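/- **Problems.** In $\mathsf{3SUM}$ one is given a set $A\subset\mathbb{Z}$ of $n$ integers (listed in arbitrary order) and has to decide whether there are pairwise distinct $a,b,c\in A$ with $a+b=c$. In $\mathsf{Convolution3SUM}$ one is given a vector $A\in\mathbb{Z}^n$, indexed by $0,1,\dots,n-1$, and has to decide whether there are indices $i,j$ (possibly equal) with $i+j\le n-1$ and $A(i)+A(j)=A(i+j)$. In both cases $n$ is the size of the instance. **Model.** Algorithms are programs of a randomized word RAM. Each word operation (addition, subtraction, multiplication, division with remainder, bitwise operations, shifts, comparisons), each memory access, each control step and the drawing of one uniformly random word costs one step. On an instance of size $n$ whose elements are $w$-bit signed integers, where $w\ge 1$ and $n<2^w$, the machine is given $n$ and $w$ in two registers and the input in its otherwise zero memory, and its words have $\kappa w$ bits, where $\kappa\ge 1$ is an integer constant of the algorithm. The program depends neither on $n$ nor on $w$. A Las Vegas algorithm for a problem gives the correct answer whenever it halts. For $T:\mathbb{N}\to[0,\infty)$ we say that a problem has randomized (Las Vegas) complexity at most $T(n)$ if some Las Vegas algorithm for it halts after at most $T(n)$ steps in expectation on every instance of size $n$, for every $n$ and every admissible $w$. **Theorem.**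 The randomized (Las Vegas) complexities of $\mathsf{3SUM}$ and $\mathsf{Convolution3SUM}$ on instances of size $n$ satisfy $$T_{3S}(n)=O(\log n\cdot T_{C3S}(n)).$$ That is, there are absolute constants $C\ge 0$ and $n_0\in\mathbb{N}$ such that for every $T:\mathbb{N}\to[0,\infty)$ for which $\mathsf{Convolution3SUM}$ has randomized complexity at most $T(n)$, there is a $T':\mathbb{N}\to[0,\infty)$ for which $\mathsf{3SUM}$ has randomized complexity at most $T'(n)$ and $T'(n)\le C\log n\cdot T(n)$ for all $n\ge n_0$. -/

import Mathlib

open scoped NNReal ENNReal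

namespace WordRAM

/-- The unit-cost binary operations on words: wrap-around addition, subtraction and multiplication,
unsigned division with remainder, bitwise operations, shifts, and the comparisons `<` (unsigned)
and `=`, which return `1` or `0`. -/
inductive BinOp where
  | add | sub | mul | div | mod | and | or | xor | shl | shr | lt | eq

/-- The value of an operation on `W`-bit words. Words are the natural numbers below `2 ^ W`, and
every result is reduced modulo `2 ^ W`. -/
def BinOp.eval (W : ℕ) (o : BinOp) (a b : ℕ) : ℕ :=
  (match o with
    | .add => a + b
    | .sub => a + (2 ^ W - b)
    | .mul => a * b
    | .div => a / b
    | .mod => a % b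
    | .and => a &&& b
    | .or => a ||| b
    | .xor => a ^^^ b
    | .shl => a <<< b
    | .shr => a >>> b
    | .lt => if a < b then 1 else 0
    | .eq => if a = b then 1 else 0) % 2 ^ W

/-- Programs of the randomized word RAM, in structured form. A program is a finite object, so it
mentions finitely many registers; it does not depend on the input length or on the word length. -/
inductive Prog where
  /-- `r_d := c` -/
  | const (d c : ℕ)
  /-- `r_d := r_a o r_b` -/
  | op (o : BinOp) (d a b : ℕ)
  /-- `r_d := M[r_a]` -/
  | load (d a : ℕ)
  /-- `M[r_a] := r_b` -/
  | store (a b : ℕ)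
  /-- `r_d :=` a fresh, uniformly random word -/
  | rand (d : ℕ)
  /-- `p; q` -/
  | seq (p q : Prog)
  /-- if `r_a ≠ 0` then `p` else `q` -/
  | ite (a : ℕ) (p q : Prog)
  /-- while `r_a ≠ 0` do `p` -/
  | loop (a : ℕ) (p : Prog)

/-- The contents of the registers and of the memory. -/
@[ext]
structure Store where
  reg : ℕ → ℕ
  mem : ℕ → ℕ

/-- Overwrite the register `r_d`. -/
def Store.setReg (s : Store) (d v : ℕ) : Store :=
  { s with reg := Function.update s.reg d v }

/-- Overwrite the memory cell `M[x]`. -/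
def Store.setMem (s : Store) (x v : ℕ) : Store :=
  { s with mem := Function.update s.mem x v }

/-- A configuration: the stack of the program pieces still to be executed, and the store. -/
abbrev Config := List Prog × Store

/-- A configuration is halted when nothing is left to be executed. -/
def Config.Halted (c : Config) : Prop := c.1 = []

/-- The uniform distribution on the `W`-bit words. -/
noncomputable def randomWord (W : ℕ) : PMF ℕ :=
  PMF.uniformOfFinset (Finset.range (2 ^ W)) ⟨0, Finset.mem_range.2 (Nat.two_pow_pos W)⟩

/-- One step of the machine with word length `W`: the distribution of the next configuration. -/
noncomputable def step (W : ℕ) : Config → PMF Config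
  | ([], s) => PMF.pure ([], s)
  | (.const d c :: k, s) => PMF.pure (k, s.setReg d (c % 2 ^ W))
  | (.op o d a b :: k, s) => PMF.pure (k, s.setReg d (o.eval W (s.reg a) (s.reg b)))
  | (.load d a :: k, s) => PMF.pure (k, s.setReg d (s.mem (s.reg a)))
  | (.store a b :: k, s) => PMF.pure (k, s.setMem (s.reg a) (s.reg b))
  | (.rand d :: k, s) => (randomWord W).map fun v => (k, s.setReg d v)
  | (.seq p q :: k, s) => PMF.pure (p :: q :: k, s)
  | (.ite a p q :: k, s) => PMF.pure (if s.reg a ≠ 0 then p :: k else q :: k, s)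
  | (.loop a p :: k, s) => PMF.pure (if s.reg a ≠ 0 then p :: .loop a p :: k else k, s)

/-- The distribution of the configuration after `t` steps from `c`. -/
noncomputable def after (W : ℕ) : ℕ → Config → PMF Config
  | 0, c => PMF.pure c
  | t + 1, c => (step W c).bind (after W t)

/-- The expected number `𝔼[T] = ∑ₜ Pr[T > t]` of steps until the machine halts, where `T > t` says
that it has not halted after `t` steps. It is `∞` if the machine runs forever with positive
probability. -/
noncomputable def expectedTime (W : ℕ) (c : Config) : ℝ≥0∞ :=
  ∑' t : ℕ, (after W t c).toOuterMeasure {c' | ¬ c'.Halted}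

/-- The start configuration of `p` with word length `W` on the input vector `A` of length `n`:
`r_0 = n`, `r_1 = w`, `M[i] = A i` in two's complement for `i < n`, everything else is `0`. -/
def start (W : ℕ) (p : Prog) (w : ℕ) {n : ℕ} (A : Fin n → ℤ) : Config :=
  ([p],
    { reg := fun r => if r = 0 then n else if r = 1 then w else 0
      mem := fun x => if h : x < n then (A ⟨x, h⟩ % 2 ^ W).toNat else 0 })

end WordRAM

/-- A decision problem about vectors of integers: its instances of size `n` and the yes-instances
among them. -/
structure DecisionProblem where
  IsInstance : ∀ n : ℕ, (Fin n → ℤ) → Prop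
  IsYes : ∀ n : ℕ, (Fin n → ℤ) → Prop

/-- `3SUM`: given a set of `n` integers, listed in any order, decide whether it has three distinct
elements `a`, `b`, `c` with `a + b = c`. -/
def threeSum : DecisionProblem where
  IsInstance _ A := Function.Injective A
  IsYes _ A := ∃ a ∈ Set.range A, ∃ b ∈ Set.range A, ∃ c ∈ Set.range A,
    a ≠ b ∧ a ≠ c ∧ b ≠ c ∧ a + b = c

/-- `Convolution3SUM`: given a vector of `n` integers with indices `0, …, n - 1`, decide whether
`A i + A j = A (i + j)` for some indices `i`, `j` such that `i + j` is an index as well. -/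
def convolutionThreeSum : DecisionProblem where
  IsInstance _ _ := True
  IsYes n A := ∃ i j k : Fin n, (i : ℕ) + (j : ℕ) = (k : ℕ) ∧ A i + A j = A k

/-- The program `p`, run with words of `κ * w` bits, is a Las Vegas algorithm for `D` with expected
running time at most `f n` on every instance of size `n`. Here `w` ranges over all numbers such that
`n` and the (signed) input numbers fit into `w` bits. Las Vegas means that the answer (yes if and
only if `r_0 ≠ 0`) is right whenever the machine halts. -/
def IsLasVegasAlgorithm (D : DecisionProblem) (p : WordRAM.Prog) (κ : ℕ) (f : ℕ → ℝ≥0) : Prop :=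
  ∀ (n w : ℕ) (A : Fin n → ℤ), D.IsInstance n A → 1 ≤ w → n < 2 ^ w →
    (∀ i, -(2 ^ (w - 1)) ≤ A i ∧ A i < 2 ^ (w - 1)) →
      (∀ t : ℕ, ∀ c ∈ (WordRAM.after (κ * w) t (WordRAM.start (κ * w) p w A)).support,
        c.Halted → (c.2.reg 0 ≠ 0 ↔ D.IsYes n A)) ∧
      WordRAM.expectedTime (κ * w) (WordRAM.start (κ * w) p w A) ≤ f n

/-- The randomized (Las Vegas) complexity of `D` on instances of size `n` is at most `f n`: some
program, on a machine whose word length is some constant multiple of `w`, achieves this bound. -/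
def LasVegasComplexityLE (D : DecisionProblem) (f : ℕ → ℝ≥0) : Prop :=
  ∃ (p : WordRAM.Prog) (κ : ℕ), 1 ≤ κ ∧ IsLasVegasAlgorithm D p κ f

namespace WordRAM

/-! ### Expected cost with a terminal penalty -/

/-- The expected cost of running the machine for at most `N` steps, where halting in the store `s`
incurs the terminal cost `F s`. -/
noncomputable def cost (W : ℕ) (F : Store → ℝ≥0∞) : ℕ → Config → ℝ≥0∞
  | 0, _ => 0
  | _ + 1, ([], s) => F s
  | N + 1, (p :: k, s) => 1 + ∑' c, step W (p :: k, s) c * cost W F N c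

section PMFsums

theorem tsum_pure_mul {α : Type*} (a : α) (g : α → ℝ≥0∞) :
    ∑' c, PMF.pure a c * g c = g a := by
  rw [tsum_eq_single a]
  · simp [PMF.pure_apply]
  · intro b hb
    simp [PMF.pure_apply, hb]

theorem tsum_bind_mul {α β : Type*} (μ : PMF α) (f : α → PMF β) (g : β → ℝ≥0∞) :
    ∑' c, μ.bind f c * g c = ∑' a, μ a * ∑' c, f a c * g c := by
  simp only [PMF.bind_apply, ← ENNReal.tsum_mul_right, ← ENNReal.tsum_mul_left]
  rw [ENNReal.tsum_comm]
  simp only [mul_assoc]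

theorem tsum_map_mul {α β : Type*} (μ : PMF α) (f : α → β) (g : β → ℝ≥0∞) :
    ∑' c, μ.map f c * g c = ∑' a, μ a * g (f a) := by
  rw [← PMF.bind_pure_comp, tsum_bind_mul]
  simp

theorem tsum_randomWord_mul (W : ℕ) (g : ℕ → ℝ≥0∞) :
    ∑' v, randomWord W v * g v = (∑ v ∈ Finset.range (2 ^ W), g v) / 2 ^ W := by
  rw [tsum_eq_sum (s := Finset.range (2 ^ W))]
  · rw [div_eq_mul_inv, Finset.sum_mul]
    refine Finset.sum_congr rfl fun v hv => ?_
    have h : randomWord W v = _ := PMF.uniformOfFinset_apply_of_mem _ hv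
    rw [h, mul_comm]
    simp
  · intro v hv
    have h : randomWord W v = _ := PMF.uniformOfFinset_apply_of_notMem _ hv
    rw [h, zero_mul]

end PMFsums

section costSteps

variable {W : ℕ} {F : Store → ℝ≥0∞} {N : ℕ} {k : List Prog} {s : Store}

theorem cost_zero (c : Config) : cost W F 0 c = 0 := by
  rw [cost]

theorem cost_nil : cost W F (N + 1) ([], s) = F s := by
  rw [cost]

theorem cost_const (d c : ℕ) :
    cost W F (N + 1) (.const d c :: k, s) = 1 + cost W F N (k, s.setReg d (c % 2 ^ W)) := by
  rw [cost, step, tsum_pure_mul]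

theorem cost_op (o : BinOp) (d a b : ℕ) : cost W F (N + 1) (.op o d a b :: k, s) =
    1 + cost W F N (k, s.setReg d (o.eval W (s.reg a) (s.reg b))) := by
  rw [cost, step, tsum_pure_mul]

theorem cost_load (d a : ℕ) : cost W F (N + 1) (.load d a :: k, s) =
    1 + cost W F N (k, s.setReg d (s.mem (s.reg a))) := by
  rw [cost, step, tsum_pure_mul]

theorem cost_store (a b : ℕ) : cost W F (N + 1) (.store a b :: k, s) =
    1 + cost W F N (k, s.setMem (s.reg a) (s.reg b)) := by
  rw [cost, step, tsum_pure_mul]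

theorem cost_rand (d : ℕ) : cost W F (N + 1) (.rand d :: k, s) =
    1 + (∑ v ∈ Finset.range (2 ^ W), cost W F N (k, s.setReg d v)) / 2 ^ W := by
  rw [cost, step, tsum_map_mul, tsum_randomWord_mul]

theorem cost_seq (p q : Prog) : cost W F (N + 1) (.seq p q :: k, s) =
    1 + cost W F N (p :: q :: k, s) := by
  rw [cost, step, tsum_pure_mul]

theorem cost_ite (a : ℕ) (p q : Prog) : cost W F (N + 1) (.ite a p q :: k, s) =
    1 + cost W F N (if s.reg a ≠ 0 then p :: k else q :: k, s) := by
  rw [cost, step, tsum_pure_mul]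

theorem cost_loop (a : ℕ) (p : Prog) : cost W F (N + 1) (.loop a p :: k, s) =
    1 + cost W F N (if s.reg a ≠ 0 then p :: .loop a p :: k else k, s) := by
  rw [cost, step, tsum_pure_mul]

theorem cost_le_succ : ∀ (N : ℕ) (c : Config), cost W F N c ≤ cost W F (N + 1) c
  | 0, c => by simp [cost_zero]
  | N + 1, ([], s) => by simp [cost_nil]
  | N + 1, (p :: k, s) => by
    rw [cost, cost]
    gcongr with c
    exact cost_le_succ N c

theorem cost_mono (c : Config) : Monotone fun N => cost W F N c :=
  monotone_nat_of_le_succ fun N => cost_le_succ N c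

end costSteps

section adequacy

variable {W : ℕ}

/-- The expected number of steps among the first `N`. -/
noncomputable def truncTime (W N : ℕ) (c : Config) : ℝ≥0∞ :=
  ∑ t ∈ Finset.range N, (after W t c).toOuterMeasure {c' | ¬ c'.Halted}

theorem toOuterMeasure_bind_eq {α β : Type*} (μ : PMF α) (f : α → PMF β) (S : Set β) :
    (μ.bind f).toOuterMeasure S = ∑' a, μ a * (f a).toOuterMeasure S :=
  PMF.toOuterMeasure_bind_apply μ f S

theorem after_nil (t : ℕ) (s : Store) : after W t ([], s) = PMF.pure ([], s) := by
  induction t with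
  | zero => rfl
  | succ t ih => rw [after, step, PMF.pure_bind, ih]

theorem truncTime_nil (N : ℕ) (s : Store) : truncTime W N ([], s) = 0 := by
  refine Finset.sum_eq_zero fun t _ => ?_
  rw [after_nil, PMF.toOuterMeasure_pure_apply]
  simp [Config.Halted]

theorem truncTime_succ (N : ℕ) (p : Prog) (k : List Prog) (s : Store) :
    truncTime W (N + 1) (p :: k, s) = 1 + ∑' c, step W (p :: k, s) c * truncTime W N c := by
  rw [truncTime, Finset.sum_range_succ', add_comm]
  congr 1
  · rw [after, PMF.toOuterMeasure_pure_apply]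
    simp [Config.Halted]
  · simp only [truncTime, Finset.mul_sum]
    rw [Summable.tsum_finsetSum (fun _ _ => ENNReal.summable)]
    refine Finset.sum_congr rfl fun t _ => ?_
    rw [after, toOuterMeasure_bind_eq]

theorem expectedTime_eq_iSup (c : Config) : expectedTime W c = ⨆ N, truncTime W N c :=
  ENNReal.tsum_eq_iSup_nat

/-- All configurations reachable from `c` that have halted satisfy `P`. -/
def Safe (W : ℕ) (P : Store → Prop) (c : Config) : Prop :=
  ∀ t : ℕ, ∀ c' ∈ (after W t c).support, c'.Halted → P c'.2

theorem Safe.step {P : Store → Prop} {c c' : Config} (h : Safe W P c)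
    (hc : c' ∈ (step W c).support) : Safe W P c' := by
  intro t c'' hc'' hh
  refine h (t + 1) c'' ?_ hh
  rw [after, PMF.mem_support_bind_iff]
  exact ⟨c', hc, hc''⟩

open Classical in
/-- The terminal cost that forbids to halt outside of `P`. -/
noncomputable def penalty (P : Store → Prop) (s : Store) : ℝ≥0∞ := if P s then 0 else ⊤

/-- On a safe configuration the penalty is never incurred, so only the steps are counted. -/
theorem cost_le_truncTime {P : Store → Prop} : ∀ (N : ℕ) (c : Config), Safe W P c →
    cost W (penalty P) N c ≤ truncTime W N c
  | 0, c, _ => by simp [cost_zero]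
  | N + 1, ([], s), h => by
    have : P s := h 0 ([], s) (by simp [after]) rfl
    simp [cost_nil, penalty, this]
  | N + 1, (p :: k, s), h => by
    rw [cost, truncTime_succ]
    gcongr 1 + ?_
    refine ENNReal.tsum_le_tsum fun c => ?_
    by_cases hc : c ∈ (step W (p :: k, s)).support
    · gcongr
      exact cost_le_truncTime N c (h.step hc)
    · rw [PMF.mem_support_iff, not_not] at hc
      simp [hc]

theorem truncTime_le_cost {F : Store → ℝ≥0∞} : ∀ (N : ℕ) (c : Config),
    truncTime W N c ≤ cost W F N c
  | 0, c => by simp [truncTime]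
  | N + 1, ([], s) => by simp [truncTime_nil]
  | N + 1, (p :: k, s) => by
    rw [cost, truncTime_succ]
    gcongr with c
    exact truncTime_le_cost N c

/-- A wrong halting configuration of positive probability contributes a positive multiple of `⊤`, so
finiteness of the cost already excludes wrong answers. -/
theorem cost_eq_top {P : Store → Prop} : ∀ (t : ℕ) (c c' : Config),
    c' ∈ (after W t c).support → c'.Halted → ¬ P c'.2 → cost W (penalty P) (t + 1) c = ⊤
  | t, ([], s), c', hc, hh, hP => by
    rw [after_nil] at hc
    obtain rfl : c' = ([], s) := by simpa using hc
    rw [cost_nil, penalty, if_neg hP]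
  | 0, (p :: k, s), c', hc, hh, hP => by
    obtain rfl : c' = (p :: k, s) := by simpa [after] using hc
    simp [Config.Halted] at hh
  | t + 1, (p :: k, s), c', hc, hh, hP => by
    rw [after, PMF.mem_support_bind_iff] at hc
    obtain ⟨c1, h1, h2⟩ := hc
    rw [cost, ENNReal.add_eq_top]
    right
    refine ENNReal.tsum_eq_top_of_eq_top ⟨c1, ?_⟩
    rw [cost_eq_top t c1 c' h2 hh hP, ENNReal.mul_top]
    rwa [PMF.mem_support_iff] at h1

/-- This direction is applied to the given algorithm, the next lemma to the one that is constructed.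
-/
theorem cost_penalty_le {P : Store → Prop} {c : Config} {B : ℝ≥0∞} (hs : Safe W P c)
    (ht : expectedTime W c ≤ B) (N : ℕ) : cost W (penalty P) N c ≤ B := by
  refine (cost_le_truncTime N c hs).trans (le_trans ?_ ht)
  rw [expectedTime_eq_iSup]
  exact le_iSup (fun N => truncTime W N c) N

theorem safe_and_expectedTime_le {P : Store → Prop} {c : Config} {B : ℝ≥0∞} (hB : B ≠ ⊤)
    (h : ∀ N, cost W (penalty P) N c ≤ B) : Safe W P c ∧ expectedTime W c ≤ B := by
  constructor
  · intro t c' hc' hh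
    by_contra hP
    have := h (t + 1)
    rw [cost_eq_top t c c' hc' hh hP, top_le_iff] at this
    exact hB this
  · rw [expectedTime_eq_iSup]
    exact iSup_le fun N => (truncTime_le_cost N c).trans (h N)

end adequacy

/-! ### Program logic in continuation-passing form -/

section Spec

/-- Started in `s`, the program `p` ends in a store that satisfies `Q`, and it takes at most `τ`
steps in expectation; in continuation-passing form. -/
def Spec (W : ℕ) (p : Prog) (s : Store) (Q : Store → Prop) (τ : ℕ) : Prop :=
  ∀ (F : Store → ℝ≥0∞) (k : List Prog) (N : ℕ) (B : ℝ≥0∞),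
    (∀ s', Q s' → cost W F N (k, s') ≤ B) → cost W F N (p :: k, s) ≤ τ + B

/-- A variant of `Spec` that records that at least one step is taken. -/
def StrictSpec (W : ℕ) (p : Prog) (s : Store) (Q : Store → Prop) (τ : ℕ) : Prop :=
  ∀ (F : Store → ℝ≥0∞) (k : List Prog) (N : ℕ) (B : ℝ≥0∞),
    (∀ s', Q s' → cost W F N (k, s') ≤ B) → cost W F (N + 1) (p :: k, s) ≤ τ + B

variable {W : ℕ} {s : Store} {p q : Prog} {Q Q' : Store → Prop} {τ τ' : ℕ}

theorem Spec.mono (h : Spec W p s Q τ) (hQ : ∀ s', Q s' → Q' s') (hτ : τ ≤ τ') :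
    Spec W p s Q' τ' := fun F k N B hB =>
  (h F k N B fun s' hs' => hB s' (hQ s' hs')).trans (by gcongr)

theorem StrictSpec.spec (h : StrictSpec W p s Q τ) : Spec W p s Q τ := fun F k N B hB =>
  (cost_mono _ N.le_succ).trans (h F k N B hB)

theorem StrictSpec.mono (h : StrictSpec W p s Q τ) (hQ : ∀ s', Q s' → Q' s') (hτ : τ ≤ τ') :
    StrictSpec W p s Q' τ' := fun F k N B hB =>
  (h F k N B fun s' hs' => hB s' (hQ s' hs')).trans (by gcongr)

theorem strictSpec_const (d c : ℕ) :
    StrictSpec W (.const d c) s (fun s' => s' = s.setReg d (c % 2 ^ W)) 1 := fun F k N B hB => by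
  rw [cost_const]
  gcongr
  · simp
  · exact hB _ rfl

theorem strictSpec_op (o : BinOp) (d a b : ℕ) : StrictSpec W (.op o d a b) s
    (fun s' => s' = s.setReg d (o.eval W (s.reg a) (s.reg b))) 1 := fun F k N B hB => by
  rw [cost_op]
  gcongr
  · simp
  · exact hB _ rfl

theorem strictSpec_load (d a : ℕ) : StrictSpec W (.load d a) s
    (fun s' => s' = s.setReg d (s.mem (s.reg a))) 1 := fun F k N B hB => by
  rw [cost_load]
  gcongr
  · simp
  · exact hB _ rfl

theorem strictSpec_store (a b : ℕ) : StrictSpec W (.store a b) s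
    (fun s' => s' = s.setMem (s.reg a) (s.reg b)) 1 := fun F k N B hB => by
  rw [cost_store]
  gcongr
  · simp
  · exact hB _ rfl

theorem StrictSpec.seq {M : Store → Prop} (h : Spec W p s M τ) (h' : ∀ s', M s' → Spec W q s' Q τ') :
    StrictSpec W (.seq p q) s Q (1 + τ + τ') := fun F k N B hB => by
  rw [cost_seq]
  push_cast
  rw [add_assoc, add_assoc]
  gcongr
  exact h F _ N _ fun s' hs' => h' s' hs' F k N B hB

theorem Spec.seq {M : Store → Prop} (h : Spec W p s M τ) (h' : ∀ s', M s' → Spec W q s' Q τ') :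
    Spec W (.seq p q) s Q (1 + τ + τ') :=
  (StrictSpec.seq h h').spec

theorem StrictSpec.ite {a : ℕ} (h : s.reg a ≠ 0 → Spec W p s Q τ)
    (h' : s.reg a = 0 → Spec W q s Q τ) : StrictSpec W (.ite a p q) s Q (1 + τ) :=
  fun F k N B hB => by
    rw [cost_ite]
    push_cast
    rw [add_assoc]
    gcongr
    split_ifs with h0
    · exact h h0 F k N B hB
    · exact h' (not_not.1 h0) F k N B hB

theorem Spec.loop_zero {a : ℕ} (h : s.reg a = 0) : Spec W (.loop a p) s (fun s' => s' = s) 1 := by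
  refine StrictSpec.spec fun F k N B hB => ?_
  rw [cost_loop, if_neg (not_not.2 h)]
  gcongr
  · simp
  · exact hB _ rfl

theorem Spec.loop_succ {a : ℕ} {M : Store → Prop} (h : s.reg a ≠ 0) (hp : Spec W p s M τ)
    (h' : ∀ s', M s' → Spec W (.loop a p) s' Q τ') : Spec W (.loop a p) s Q (1 + τ + τ') := by
  refine StrictSpec.spec fun F k N B hB => ?_
  rw [cost_loop, if_pos h]
  push_cast
  rw [add_assoc, add_assoc]
  gcongr
  exact hp F _ N _ fun s' hs' => h' s' hs' F k N B hB

end Spec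

end WordRAM

/-! ### Abstract states, expressions and structured programs -/

namespace WordRAM

theorem BinOp.eval_lt (W : ℕ) (o : BinOp) (a b : ℕ) : o.eval W a b < 2 ^ W :=
  Nat.mod_lt _ (Nat.two_pow_pos W)

/-- Abstract states: variables, kept in the first 32 registers, and arrays. -/
structure HS where
  v : ℕ → ℕ
  a : ℕ → ℕ → ℕ

/-- Overwrite a variable. -/
def HS.setV (H : HS) (x c : ℕ) : HS := { H with v := Function.update H.v x c }

/-- Overwrite an entry of an array. -/
def HS.setA (H : HS) (j i c : ℕ) : HS :=
  { H with a := Function.update H.a j (Function.update (H.a j) i c) }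

@[simp] theorem HS.setV_v (H : HS) (x c y : ℕ) :
    (H.setV x c).v y = if y = x then c else H.v y := Function.update_apply ..

@[simp] theorem HS.setV_a (H : HS) (x c : ℕ) : (H.setV x c).a = H.a := rfl

@[simp] theorem HS.setA_v (H : HS) (j i c : ℕ) : (H.setA j i c).v = H.v := rfl

@[simp] theorem HS.setA_a (H : HS) (j i c j' i' : ℕ) :
    (H.setA j i c).a j' i' = if j' = j ∧ i' = i then c else H.a j' i' := by
  by_cases hj : j' = j
  · subst hj
    simp [HS.setA, Function.update_apply]
  · simp [HS.setA, hj]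

/-- The store `s` represents the abstract state `H`: there are eight arrays of `S` cells each, and
variable `2` holds `S`. -/
structure Abs (W S : ℕ) (s : Store) (H : HS) : Prop where
  reg : ∀ r < 32, s.reg r = H.v r
  mem : ∀ j < 8, ∀ i < S, s.mem (j * S + i) = H.a j i
  v_lt : ∀ r < 32, H.v r < 2 ^ W
  a_lt : ∀ j < 8, ∀ i < S, H.a j i < 2 ^ W
  base : H.v 2 = S
  le : 8 * S ≤ 2 ^ W

/-- Expressions over abstract states. -/
inductive Ex where
  | lit (c : ℕ)
  | var (x : ℕ)
  | bin (o : BinOp) (a b : Ex)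
  | arr (j : ℕ) (e : Ex)

namespace Ex

/-- The value of an expression. -/
def eval (W : ℕ) (H : HS) : Ex → ℕ
  | lit c => c % 2 ^ W
  | var x => H.v x
  | bin o a b => o.eval W (a.eval W H) (b.eval W H)
  | arr j e => H.a j (e.eval W H)

/-- Variables and array accesses are in range. -/
def Ok (W S : ℕ) (H : HS) : Ex → Prop
  | lit _ => True
  | var x => x < 32
  | bin _ a b => a.Ok W S H ∧ b.Ok W S H
  | arr j e => j < 8 ∧ e.Ok W S H ∧ e.eval W H < S

/-- The program that evaluates an expression into register `d`, using registers above as scratch. -/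
def code : Ex → ℕ → Prog
  | lit c, d => .const d c
  | var x, d => .op .or d x x
  | bin o a b, d => .seq (a.code d) (.seq (b.code (d + 1)) (.op o d d (d + 1)))
  | arr j e, d => .seq (e.code d) (.seq (.const (d + 1) j)
      (.seq (.op .mul (d + 1) (d + 1) 2) (.seq (.op .add d d (d + 1)) (.load d d))))

/-- The number of steps of the evaluation. -/
def time : Ex → ℕ
  | lit _ => 1
  | var _ => 1
  | bin _ a b => a.time + b.time + 3
  | arr _ e => e.time + 8

end Ex

variable {W S : ℕ} {s : Store} {H : HS}

theorem Abs.congr {s' : Store} (h : Abs W S s H) (hr : ∀ r < 32, s'.reg r = s.reg r)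
    (hm : s'.mem = s.mem) : Abs W S s' H where
  reg r hr' := by rw [hr r hr', h.reg r hr']
  mem j hj i hi := by rw [hm, h.mem j hj i hi]
  v_lt := h.v_lt
  a_lt := h.a_lt
  base := h.base
  le := h.le

theorem Abs.eval_lt (h : Abs W S s H) : ∀ {e : Ex}, e.Ok W S H → e.eval W H < 2 ^ W
  | .lit _, _ => Nat.mod_lt _ (Nat.two_pow_pos W)
  | .var x, hx => h.v_lt x hx
  | .bin .., _ => BinOp.eval_lt ..
  | .arr j _, he => h.a_lt j he.1 _ he.2.2

/-- The eight arrays fit into the address space, so address arithmetic never wraps around. -/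
theorem addr_lt {j i : ℕ} (h8 : 8 * S ≤ 2 ^ W) (hj : j < 8) (hi : i < S) :
    j * S + i < 2 ^ W ∧ j * S < 2 ^ W ∧ i < 2 ^ W ∧ j < 2 ^ W := by
  have h1 : j * S + S ≤ 8 * S := by
    have : (j + 1) * S ≤ 8 * S := Nat.mul_le_mul_right _ hj
    linarith
  have : j ≤ j * S := Nat.le_mul_of_pos_right _ (by omega)
  omega

@[simp] theorem Store.setReg_reg (s : Store) (d c r : ℕ) :
    (s.setReg d c).reg r = if r = d then c else s.reg r := Function.update_apply ..

@[simp] theorem Store.setReg_mem (s : Store) (d c : ℕ) : (s.setReg d c).mem = s.mem := rfl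

@[simp] theorem Store.setMem_mem (s : Store) (d c r : ℕ) :
    (s.setMem d c).mem r = if r = d then c else s.mem r := Function.update_apply ..

@[simp] theorem Store.setMem_reg (s : Store) (d c : ℕ) : (s.setMem d c).reg = s.reg := rfl

/-- Scratch registers start at 32, above all variables, so evaluation does not touch the abstract
state. The second operand is evaluated one register higher, which preserves the first. -/
theorem Ex.code_spec : ∀ (e : Ex) (d : ℕ) (s : Store), 32 ≤ d → Abs W S s H → e.Ok W S H →
    Spec W (e.code d) s (fun s' => s'.mem = s.mem ∧ (∀ r < d, s'.reg r = s.reg r) ∧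
      s'.reg d = e.eval W H) e.time
  | .lit c, d, s, hd, hs, ho => by
    refine (strictSpec_const d c).spec.mono ?_ le_rfl
    rintro _ rfl
    refine ⟨rfl, fun r hr => ?_, by simp [eval]⟩
    simp [hr.ne]
  | .var x, d, s, hd, hs, ho => by
    refine (strictSpec_op .or d x x).spec.mono ?_ le_rfl
    rintro _ rfl
    refine ⟨rfl, fun r hr => by simp [hr.ne], ?_⟩
    have h1 : s.reg x = H.v x := hs.reg x ho
    simp [eval, BinOp.eval, h1, Nat.mod_eq_of_lt (hs.v_lt x ho)]
  | .bin o a b, d, s, hd, hs, ho => by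
    refine (Spec.seq (a.code_spec d s hd hs ho.1) (τ' := b.time + 2) ?_).mono (fun _ h => h)
      (by simp [time]; omega)
    rintro s1 ⟨hm1, hr1, hv1⟩
    have hs1 : Abs W S s1 H := hs.congr (fun r hr => hr1 r (by omega)) hm1
    refine (Spec.seq (b.code_spec (d + 1) s1 (by omega) hs1 ho.2) (τ' := 1) ?_).mono (fun _ h => h)
      (by omega)
    rintro s2 ⟨hm2, hr2, hv2⟩
    refine (strictSpec_op o d d (d + 1)).spec.mono ?_ le_rfl
    rintro _ rfl
    refine ⟨by simp [hm2, hm1], fun r hr => ?_, ?_⟩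
    · simp [hr.ne, hr2 r (by omega), hr1 r hr]
    · simp [eval, hv2, hr2 d (by omega), hv1]
  | .arr j e, d, s, hd, hs, ho => by
    obtain ⟨hj, hoe, hi⟩ := ho
    obtain ⟨l1, l2, l3, l4⟩ := addr_lt hs.le hj hi
    refine (Spec.seq (e.code_spec d s hd hs hoe) (τ' := 7) ?_).mono (fun _ h => h)
      (by simp [time]; omega)
    rintro s1 ⟨hm1, hr1, hv1⟩
    have hb : s1.reg 2 = S := by rw [hr1 2 (by omega), hs.reg 2 (by omega), hs.base]
    refine (Spec.seq (strictSpec_const (d + 1) j).spec (τ' := 5) ?_)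
    rintro _ rfl
    refine (Spec.seq (strictSpec_op .mul (d + 1) (d + 1) 2).spec (τ' := 3) ?_)
    rintro _ rfl
    refine (Spec.seq (strictSpec_op .add d d (d + 1)).spec (τ' := 1) ?_)
    rintro _ rfl
    refine (strictSpec_load d d).spec.mono ?_ le_rfl
    rintro _ rfl
    have h2 : (2 : ℕ) ≠ d + 1 := by omega
    refine ⟨by simp [hm1], fun r hr => ?_, ?_⟩
    · have h3 : r ≠ d + 1 := by omega
      simp [hr.ne, h3, hr1 r hr]
    · simp [eval, BinOp.eval, h2, hb, hv1, hm1, Nat.mod_eq_of_lt l4, Nat.mod_eq_of_lt l2]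
      rw [add_comm, Nat.mod_eq_of_lt l1, hs.mem j hj _ hi]

/-- Started in a store that represents `H`, the program ends in a store that represents a state in
`Q`, after at most `τ` steps in expectation. -/
def HSpec (W S : ℕ) (p : Prog) (H : HS) (Q : HS → Prop) (τ : ℕ) : Prop :=
  ∀ s, Abs W S s H → Spec W p s (fun s' => ∃ H', Abs W S s' H' ∧ Q H') τ

/-- `x := e` -/
def asg (x : ℕ) (e : Ex) : Prog := .seq (e.code 32) (.op .or x 32 32)

/-- `a_j[e] := e'` -/
def put (j : ℕ) (e e' : Ex) : Prog := .seq (e.code 32) (.seq (e'.code 33) (.seq (.const 34 j)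
  (.seq (.op .mul 34 34 2) (.seq (.op .add 32 32 34) (.store 32 33)))))

/-- if `e ≠ 0` then `p` else `q` -/
def cond (e : Ex) (p q : Prog) : Prog := .seq (e.code 32) (.ite 32 p q)

/-- while `e ≠ 0` do `p` -/
def whileDo (e : Ex) (p : Prog) : Prog := .seq (e.code 32) (.loop 32 (.seq p (e.code 32)))

/-- for `x := 0, …, e - 1` do `p` -/
def forDo (x : ℕ) (e : Ex) (p : Prog) : Prog :=
  .seq (asg x (.lit 0)) (whileDo (.bin .lt (.var x) e)
    (.seq p (asg x (.bin .add (.var x) (.lit 1)))))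

variable {p q : Prog} {Q Q' : HS → Prop} {τ τ' : ℕ}

theorem HSpec.mono (h : HSpec W S p H Q τ) (hQ : ∀ H', Q H' → Q' H') (hτ : τ ≤ τ') :
    HSpec W S p H Q' τ' := fun s hs =>
  (h s hs).mono (fun _ ⟨H', h1, h2⟩ => ⟨H', h1, hQ H' h2⟩) hτ

theorem HSpec.seq {M : HS → Prop} (h : HSpec W S p H M τ)
    (h' : ∀ H', M H' → HSpec W S q H' Q τ') : HSpec W S (.seq p q) H Q (1 + τ + τ') := fun s hs =>
  Spec.seq (h s hs) fun s' ⟨H', h1, h2⟩ => h' H' h2 s' h1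

theorem HSpec.cond {e : Ex} (he : e.Ok W S H) (h : e.eval W H ≠ 0 → HSpec W S p H Q τ)
    (h' : e.eval W H = 0 → HSpec W S q H Q τ) :
    HSpec W S (cond e p q) H Q (2 + e.time + τ) := fun s hs => by
  refine (Spec.seq (e.code_spec 32 s le_rfl hs he) (τ' := 1 + τ) ?_).mono (fun _ h => h) (by omega)
  rintro s1 ⟨hm, hr, hv⟩
  have hs1 : Abs W S s1 H := hs.congr hr hm
  exact (StrictSpec.ite (fun h0 => h (hv ▸ h0) s1 hs1) (fun h0 => h' (hv ▸ h0) s1 hs1)).spec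

theorem Abs.setV {x c : ℕ} (hs : Abs W S s H) (hx : x ≠ 2) (hc : c < 2 ^ W) :
    Abs W S (s.setReg x c) (H.setV x c) where
  reg r hr := by
    by_cases h : r = x
    · simp [h]
    · simp [h, hs.reg r hr]
  mem := hs.mem
  v_lt r hr := by
    by_cases h : r = x
    · simp [h, hc]
    · simp [h, hs.v_lt r hr]
  a_lt := hs.a_lt
  base := by simp [hx.symm, hs.base]
  le := hs.le

theorem HSpec.asg {x : ℕ} {e : Ex} (he : e.Ok W S H) (hx2 : x ≠ 2)
    (hQ : Q (H.setV x (e.eval W H))) : HSpec W S (asg x e) H Q (2 + e.time) := fun s hs => by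
  refine (Spec.seq (e.code_spec 32 s le_rfl hs he) (τ' := 1) ?_).mono (fun _ h => h) (by omega)
  rintro s1 ⟨hm, hr, hv⟩
  have hs1 : Abs W S s1 H := hs.congr hr hm
  refine (strictSpec_op .or x 32 32).spec.mono ?_ le_rfl
  rintro _ rfl
  refine ⟨_, ?_, hQ⟩
  simp only [hv, BinOp.eval, Nat.or_self, Nat.mod_eq_of_lt (hs.eval_lt he)]
  exact hs1.setV hx2 (hs.eval_lt he)

/-- As `i < S`, the address `j * S + i` determines `j` and `i`, so the store changes one abstract
entry only. The strict form is needed in the simulation, where each simulated instruction must use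
up at least one unit of the step budget. -/
theorem strict_put {j : ℕ} {e e' : Ex} (hs : Abs W S s H) (he : e.Ok W S H) (he' : e'.Ok W S H)
    (hj : j < 8) (hi : e.eval W H < S) (hQ : Q (H.setA j (e.eval W H) (e'.eval W H))) :
    StrictSpec W (put j e e') s (fun s' => ∃ H', Abs W S s' H' ∧ Q H') (9 + e.time + e'.time) := by
  obtain ⟨l1, l2, l3, l4⟩ := addr_lt hs.le hj hi
  refine (StrictSpec.seq (e.code_spec 32 s le_rfl hs he) (τ' := e'.time + 8) ?_).mono
    (fun _ h => h) (by omega)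
  rintro s1 ⟨hm1, hr1, hv1⟩
  have hs1 : Abs W S s1 H := hs.congr hr1 hm1
  refine (Spec.seq (e'.code_spec 33 s1 (by omega) hs1 he') (τ' := 7) ?_).mono (fun _ h => h)
    (by omega)
  rintro s2 ⟨hm2, hr2, hv2⟩
  have hs2 : Abs W S s2 H := hs1.congr (fun r hr => hr2 r (by omega)) hm2
  have hb : s2.reg 2 = S := by rw [hs2.reg 2 (by omega), hs2.base]
  refine (Spec.seq (strictSpec_const 34 j).spec (τ' := 5) ?_)
  rintro _ rfl
  refine (Spec.seq (strictSpec_op .mul 34 34 2).spec (τ' := 3) ?_)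
  rintro _ rfl
  refine (Spec.seq (strictSpec_op .add 32 32 34).spec (τ' := 1) ?_)
  rintro _ rfl
  refine (strictSpec_store 32 33).spec.mono ?_ le_rfl
  rintro _ rfl
  refine ⟨_, ?_, hQ⟩
  have hv : e.eval W H + j * S < 2 ^ W := by omega
  simp only [Store.setReg_reg, BinOp.eval, hb, hv2, hr2 32 (by omega), hv1, Nat.reduceEqDiff,
    if_true, if_false, Nat.mod_eq_of_lt l4, Nat.mod_eq_of_lt l2, Nat.mod_eq_of_lt hv]
  constructor
  · intro r hr
    have h32 : r ≠ 32 := by omega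
    have h34 : r ≠ 34 := by omega
    simp [h32, h34, hs2.reg r hr]
  · intro j' hj' i' hi'
    simp only [Store.setMem_mem, Store.setReg_mem, HS.setA_a]
    have hiff : j' * S + i' = e.eval W H + j * S ↔ j' = j ∧ i' = e.eval W H := by
      constructor
      · intro h
        have h1 : (j' * S + i') / S = (e.eval W H + j * S) / S := by rw [h]
        rw [Nat.add_mul_div_right _ _ (by omega), Nat.div_eq_of_lt hi, mul_comm,
          Nat.mul_add_div (by omega), Nat.div_eq_of_lt hi'] at h1
        have : j' = j := by omega
        subst this
        omega
      · rintro ⟨rfl, rfl⟩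
        ring
    simp only [hiff, hs2.mem j' hj' i' hi']
  · exact hs.v_lt
  · intro j' hj' i' hi'
    rw [HS.setA_a]
    split_ifs
    · exact hs.eval_lt he'
    · exact hs.a_lt j' hj' i' hi'
  · exact hs.base
  · exact hs.le

theorem HSpec.put {j : ℕ} {e e' : Ex} (he : e.Ok W S H) (he' : e'.Ok W S H)
    (hj : j < 8) (hi : e.eval W H < S) (hQ : Q (H.setA j (e.eval W H) (e'.eval W H))) :
    HSpec W S (put j e e') H Q (9 + e.time + e'.time) := fun _ hs =>
  (strict_put hs he he' hj hi hQ).spec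

/-- The index `f` of the invariant bounds the number of iterations that are left. An execution of
the body must lower it by one. -/
theorem HSpec.whileDo {e : Ex} (I : ℕ → HS → Prop) (he : ∀ f H, I f H → e.Ok W S H)
    (h : ∀ f H, I f H → e.eval W H ≠ 0 → ∃ f', f = f' + 1 ∧ HSpec W S p H (I f') τ)
    (f : ℕ) (hI : I f H) :
    HSpec W S (whileDo e p) H (fun H' => (∃ f', I f' H') ∧ e.eval W H' = 0)
      (f * (τ + e.time + 2) + e.time + 2) := fun s hs => by
  have key : ∀ f H s, I f H → Abs W S s H → s.reg 32 = e.eval W H →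
      Spec W (.loop 32 (.seq p (e.code 32))) s
        (fun s' => ∃ H', Abs W S s' H' ∧ (∃ f', I f' H') ∧ e.eval W H' = 0)
        (f * (τ + e.time + 2) + 1) := by
    intro f
    induction f with
    | zero =>
      intro H s hI hs hr
      by_cases h0 : e.eval W H = 0
      · refine (Spec.loop_zero (hr.trans h0)).mono ?_ (by omega)
        rintro _ rfl
        exact ⟨H, hs, ⟨_, hI⟩, h0⟩
      · obtain ⟨f', hf', -⟩ := h 0 H hI h0
        omega
    | succ f ih =>
      intro H s hI hs hr
      by_cases h0 : e.eval W H = 0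
      · refine (Spec.loop_zero (hr.trans h0)).mono ?_ (by omega)
        rintro _ rfl
        exact ⟨H, hs, ⟨_, hI⟩, h0⟩
      · obtain ⟨f', hf', hp⟩ := h _ H hI h0
        obtain rfl : f' = f := by omega
        refine (Spec.loop_succ (hr.trans_ne h0) (τ := 1 + τ + e.time)
          (M := fun s' => ∃ H', Abs W S s' H' ∧ I f' H' ∧ s'.reg 32 = e.eval W H')
          ?_ fun s' ⟨H', h1, h2, h3⟩ => ih H' s' h2 h1 h3).mono (fun _ h => h) (by
            rw [add_mul]; omega)
        refine (Spec.seq (hp s hs) fun s' ⟨H', h1, h2⟩ =>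
          (e.code_spec 32 s' le_rfl h1 (he _ _ h2)).mono (Q' := _) ?_ le_rfl)
        rintro s2 ⟨hm, hr, hv⟩
        exact ⟨H', h1.congr hr hm, h2, hv⟩
  refine (Spec.seq (e.code_spec 32 s le_rfl hs (he _ _ hI)) fun s' ⟨hm, hr, hv⟩ =>
    key f H s' hI (hs.congr hr hm) hv).mono (fun _ h => h) (by omega)

theorem HSpec.forDo {x : ℕ} {e : Ex} (n : ℕ) (I : ℕ → HS → Prop) (hx : x < 32) (hx2 : x ≠ 2)
    (hn : n < 2 ^ W) (h0 : I 0 (H.setV x 0))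
    (he : ∀ i H, I i H → H.v x = i ∧ e.Ok W S H ∧ e.eval W H = n)
    (h : ∀ i < n, ∀ H, I i H → HSpec W S p H (fun H' => H'.v x = i ∧ I (i + 1) (H'.setV x (i + 1))) τ) :
    HSpec W S (forDo x e p) H (I n) (n * (τ + e.time + 14) + e.time + 10) := by
  refine (HSpec.seq (M := I 0) (HSpec.asg (e := .lit 0) trivial hx2 (by simpa [Ex.eval] using h0)) fun H1 h1 =>
    (HSpec.whileDo (p := .seq p (WordRAM.asg x (.bin .add (.var x) (.lit 1)))) (e := .bin .lt (.var x) e)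
      (τ := τ + 8) (fun f H => ∃ i, i + f = n ∧ I i H) ?_ ?_ n ⟨0, by omega, h1⟩)).mono
      (fun H' => ?_) ?_
  · rintro f H ⟨i, -, hi⟩
    exact ⟨hx, (he i H hi).2.1⟩
  · rintro f H ⟨i, hf, hi⟩ hlt
    obtain ⟨e1, e2, e3⟩ := he i H hi
    simp only [Ex.eval, BinOp.eval, e1, e3] at hlt
    have hin : i < n := by
      by_contra hc
      simp [hc] at hlt
    obtain ⟨f', rfl⟩ : ∃ f', f = f' + 1 := ⟨f - 1, by omega⟩
    refine ⟨f', rfl, (HSpec.seq (h i hin H hi) fun H' h' => HSpec.asg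
      (e := .bin .add (.var x) (.lit 1)) ⟨hx, trivial⟩ hx2 ?_).mono
      (fun _ h => h) (by simp [Ex.time]; omega)⟩
    refine ⟨i + 1, by omega, ?_⟩
    have hW : 1 < 2 ^ W := by omega
    have h3 : (i + 1) % 2 ^ W = i + 1 := Nat.mod_eq_of_lt (by omega)
    simpa [Ex.eval, BinOp.eval, h'.1, h3, Nat.mod_eq_of_lt hW] using h'.2
  · rintro ⟨⟨f', i, hf, hi⟩, h0⟩
    obtain ⟨e1, e2, e3⟩ := he i H' hi
    simp only [Ex.eval, BinOp.eval, e1, e3] at h0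
    have hin : ¬ i < n := by
      intro hc
      have hW : 1 < 2 ^ W := by omega
      rw [if_pos hc, Nat.mod_eq_of_lt hW] at h0
      omega
    obtain rfl : i = n := by omega
    exact hi
  · simp only [Ex.time]
    have : n * (τ + 8 + (1 + e.time + 3) + 2) ≤ n * (τ + e.time + 14) :=
      Nat.mul_le_mul_left _ (by omega)
    omega

/-- The claimed bound `X = 2 * τ + 7 + B` reproduces itself: three steps for loop test, sequencing
and draw, then `τ` for the body, then `1 + B` after a success and `X` after a failure, which has
probability at most one half. The induction runs over the truncation, where the cost is known to be
finite and nothing has to be assumed about termination. -/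
theorem HSpec.retry {f d : ℕ} (I : HS → Prop) (Good : ℕ → Prop) [DecidablePred Good]
    (hd2 : d ≠ 2) (hf : f < 32)
    (hG : 2 ^ W ≤ 2 * ((Finset.range (2 ^ W)).filter Good).card)
    (hIf : ∀ H, I H → H.v f ≠ 0)
    (h : ∀ H, I H → ∀ c < 2 ^ W, HSpec W S p (H.setV d c)
      (fun H' => if Good c then H'.v f = 0 ∧ Q H' else I H') τ) (hI : I H) :
    HSpec W S (.loop f (.seq (.rand d) p)) H Q (2 * τ + 7) := by
  intro s hs F k N B hB
  have key : ∀ M ≤ N, ∀ H s, I H → Abs W S s H →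
      cost W F M (.loop f (.seq (.rand d) p) :: k, s) ≤ (2 * τ + 7 : ℕ) + B := by
    intro M
    induction M with
    | zero => intro _ H s _ _; simp [cost_zero]
    | succ M ih =>
      intro hM H s hI hs
      rw [cost_loop, if_pos (by rw [hs.reg f hf]; exact hIf H hI)]
      -- A larger step budget only increases the cost, and a successor allows the next step to be
      -- unfolded.
      refine (add_le_add_right (cost_mono _ (Nat.le_succ M)) _).trans ?_
      simp only
      rw [cost_seq]
      refine (add_le_add_right (add_le_add_right (cost_mono _ (Nat.le_succ M)) _) _).trans ?_
      simp only
      rw [cost_rand]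
      -- A failure costs `2 * τ + 7 + B` after the body instead of `1 + B`, that is, `2 * (τ + 3)`
      -- more.
      have hterm : ∀ c ∈ Finset.range (2 ^ W),
          cost W F M (p :: .loop f (.seq (.rand d) p) :: k, s.setReg d c) ≤
            (τ + 1 + B) + if Good c then 0 else (2 * (τ + 3 : ℕ) : ℝ≥0∞) := by
        intro c hc
        have hc' := Finset.mem_range.1 hc
        have hsp := h H hI c hc' _ (hs.setV hd2 hc') F (.loop f (.seq (.rand d) p) :: k) M
        by_cases hg : Good c
        · simp only [hg, if_true, add_zero] at hsp ⊢
          rw [add_assoc]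
          refine hsp (1 + B) fun s' ⟨H', h1, h2, h3⟩ => ?_
          refine (cost_mono _ M.le_succ).trans ?_
          simp only
          rw [cost_loop, if_neg (by rw [h1.reg f hf, h2]; simp)]
          gcongr
          exact (cost_mono _ (by omega : M ≤ N)).trans (hB s' ⟨H', h1, h3⟩)
        · simp only [hg, if_false] at hsp ⊢
          refine (hsp _ fun s' ⟨H', h1, h2⟩ => ih (by omega) H' s' h2 h1).trans (le_of_eq ?_)
          push_cast
          ring
      have hsum : (∑ c ∈ Finset.range (2 ^ W),
          cost W F M (p :: .loop f (.seq (.rand d) p) :: k, s.setReg d c)) / 2 ^ W ≤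
            (τ + 1 + B) + (τ + 3 : ℕ) := by
        refine ENNReal.div_le_of_le_mul ?_
        refine (Finset.sum_le_sum hterm).trans ?_
        rw [Finset.sum_add_distrib, add_mul]
        gcongr ?_ + ?_
        · refine le_of_eq ?_
          simp
          ring
        · rw [Finset.sum_ite, Finset.sum_const_zero, zero_add, Finset.sum_const, nsmul_eq_mul]
          have hcard := Finset.card_filter_add_card_filter_not (s := Finset.range (2 ^ W)) Good
          rw [Finset.card_range] at hcard
          have h2 : ((Finset.range (2 ^ W)).filter fun c => ¬ Good c).card * 2 ≤ 2 ^ W := by omega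
          rw [← mul_assoc, mul_comm ((τ + 3 : ℕ) : ℝ≥0∞)]
          gcongr
          exact_mod_cast h2
      refine (add_le_add_right (add_le_add_right (add_le_add_right hsum _) _) _).trans (le_of_eq ?_)
      push_cast
      ring
  exact key N le_rfl H s hI hs

/-- `H'` agrees with `H` outside of the variables `X` and the arrays `J`. -/
structure Fr (X J : List ℕ) (H H' : HS) : Prop where
  v : ∀ x, x ∉ X → H'.v x = H.v x
  a : ∀ j, j ∉ J → H'.a j = H.a j

theorem Fr.refl (X J : List ℕ) (H : HS) : Fr X J H H := ⟨fun _ _ => rfl, fun _ _ => rfl⟩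

theorem Fr.trans {X J : List ℕ} {H H' H'' : HS} (h : Fr X J H H') (h' : Fr X J H' H'') :
    Fr X J H H'' :=
  ⟨fun x hx => (h'.v x hx).trans (h.v x hx), fun x hx => (h'.a x hx).trans (h.a x hx)⟩

theorem Fr.mono {X J X' J' : List ℕ} {H H' : HS} (h : Fr X J H H') (hX : X ⊆ X') (hJ : J ⊆ J') :
    Fr X' J' H H' :=
  ⟨fun x hx => h.v x fun h' => hx (hX h'), fun x hx => h.a x fun h' => hx (hJ h')⟩

theorem Fr.setV {X J : List ℕ} {H H' : HS} (h : Fr X J H H') {x : ℕ} (c : ℕ) (hx : x ∈ X) :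
    Fr X J H (H'.setV x c) :=
  ⟨fun y hy => by
    have : y ≠ x := by rintro rfl; exact hy hx
    simp [this, h.v y hy], h.a⟩

theorem Fr.setA {X J : List ℕ} {H H' : HS} (h : Fr X J H H') {j : ℕ} (i c : ℕ) (hj : j ∈ J) :
    Fr X J H (H'.setA j i c) :=
  ⟨h.v, fun y hy => by
    have : y ≠ j := by rintro rfl; exact hy hj
    ext i'
    simp [this, h.a y hy]⟩

end WordRAM

/-! ### Simulation of a machine with a shorter word length -/

namespace WordRAM

namespace Ex

/-- The content of a packed cell if it carries the current epoch, and `0` otherwise. -/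
def unpack (c : Ex) : Ex :=
  .bin .mul (.bin .eq (.bin .div c (.var 3)) (.var 4)) (.bin .mod c (.var 3))

/-- Pack a value together with the current epoch. -/
def pack (e : Ex) : Ex := .bin .add (.bin .mul (.var 4) (.var 3)) (.bin .mod e (.var 3))

/-- The value of the simulated register `r_a`. -/
def simReg (a : ℕ) : Ex := unpack (.arr 7 (.lit a))

end Ex

open Ex

/-- The simulation of a program for a smaller word length, with registers and memory kept in the
arrays `7` and `6`. -/
def simulate : Prog → Prog
  | .const d c => put 7 (.lit d) (pack (.lit c))
  | .op o d a b => put 7 (.lit d) (pack (.bin o (simReg a) (simReg b)))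
  | .load d a => put 7 (.lit d) (pack (unpack (.arr 6 (simReg a))))
  | .store a b => put 6 (simReg a) (pack (simReg b))
  | .rand d => .seq (.rand 31) (put 7 (.lit d) (pack (.var 31)))
  | .seq p q => .seq (simulate p) (simulate q)
  | .ite a p q => cond (simReg a) (simulate p) (simulate q)
  | .loop a p => whileDo (simReg a) (simulate p)

/-- All registers mentioned by the program are below `D`. -/
def Prog.RegsBelow (D : ℕ) : Prog → Prop
  | .const d _ => d < D
  | .op _ d a b => d < D ∧ a < D ∧ b < D
  | .load d a => d < D ∧ a < D
  | .store a b => a < D ∧ b < D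
  | .rand d => d < D
  | .seq p q => p.RegsBelow D ∧ q.RegsBelow D
  | .ite a p q => a < D ∧ p.RegsBelow D ∧ q.RegsBelow D
  | .loop a p => a < D ∧ p.RegsBelow D

theorem Prog.RegsBelow.mono {D D' : ℕ} (h : D ≤ D') : ∀ {p : Prog}, p.RegsBelow D → p.RegsBelow D'
  | .const _ _, hp => hp.trans_le h
  | .op .., hp => ⟨hp.1.trans_le h, hp.2.1.trans_le h, hp.2.2.trans_le h⟩
  | .load .., hp => ⟨hp.1.trans_le h, hp.2.trans_le h⟩
  | .store .., hp => ⟨hp.1.trans_le h, hp.2.trans_le h⟩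
  | .rand _, hp => hp.trans_le h
  | .seq .., hp => ⟨hp.1.mono h, hp.2.mono h⟩
  | .ite .., hp => ⟨hp.1.trans_le h, hp.2.1.mono h, hp.2.2.mono h⟩
  | .loop .., hp => ⟨hp.1.trans_le h, hp.2.mono h⟩

/-- Finitely many simulated registers fit into one array. -/
theorem Prog.exists_regsBelow : ∀ p : Prog, ∃ D, p.RegsBelow D
  | .const d _ => ⟨d + 1, Nat.lt_succ_self d⟩
  | .op _ d a b => ⟨d + a + b + 1, by simp only [RegsBelow]; omega⟩
  | .load d a => ⟨d + a + 1, by simp only [RegsBelow]; omega⟩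
  | .store a b => ⟨a + b + 1, by simp only [RegsBelow]; omega⟩
  | .rand d => ⟨d + 1, Nat.lt_succ_self d⟩
  | .seq p q => by
    obtain ⟨D, hD⟩ := p.exists_regsBelow
    obtain ⟨D', hD'⟩ := q.exists_regsBelow
    exact ⟨D + D', hD.mono (by omega), hD'.mono (by omega)⟩
  | .ite a p q => by
    obtain ⟨D, hD⟩ := p.exists_regsBelow
    obtain ⟨D', hD'⟩ := q.exists_regsBelow
    exact ⟨a + 1 + D + D', by omega, hD.mono (by omega), hD'.mono (by omega)⟩
  | .loop a p => by
    obtain ⟨D, hD⟩ := p.exists_regsBelow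
    exact ⟨a + 1 + D, by omega, hD.mono (by omega)⟩

/-- The content of a packed cell in epoch `e`, for the modulus `q`. -/
def unpackNat (q e c : ℕ) : ℕ := if c / q = e then c % q else 0

/-- The abstract state `H` represents the store `t` of a machine with word length `V`. -/
structure Sim (S V D e : ℕ) (t : Store) (H : HS) : Prop where
  reg : ∀ r < D, unpackNat (2 ^ V) e (H.a 7 r) = t.reg r
  mem : ∀ x < 2 ^ V, unpackNat (2 ^ V) e (H.a 6 x) = t.mem x
  reg_lt : ∀ r < D, t.reg r < 2 ^ V
  mem_lt : ∀ x < 2 ^ V, t.mem x < 2 ^ V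
  modulus : H.v 3 = 2 ^ V
  epoch : H.v 4 = e
  le_epoch : ∀ x < S, H.a 6 x / 2 ^ V ≤ e ∧ H.a 7 x / 2 ^ V ≤ e

/-- The numerical requirements of the simulation. -/
structure SimSize (W S V D e : ℕ) : Prop where
  word : V ≤ W
  mem : 2 ^ V ≤ S
  regs : D ≤ S
  epoch : (e + 1) * 2 ^ V ≤ 2 ^ W

/-- Only subtraction uses the word length before the final reduction, and there `2 ^ W` and `2 ^ V`
differ by a multiple of `2 ^ V`. -/
theorem BinOp.eval_mod {V W : ℕ} (h : V ≤ W) (o : BinOp) {a b : ℕ} (hb : b < 2 ^ V) :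
    o.eval W a b % 2 ^ V = o.eval V a b := by
  have hd : 2 ^ V ∣ 2 ^ W := pow_dvd_pow 2 h
  have hle : 2 ^ V ≤ 2 ^ W := Nat.pow_le_pow_right (by omega) h
  cases o
  case sub =>
    simp only [BinOp.eval, Nat.mod_mod_of_dvd _ hd]
    obtain ⟨c, hc⟩ := hd
    have hc0 : 1 ≤ c := by
      rcases Nat.eq_zero_or_pos c with rfl | h
      · simp at hc
      · exact h
    obtain ⟨c, rfl⟩ : ∃ c', c = c' + 1 := ⟨c - 1, by omega⟩
    have : a + (2 ^ W - b) = a + (2 ^ V - b) + 2 ^ V * c := by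
      rw [hc, mul_add]
      omega
    rw [this, Nat.add_mul_mod_self_left]
  all_goals simp only [BinOp.eval, Nat.mod_mod_of_dvd _ hd]

theorem unpackNat_lt {q e c : ℕ} (hq : 0 < q) : unpackNat q e c < q := by
  rw [unpackNat]
  split_ifs
  · exact Nat.mod_lt _ hq
  · exact hq

theorem unpackNat_pack {q e u : ℕ} (hu : u < q) : unpackNat q e (e * q + u) = u := by
  have h1 : (e * q + u) / q = e := by
    rw [mul_comm, Nat.mul_add_div (by omega), Nat.div_eq_of_lt hu, add_zero]
  rw [unpackNat, if_pos h1, Nat.mul_add_mod_self_right, Nat.mod_eq_of_lt hu]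

variable {W S V D e : ℕ} {s : Store} {t : Store} {H : HS}

theorem eval_unpack {q : ℕ} (hs : Abs W S s H) (hq : H.v 3 = q) (he : H.v 4 = e) {c : Ex}
    (hc : c.Ok W S H) (hW : 1 < 2 ^ W) :
    (unpack c).eval W H = unpackNat q e (c.eval W H) := by
  have h1 := hs.eval_lt hc
  have h2 : c.eval W H / q % 2 ^ W = c.eval W H / q :=
    Nat.mod_eq_of_lt ((Nat.div_le_self _ _).trans_lt h1)
  have h3 : c.eval W H % q % 2 ^ W = c.eval W H % q :=
    Nat.mod_eq_of_lt ((Nat.mod_le _ _).trans_lt h1)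
  simp only [unpack, eval, BinOp.eval, hq, he, h2, h3, unpackNat]
  split_ifs
  · rw [Nat.mod_eq_of_lt hW, one_mul, h3]
  · simp

theorem ok_unpack {c : Ex} (hc : c.Ok W S H) : (unpack c).Ok W S H := by
  simp [unpack, Ok, hc]

theorem ok_pack {c : Ex} (hc : c.Ok W S H) : (pack c).Ok W S H := by
  simp [pack, Ok, hc]

theorem eval_pack {q : ℕ} (hq : H.v 3 = q) (he : H.v 4 = e) (h : (e + 1) * q ≤ 2 ^ W) (hq0 : 0 < q)
    (c : Ex) : (pack c).eval W H = e * q + c.eval W H % q := by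
  have h0 := Nat.mod_lt (c.eval W H) hq0
  rw [add_mul] at h
  simp only [pack, eval, BinOp.eval, hq, he]
  rw [Nat.mod_eq_of_lt (a := e * q) (by omega), Nat.mod_eq_of_lt (a := c.eval W H % q) (by omega),
    Nat.mod_eq_of_lt (by omega)]

theorem Abs.one_lt (hs : Abs W S s H) (hS : 0 < S) : 1 < 2 ^ W := by
  have := hs.le
  omega

theorem SimSize.pos (h : SimSize W S V D e) : 0 < S := (Nat.two_pow_pos V).trans_le h.mem

theorem Sim.ok_simReg (hz : SimSize W S V D e) (hs : Abs W S s H) {a : ℕ}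
    (ha : a < D) : (simReg a).Ok W S H := by
  have h1 := hs.le
  have h2 := hz.regs
  refine ok_unpack ⟨by omega, trivial, ?_⟩
  simp only [eval]
  rw [Nat.mod_eq_of_lt (by omega)]
  omega

theorem Sim.eval_simReg (h : Sim S V D e t H) (hz : SimSize W S V D e) (hs : Abs W S s H) {a : ℕ}
    (ha : a < D) : (simReg a).eval W H = t.reg a := by
  have h1 := hs.le
  have h2 := hz.regs
  rw [simReg, eval_unpack hs h.modulus h.epoch (ok_simReg hz hs ha).1.1.1 (hs.one_lt hz.pos)]
  simp only [eval]
  rw [Nat.mod_eq_of_lt (by omega), h.reg a ha]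

theorem pack_div {q e u : ℕ} (hu : u < q) : (e * q + u) / q = e := by
  rw [mul_comm, Nat.mul_add_div (by omega), Nat.div_eq_of_lt hu, add_zero]

theorem Sim.setReg (h : Sim S V D e t H) {d u : ℕ} (hu : u < 2 ^ V) :
    Sim S V D e (t.setReg d u) (H.setA 7 d (e * 2 ^ V + u)) where
  reg r hr := by
    by_cases hrd : r = d
    · simp [hrd, unpackNat_pack hu]
    · simp [hrd, h.reg r hr]
  mem x hx := by simp [h.mem x hx]
  reg_lt r hr := by
    by_cases hrd : r = d
    · simp [hrd, hu]
    · simp [hrd, h.reg_lt r hr]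
  mem_lt := h.mem_lt
  modulus := h.modulus
  epoch := h.epoch
  le_epoch x hx := by
    by_cases hrd : x = d
    · subst hrd
      simp [pack_div hu, h.le_epoch x hx]
    · simp [hrd, h.le_epoch x hx]

theorem Sim.setMem (h : Sim S V D e t H) {d u : ℕ} (hu : u < 2 ^ V) :
    Sim S V D e (t.setMem d u) (H.setA 6 d (e * 2 ^ V + u)) where
  reg r hr := by simp [h.reg r hr]
  mem x hx := by
    by_cases hrd : x = d
    · simp [hrd, unpackNat_pack hu]
    · simp [hrd, h.mem x hx]
  mem_lt r hr := by
    by_cases hrd : r = d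
    · simp [hrd, hu]
    · simp [hrd, h.mem_lt r hr]
  reg_lt := h.reg_lt
  modulus := h.modulus
  epoch := h.epoch
  le_epoch x hx := by
    by_cases hrd : x = d
    · subst hrd
      simp [pack_div hu, h.le_epoch x hx]
    · simp [hrd, h.le_epoch x hx]

theorem Sim.setV (h : Sim S V D e t H) (u : ℕ) : Sim S V D e t (H.setV 31 u) where
  reg := h.reg
  mem := h.mem
  reg_lt := h.reg_lt
  mem_lt := h.mem_lt
  modulus := by simp [h.modulus]
  epoch := by simp [h.epoch]
  le_epoch := h.le_epoch

/-- The stacks of the simulating machine that correspond to a stack of the simulated one. -/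
inductive SimStack (k₀ : List Prog) : List Prog → List Prog → Prop
  | nil : SimStack k₀ [] k₀
  | cons {p k k'} : SimStack k₀ k k' → SimStack k₀ (p :: k) (simulate p :: k')
  | loop {a p k k'} : SimStack k₀ k k' → SimStack k₀ (.loop a p :: k)
      ((simReg a).code 32 :: .loop 32 (.seq (simulate p) ((simReg a).code 32)) :: k')

theorem sum_range_mul_mod (q c : ℕ) (f : ℕ → ℝ≥0∞) :
    ∑ v ∈ Finset.range (q * c), f (v % q) = c * ∑ v ∈ Finset.range q, f v := by
  induction c with
  | zero => simp
  | succ c ih =>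
    rw [mul_add, mul_one, Finset.sum_range_add, ih]
    push_cast
    rw [add_mul, one_mul]
    congr 1
    refine Finset.sum_congr rfl fun v hv => ?_
    rw [Nat.mul_add_mod, Nat.mod_eq_of_lt (Finset.mem_range.1 hv)]

/-- The low `V` bits of a uniform `W`-bit word are uniform, since every residue has `2 ^ (W - V)`
preimages. -/
theorem sum_range_two_pow_mod (h : V ≤ W) (f : ℕ → ℝ≥0∞) :
    (∑ v ∈ Finset.range (2 ^ W), f (v % 2 ^ V)) / 2 ^ W =
      (∑ v ∈ Finset.range (2 ^ V), f v) / 2 ^ V := by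
  obtain ⟨c, rfl⟩ := Nat.exists_eq_add_of_le h
  rw [pow_add, sum_range_mul_mod, pow_add, mul_comm]
  push_cast
  exact ENNReal.mul_div_mul_right _ _ (by simp) (by simp)

theorem simReg_time (a : ℕ) : (simReg a).time = 33 := rfl

variable {F : Store → ℝ≥0∞} {B : ℝ≥0∞} {P : Store → Prop} {N : ℕ} {k₀ : List Prog} {H₀ : HS}

/-- Both machines get the same step budget `M`: a simulated step takes at least one real step, and
at most 200 real steps are charged to it. If the simulated run halts outside of `P`, the right side
is infinite and nothing is to be shown; otherwise `hend` takes over. The third kind of stack in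
`SimStack` describes a loop whose condition is about to be evaluated, which happens on entry and
after each execution of the body. -/
theorem Sim.cost_le (hz : SimSize W S V D e)
    (hend : ∀ t' H' s', P t' → Sim S V D e t' H' → Fr [31] [6, 7] H₀ H' → Abs W S s' H' →
      cost W F N (k₀, s') ≤ B) :
    ∀ M ≤ N, ∀ (k k' : List Prog) (t s : Store) (H : HS), SimStack k₀ k k' →
      (∀ p ∈ k, p.RegsBelow D) → Sim S V D e t H → Fr [31] [6, 7] H₀ H → Abs W S s H →
      cost W F M (k', s) ≤ 200 * cost V (penalty P) M (k, t) + B := by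
  intro M
  induction M with
  | zero => intros; simp [cost_zero]
  | succ M ih =>
    intro hM k k' t s H hst hk h hF hs
    have hW := hs.one_lt hz.pos
    have ih' := ih (by omega)
    have hq : 0 < 2 ^ V := Nat.two_pow_pos V
    have hlit : ∀ d < D, (Ex.lit d).eval W H = d ∧ d < S := fun d hd => by
      have h1 := hs.le
      have h2 := hz.regs
      exact ⟨Nat.mod_eq_of_lt (by omega), by omega⟩
    have hpack := fun c => eval_pack h.modulus h.epoch hz.epoch hq c
    -- the case of deterministic instructions
    have hdet : ∀ {p k k' t'}, SimStack k₀ k k' → (∀ p ∈ k, p.RegsBelow D) →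
        StrictSpec W (simulate p) s
          (fun s' => ∃ H', Abs W S s' H' ∧ Sim S V D e t' H' ∧ Fr [31] [6, 7] H₀ H') 200 →
        cost W F (M + 1) (simulate p :: k', s) ≤
          200 * (1 + cost V (penalty P) M (k, t')) + B := by
      intro p k k' t' hst hk hp
      refine (hp F k' M (200 * cost V (penalty P) M (k, t') + B)
        fun s' ⟨H', h1, h2, h3⟩ => ih' _ _ _ _ _ hst hk h2 h3 h1).trans (le_of_eq ?_)
      push_cast
      ring
    have hput7 : ∀ {d u c} , d < D → c.Ok W S H → c.eval W H % 2 ^ V = u → c.time ≤ 150 →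
        StrictSpec W (put 7 (.lit d) (pack c)) s
          (fun s' => ∃ H', Abs W S s' H' ∧ Sim S V D e (t.setReg d u) H' ∧
            Fr [31] [6, 7] H₀ H') 200 := by
      intro d u c hd hc hu ht
      refine (strict_put hs (e := .lit d) (Q := fun H' => Sim S V D e (t.setReg d u) H' ∧ Fr [31] [6, 7] H₀ H')
        trivial (ok_pack hc) (by omega) ?_ ?_).mono (fun _ h => h)
        (by simp [Ex.time, pack]; omega)
      · rw [(hlit d hd).1]
        exact (hlit d hd).2
      · rw [(hlit d hd).1, hpack, hu]
        exact ⟨h.setReg (hu ▸ Nat.mod_lt _ hq), hF.setA _ _ (by simp)⟩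
    -- the evaluation of the condition of a loop
    have hloop : ∀ {a p k k'}, SimStack k₀ k k' → (∀ q ∈ Prog.loop a p :: k, q.RegsBelow D) →
        cost W F (M + 1) ((simReg a).code 32 ::
          .loop 32 (.seq (simulate p) ((simReg a).code 32)) :: k', s) + 1 ≤
          200 * cost V (penalty P) (M + 1) (.loop a p :: k, t) + B := by
      intro a p k k' hst hk
      have ha : a < D := (hk _ List.mem_cons_self).1
      rw [cost_loop]
      have hcode := (simReg a).code_spec 32 s le_rfl hs (ok_simReg hz hs ha) F
        (.loop 32 (.seq (simulate p) ((simReg a).code 32)) :: k') (M + 1)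
        (2 + (200 * cost V (penalty P) M
          (if t.reg a ≠ 0 then p :: .loop a p :: k else k, t) + B)) ?_
      · refine (add_le_add_left hcode 1).trans ?_
        rw [simReg_time, mul_add]
        set X := 200 * cost V (penalty P) M (if t.reg a ≠ 0 then p :: .loop a p :: k else k, t)
        calc ((33 : ℕ) : ℝ≥0∞) + (2 + (X + B)) + 1 = 36 + (X + B) := by push_cast; ring
          _ ≤ 200 * 1 + X + B := by
            rw [mul_one, add_assoc]
            gcongr
            norm_num
      · rintro s' ⟨hm, hr, hv⟩
        have hs' : Abs W S s' H := hs.congr hr hm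
        rw [h.eval_simReg hz hs ha] at hv
        rw [cost_loop, hv]
        split_ifs with h0
        · refine (add_le_add_right (cost_mono _ M.le_succ) 1).trans ?_
          simp only
          rw [cost_seq, ← add_assoc, one_add_one_eq_two]
          gcongr
          refine ih' _ _ _ _ _ (.cons (.loop hst)) ?_ h hF hs'
          intro q hq
          rcases List.mem_cons.1 hq with rfl | hq
          · exact (hk _ List.mem_cons_self).2
          · exact hk _ hq
        · gcongr
          · norm_num
          · exact ih' _ _ _ _ _ hst (fun q hq => hk _ (List.mem_cons_of_mem _ hq)) h hF hs'
    cases hst with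
    | nil =>
      rw [cost_nil, penalty]
      split_ifs with hP
      · refine le_trans ((cost_mono _ hM).trans (hend _ _ _ hP h hF hs)) ?_
        simp
      · simp
    | loop hst =>
      exact le_self_add.trans (hloop hst hk)
    | @cons p k k' hst =>
      have hk' : ∀ q ∈ k, q.RegsBelow D := fun q hq => hk q (List.mem_cons_of_mem _ hq)
      have hp : p.RegsBelow D := hk p List.mem_cons_self
      cases p with
      | const d c =>
        rw [cost_const]
        refine hdet hst hk' (hput7 hp trivial ?_ (by simp [Ex.time]))
        exact Nat.mod_mod_of_dvd _ (pow_dvd_pow 2 hz.word)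
      | op o d a b =>
        obtain ⟨hd, ha, hb⟩ := hp
        rw [cost_op]
        refine hdet hst hk' (hput7 hd ⟨ok_simReg hz hs ha, ok_simReg hz hs hb⟩ ?_
          (by simp [Ex.time, simReg_time]))
        rw [Ex.eval, h.eval_simReg hz hs ha, h.eval_simReg hz hs hb,
          BinOp.eval_mod hz.word o (h.reg_lt b hb)]
      | load d a =>
        obtain ⟨hd, ha⟩ := hp
        have hra := h.reg_lt a ha
        have hok : (Ex.arr 6 (simReg a)).Ok W S H := by
          refine ⟨by omega, ok_simReg hz hs ha, ?_⟩
          rw [h.eval_simReg hz hs ha]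
          exact hra.trans_le hz.mem
        rw [cost_load]
        refine hdet hst hk' (hput7 hd (ok_unpack hok) ?_ (by simp [Ex.time, unpack, simReg_time]))
        rw [eval_unpack hs h.modulus h.epoch hok hW, Nat.mod_eq_of_lt (unpackNat_lt hq), Ex.eval,
          h.eval_simReg hz hs ha, h.mem _ hra]
      | store a b =>
        obtain ⟨ha, hb⟩ := hp
        have hra := h.reg_lt a ha
        have hrb := h.reg_lt b hb
        rw [cost_store]
        refine hdet hst hk' ((strict_put hs
          (Q := fun H' => Sim S V D e (t.setMem (t.reg a) (t.reg b)) H' ∧ Fr [31] [6, 7] H₀ H')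
          (ok_simReg hz hs ha) (ok_pack (ok_simReg hz hs hb)) (by omega) ?_ ?_).mono
          (fun _ h => h) (by simp [Ex.time, simReg_time, pack]))
        · rw [h.eval_simReg hz hs ha]
          exact hra.trans_le hz.mem
        · rw [hpack, h.eval_simReg hz hs ha, h.eval_simReg hz hs hb, Nat.mod_eq_of_lt hrb]
          exact ⟨h.setMem hrb, hF.setA _ _ (by simp)⟩
      | rand d =>
        rw [cost_rand, simulate, cost_seq]
        refine (add_le_add_right (cost_mono _ M.le_succ) 1).trans ?_
        simp only
        rw [cost_rand]
        set g : ℕ → ℝ≥0∞ := fun v => cost V (penalty P) M (k, t.setReg d v) with hg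
        -- The full word is drawn into variable 31, and packing keeps only its low `V` bits.
        have hterm : ∀ c ∈ Finset.range (2 ^ W),
            cost W F M (put 7 (.lit d) (pack (.var 31)) :: k', s.setReg 31 c) ≤
              (100 + B) + 200 * g (c % 2 ^ V) := by
          intro c hc
          have hc' := Finset.mem_range.1 hc
          have hs' := hs.setV (x := 31) (by omega) hc'
          have h' := h.setV c
          have hsp := (strict_put hs' (e := .lit d) (e' := pack (.var 31)) (j := 7)
            (Q := fun H' => Sim S V D e (t.setReg d (c % 2 ^ V)) H' ∧ Fr [31] [6, 7] H₀ H')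
            trivial (ok_pack (by simp [Ex.Ok])) (by omega)
            (by rw [Ex.eval, Nat.mod_eq_of_lt]; exact (hlit d hp).2
                have := (hlit d hp).2; have := hs.le; omega) ?_).spec F k' M
            (200 * g (c % 2 ^ V) + B) ?_
          · refine hsp.trans ?_
            rw [add_comm _ B, ← add_assoc]
            gcongr
            simp [Ex.time, pack]
            norm_num
          · have hd : (Ex.lit d).eval W (H.setV 31 c) = d := (hlit d hp).1
            rw [hd, eval_pack h'.modulus h'.epoch hz.epoch hq]
            simp only [Ex.eval, HS.setV_v, if_true]
            exact ⟨h'.setReg (Nat.mod_lt _ hq), (hF.setV _ (by simp)).setA _ _ (by simp)⟩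
          · rintro s' ⟨H', h1, h2, h3⟩
            exact ih' _ _ _ _ _ hst hk' h2 h3 h1
        have hsum : (∑ c ∈ Finset.range (2 ^ W),
            cost W F M (put 7 (.lit d) (pack (.var 31)) :: k', s.setReg 31 c)) / 2 ^ W ≤
              (100 + B) + 200 * ((∑ v ∈ Finset.range (2 ^ V), g v) / 2 ^ V) := by
          refine (ENNReal.div_le_div_right (Finset.sum_le_sum hterm) _).trans ?_
          rw [Finset.sum_add_distrib, ENNReal.add_div, ← Finset.mul_sum,
            ← sum_range_two_pow_mod hz.word g, mul_div_assoc]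
          gcongr
          refine ENNReal.div_le_of_le_mul (le_of_eq ?_)
          simp
          ring
        refine (add_le_add_right (add_le_add_right hsum _) _).trans ?_
        rw [mul_add]
        set X := 200 * ((∑ v ∈ Finset.range (2 ^ V), g v) / 2 ^ V)
        calc 1 + (1 + (100 + B + X)) = 102 + (X + B) := by ring
          _ ≤ 200 * 1 + X + B := by
            rw [mul_one, add_assoc]
            gcongr
            norm_num
      | seq p q =>
        rw [cost_seq, simulate, cost_seq, mul_add, mul_one, add_assoc]
        gcongr
        · norm_num
        · refine ih' _ _ _ _ _ (.cons (.cons hst)) ?_ h hF hs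
          intro r hr
          simp only [List.mem_cons] at hr
          rcases hr with rfl | rfl | hr
          · exact hp.1
          · exact hp.2
          · exact hk' r hr
      | ite a p q =>
        have ha : a < D := hp.1
        rw [cost_ite, simulate, cond, cost_seq]
        have hcode := (simReg a).code_spec 32 s le_rfl hs (ok_simReg hz hs ha) F
          (.ite 32 (simulate p) (simulate q) :: k') M
          (1 + (200 * cost V (penalty P) M (if t.reg a ≠ 0 then p :: k else q :: k, t) + B)) ?_
        · refine (add_le_add_right hcode 1).trans ?_
          rw [simReg_time, mul_add]
          set X := 200 * cost V (penalty P) M (if t.reg a ≠ 0 then p :: k else q :: k, t)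
          calc 1 + (((33 : ℕ) : ℝ≥0∞) + (1 + (X + B))) = 35 + (X + B) := by push_cast; ring
            _ ≤ 200 * 1 + X + B := by
              rw [mul_one, add_assoc]
              gcongr
              norm_num
        · rintro s' ⟨hm, hr, hv⟩
          have hs' : Abs W S s' H := hs.congr hr hm
          rw [h.eval_simReg hz hs ha] at hv
          refine (cost_mono _ M.le_succ).trans ?_
          simp only
          rw [cost_ite, hv]
          gcongr
          split_ifs with h0
          · refine ih' _ _ _ _ _ (.cons hst) ?_ h hF hs'
            intro r hr
            rcases List.mem_cons.1 hr with rfl | hr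
            · exact hp.2.1
            · exact hk' r hr
          · refine ih' _ _ _ _ _ (.cons hst) ?_ h hF hs'
            intro r hr
            rcases List.mem_cons.1 hr with rfl | hr
            · exact hp.2.2
            · exact hk' r hr
      | loop a p =>
        rw [simulate, whileDo, cost_seq, add_comm]
        refine le_trans ?_ (hloop hst hk)
        gcongr
        exact cost_mono _ M.le_succ

/-- A bound on all truncated costs of the simulated run suffices, so runs that do not halt need no
separate treatment. -/
theorem Sim.hspec (hz : SimSize W S V D e) {p : Prog} (hp : p.RegsBelow D) (h : Sim S V D e t H)
    {τ : ℕ} (hτ : ∀ N, cost V (penalty P) N ([p], t) ≤ τ) :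
    HSpec W S (simulate p) H
      (fun H' => Fr [31] [6, 7] H H' ∧ ∃ t', P t' ∧ Sim S V D e t' H') (200 * τ) := by
  intro s hs F k N B hB
  refine (Sim.cost_le hz (k₀ := k) (H₀ := H) (P := P) (F := F) (B := B) (N := N) ?_ N le_rfl [p] _ t s H
    (.cons .nil) (by simpa using hp) h (Fr.refl _ _ _) hs).trans ?_
  · intro t' H' s' h1 h2 h3 h4
    exact hB s' ⟨H', h4, h3, t', h1, h2⟩
  · push_cast
    gcongr
    exact hτ N

end WordRAM

/-! ### A linear lower bound for `Convolution3SUM` -/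

namespace WordRAM

/-- A run of `t` steps depends on at most `t` memory cells. -/
theorem exists_read_cells {W : ℕ} : ∀ (t : ℕ) (k : List Prog) (s : Store) (c : Config),
    c ∈ (after W t (k, s)).support → ∃ R : Finset ℕ, R.card ≤ t ∧
      ∀ m : ℕ → ℕ, (∀ x ∈ R, m x = s.mem x) →
        ∃ c' ∈ (after W t (k, { s with mem := m })).support, c'.1 = c.1 ∧ c'.2.reg = c.2.reg
  | 0, k, s, c, hc => by
    obtain rfl : c = (k, s) := by simpa [after] using hc
    exact ⟨∅, by simp, fun m _ => ⟨(k, { s with mem := m }), by simp [after], rfl, rfl⟩⟩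
  | t + 1, [], s, c, hc => by
    rw [after_nil] at hc
    obtain rfl : c = ([], s) := by simpa using hc
    refine ⟨∅, by simp, fun m _ => ⟨([], { s with mem := m }), ?_, rfl, rfl⟩⟩
    rw [after_nil]
    simp
  | t + 1, i :: k, s, c, hc => by
    simp only [after, PMF.mem_support_bind_iff] at hc ⊢
    obtain ⟨c1, h1, h2⟩ := hc
    have hdet : ∀ k' s', c1 = (k', s') →
        (∀ m, (k', { s' with mem := m }) ∈ (step W (i :: k, { s with mem := m })).support) →
        s'.mem = s.mem → ∃ R : Finset ℕ, R.card ≤ t + 1 ∧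
        ∀ m : ℕ → ℕ, (∀ x ∈ R, m x = s.mem x) → ∃ c', (∃ a ∈ (step W (i :: k,
          { s with mem := m })).support, c' ∈ (after W t a).support) ∧
            c'.1 = c.1 ∧ c'.2.reg = c.2.reg := by
      rintro k' s' rfl hstep hm
      obtain ⟨R, hR, h⟩ := exists_read_cells t k' s' c h2
      refine ⟨R, by omega, fun m hmR => ?_⟩
      obtain ⟨c', h3, h4⟩ := h m (by rwa [hm])
      exact ⟨c', ⟨_, hstep m, h3⟩, h4⟩
    cases i with
    | const d v =>
      exact hdet k (s.setReg d (v % 2 ^ W)) (by simpa [step] using h1)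
        (fun m => by simp [step, Store.setReg]) rfl
    | op o d a b =>
      exact hdet k (s.setReg d (o.eval W (s.reg a) (s.reg b))) (by simpa [step] using h1)
        (fun m => by simp [step, Store.setReg]) rfl
    | load d a =>
      obtain rfl : c1 = (k, s.setReg d (s.mem (s.reg a))) := by simpa [step] using h1
      obtain ⟨R, hR, h⟩ := exists_read_cells t k _ c h2
      refine ⟨insert (s.reg a) R, (Finset.card_insert_le _ _).trans (by omega), fun m hmR => ?_⟩
      obtain ⟨c', h3, h4⟩ := h m fun x hx => hmR x (Finset.mem_insert_of_mem hx)
      refine ⟨c', ⟨_, ?_, h3⟩, h4⟩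
      simp [step, Store.setReg, hmR _ (Finset.mem_insert_self _ _)]
    | store a b =>
      obtain rfl : c1 = (k, s.setMem (s.reg a) (s.reg b)) := by simpa [step] using h1
      obtain ⟨R, hR, h⟩ := exists_read_cells t k _ c h2
      refine ⟨R, by omega, fun m hmR => ?_⟩
      -- The cell just written holds the same word in both memories, so agreement on `R` persists
      -- and no cell has to be added.
      obtain ⟨c', h3, h4⟩ := h (Function.update m (s.reg a) (s.reg b)) fun x hx => by
        simp only [Function.update_apply, Store.setMem_mem, hmR x hx]
      refine ⟨c', ⟨_, ?_, h3⟩, h4⟩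
      simp [step, Store.setMem]
    | rand d =>
      simp only [step, PMF.mem_support_map_iff] at h1
      obtain ⟨v, hv, rfl⟩ := h1
      refine hdet k (s.setReg d v) rfl (fun m => ?_) rfl
      simp only [step, PMF.mem_support_map_iff]
      exact ⟨v, hv, rfl⟩
    | seq p q =>
      exact hdet (p :: q :: k) s (by simpa [step] using h1) (fun m => by simp [step]) rfl
    | ite a p q =>
      exact hdet (if s.reg a ≠ 0 then p :: k else q :: k) s (by simpa [step] using h1)
        (fun m => by simp [step]) rfl
    | loop a p =>
      exact hdet (if s.reg a ≠ 0 then p :: .loop a p :: k else k) s (by simpa [step] using h1)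
        (fun m => by simp [step]) rfl

theorem le_expectedTime {W n : ℕ} {c : Config}
    (h : ∀ t < n, ∀ c' ∈ (after W t c).support, ¬ c'.Halted) : (n : ℝ≥0∞) ≤ expectedTime W c := by
  calc (n : ℝ≥0∞) = ∑ t ∈ Finset.range n, 1 := by simp
    _ ≤ ∑ t ∈ Finset.range n, (after W t c).toOuterMeasure {c' | ¬ c'.Halted} := by
      refine Finset.sum_le_sum fun t ht => ?_
      rw [(PMF.toOuterMeasure_apply_eq_one_iff _ _).2]
      exact fun c' hc' => h t (Finset.mem_range.1 ht) c' hc'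
    _ ≤ _ := ENNReal.sum_le_tsum _

end WordRAM

open WordRAM

/-- Every Las Vegas algorithm for `Convolution3SUM` has to read all the cells with an even index. -/
theorem le_of_isLasVegasAlgorithm {p : Prog} {κ : ℕ} {f : ℕ → ℝ≥0}
    (h : IsLasVegasAlgorithm convolutionThreeSum p κ f) (n : ℕ) : (((n - 1) / 2 : ℕ) : ℝ≥0) ≤ f n := by
  have hw : n < 2 ^ (n + 3) := Nat.lt_two_pow_self.trans (Nat.pow_lt_pow_right (by omega) (by omega))
  have hw' : (4 : ℤ) ≤ 2 ^ (n + 3 - 1) := by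
    have : (2 : ℤ) ^ 2 ≤ 2 ^ (n + 3 - 1) := pow_le_pow_right₀ (by norm_num) (by omega)
    linarith
  have h1 := h n (n + 3) (fun _ => 1) trivial (by omega) hw fun i => ⟨by linarith, by linarith⟩
  refine ENNReal.coe_le_coe.1 (le_trans ?_ h1.2)
  -- It is shown that on the vector of ones no run at all halts within fewer than `(n - 1) / 2`
  -- steps.
  refine (le_of_eq (by simp)).trans (le_expectedTime (n := (n - 1) / 2) fun t ht c hc hh => ?_)
  obtain ⟨R, hR, hm⟩ := exists_read_cells t _ _ c hc
  -- There are more indices `2 * (i + 1)` than cells on which the run depends.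
  obtain ⟨x, hx, hxR⟩ : ∃ x ∈ (Finset.range ((n - 1) / 2)).image (fun i => 2 * (i + 1)), x ∉ R := by
    by_contra hcon
    push Not at hcon
    have := Finset.card_le_card (fun x hx => hcon x hx)
    rw [Finset.card_image_of_injective _ (fun a b hab => by simp at hab; omega),
      Finset.card_range] at this
    omega
  obtain ⟨i, hi, rfl⟩ := Finset.mem_image.1 hx
  rw [Finset.mem_range] at hi
  -- Changing the unread entry to 2 creates the solution `1 + 1 = 2`, with the index `i + 1` used
  -- twice. The vector of ones has no solution, yet a run with the same answer remains possible.
  have h2 := h n (n + 3) (fun j => if (j : ℕ) = 2 * (i + 1) then 2 else 1) trivial (by omega) hw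
    fun j => ⟨by split_ifs <;> linarith, by split_ifs <;> linarith⟩
  obtain ⟨c', hc', e1, e2⟩ := hm (start (κ * (n + 3)) p (n + 3)
    (fun j : Fin n => if (j : ℕ) = 2 * (i + 1) then (2 : ℤ) else 1)).2.mem (fun y hy => by
      have : y ≠ 2 * (i + 1) := by rintro rfl; exact hxR hy
      simp [start, this])
  have hno := h1.1 t c hc hh
  have hyes := h2.1 t c' hc' (by rw [Config.Halted, e1]; exact hh)
  rw [e2, hno] at hyes
  have : convolutionThreeSum.IsYes n fun _ => 1 := by
    refine hyes.2 ⟨⟨i + 1, by omega⟩, ⟨i + 1, by omega⟩, ⟨2 * (i + 1), by omega⟩, ?_, ?_⟩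
    · simp only
      omega
    · have : i + 1 ≠ 2 * (i + 1) := by omega
      simp
  obtain ⟨_, _, _, -, h3⟩ := this
  norm_num at h3

/-! ### Multiplicative hashing and the weights -/

open Finset in
/-- Few multiples of `d` fall into a window modulo `N`. -/
theorem card_mul_mod_window_le (N M u : ℕ) {d : ℕ} (hd : 0 < d) :
    #{a ∈ range N | u ≤ a * d % N ∧ a * d % N < u + M} ≤ M + d := by
  -- The multiples `a * d` with the same quotient by `N` are integers with gaps of at least `d` in a
  -- window of length `M`, so at most `M / d + 1` of them occur. There are at most `d` quotients.
  have hfib : ∀ j ∈ range d, #{a ∈ {a ∈ range N | u ≤ a * d % N ∧ a * d % N < u + M} |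
      a * d / N = j} ≤ M / d + 1 := by
    intro j _
    set T := {a ∈ {a ∈ range N | u ≤ a * d % N ∧ a * d % N < u + M} | a * d / N = j} with hT
    rcases T.eq_empty_or_nonempty with h0 | h0
    · simp [h0]
    · have hmin := T.min'_mem h0
      set a₀ := T.min' h0 with ha₀
      have hsub : T ⊆ Ico a₀ (a₀ + (M / d + 1)) := by
        intro a ha
        have hle : a₀ ≤ a := T.min'_le a ha
        rw [mem_Ico]
        refine ⟨hle, ?_⟩
        simp only [hT, mem_filter] at ha hmin
        have e1 := Nat.div_add_mod (a * d) N
        have e2 := Nat.div_add_mod (a₀ * d) N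
        rw [ha.2] at e1
        rw [hmin.2] at e2
        have h3 : (a - a₀) * d < M + 1 := by
          rw [Nat.sub_mul]
          omega
        have h4 : a - a₀ ≤ M / d := by
          rw [Nat.le_div_iff_mul_le hd]
          omega
        omega
      calc #T ≤ #(Ico a₀ (a₀ + (M / d + 1))) := card_le_card hsub
        _ = M / d + 1 := by simp
  have hmaps : ∀ a ∈ {a ∈ range N | u ≤ a * d % N ∧ a * d % N < u + M}, a * d / N ∈ range d := by
    intro a ha
    simp only [mem_filter, mem_range] at ha ⊢
    rw [Nat.div_lt_iff_lt_mul (by omega), mul_comm d N]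
    exact Nat.mul_lt_mul_of_pos_right ha.1 hd
  rw [card_eq_sum_card_fiberwise hmaps]
  calc _ ≤ ∑ _j ∈ range d, (M / d + 1) := sum_le_sum hfib
    _ = d * (M / d) + d := by simp [mul_add]
    _ ≤ M + d := by
      have := Nat.mul_div_le M d
      omega

/-- `r` is within `M` of a multiple of `N`. -/
def NearZero (N M r : ℕ) : Prop := r < M ∨ N ≤ r + M

instance (N M r : ℕ) : Decidable (NearZero N M r) := inferInstanceAs (Decidable (_ ∨ _))

open Finset in
-- Two windows of length `M`, each hit by at most `M + d ≤ 2 * M` multiples.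
theorem card_nearZero_le {N M d : ℕ} (hd : 0 < d) (hdM : d ≤ M) (hMN : M ≤ N) :
    #{a ∈ range N | NearZero N M (a * d % N)} ≤ 4 * M := by
  have h1 := card_mul_mod_window_le N M 0 hd
  have h2 := card_mul_mod_window_le N M (N - M) hd
  have hsub : {a ∈ range N | NearZero N M (a * d % N)} ⊆
      {a ∈ range N | 0 ≤ a * d % N ∧ a * d % N < 0 + M} ∪
        {a ∈ range N | N - M ≤ a * d % N ∧ a * d % N < N - M + M} := by
    intro a ha
    rw [mem_filter, mem_range] at ha
    simp only [mem_filter, mem_union, mem_range]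
    have := Nat.mod_lt (a * d) (by omega : 0 < N)
    rcases ha.2 with h | h
    · left
      exact ⟨ha.1, by omega, by omega⟩
    · right
      exact ⟨ha.1, by omega, by omega⟩
  have := (card_le_card hsub).trans (card_union_le _ _)
  omega

/-- Two residues in the same interval of length `M` differ by less than `M` in absolute value. So
collisions are turned into a condition on the difference alone. -/
theorem nearZero_of_div_eq {N M u v z : ℕ} (hM : 0 < M) (hu : u < N) (hv : v < N)
    (huv : u / M = v / M) (hz : z < N) (h : (z : ℤ) ≡ u - v [ZMOD N]) : NearZero N M z := by
  obtain ⟨c, hc⟩ := h.dvd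
  have h1 := Nat.div_add_mod u M
  have h2 := Nat.div_add_mod v M
  have h3 := Nat.mod_lt u hM
  have h4 := Nat.mod_lt v hM
  rw [huv] at h1
  have hN : 0 < (N : ℤ) := by omega
  have hc1 : c < 1 := by
    by_contra hc1
    have : (N : ℤ) * 1 ≤ N * c := by gcongr; omega
    omega
  have hc2 : -2 < c := by
    by_contra hc2
    have : (N : ℤ) * c ≤ N * (-2) := by gcongr; omega
    omega
  obtain rfl | rfl : c = 0 ∨ c = -1 := by omega
  · left; omega
  · right; omega

open Finset in
/-- Markov's inequality for the weights after a random word has been drawn. -/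
theorem card_sum_weights_le {ι : Type*} (s : Finset ι) (w : ι → ℕ) (N K : ℕ) (bad : ℕ → ι → Prop)
    [∀ a i, Decidable (bad a i)] (h : ∀ i ∈ s, #{a ∈ range N | bad a i} * K ≤ N) :
    N ≤ 2 * #{a ∈ range N | ∑ i ∈ s, w i * (if bad a i then K else 1) ≤ 4 * ∑ i ∈ s, w i} := by
  set Φ := ∑ i ∈ s, w i with hΦ
  set g : ℕ → ℕ := fun a => ∑ i ∈ s, w i * (if bad a i then K else 1) with hg
  -- The expected factor of each item is at most `1 + K * Pr[bad] ≤ 2`.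
  have htot : ∑ a ∈ range N, g a ≤ 2 * N * Φ := by
    rw [hg, sum_comm, hΦ, mul_sum]
    refine sum_le_sum fun i hi => ?_
    rw [← mul_sum, mul_comm (2 * N)]
    gcongr
    have hle : ∀ a ∈ range N, (if bad a i then K else 1) ≤ 1 + if bad a i then K else 0 :=
      fun a _ => by split_ifs <;> omega
    refine (sum_le_sum hle).trans ?_
    rw [sum_add_distrib, ← sum_filter, sum_const, sum_const, card_range, smul_eq_mul, smul_eq_mul]
    have := h i hi
    omega
  change N ≤ 2 * #{a ∈ range N | g a ≤ 4 * Φ}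
  have hcard := card_filter_add_card_filter_not (s := range N) (fun a => g a ≤ 4 * Φ)
  rw [card_range] at hcard
  rcases Nat.eq_zero_or_pos Φ with h0 | h0
  · have hw : ∀ i ∈ s, w i = 0 := by
      rw [hΦ] at h0
      exact fun i hi => (sum_eq_zero_iff.1 h0) i hi
    have : ∀ a ∈ range N, g a ≤ 4 * Φ := fun a _ => by
      rw [hg]
      simp only
      rw [sum_eq_zero fun i hi => by rw [hw i hi, zero_mul]]
      omega
    rw [filter_true_of_mem this, card_range]
    omega
  -- Words that exceed twice the bound `2 * Φ` on the average make up at most half of all words.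
  · have h1 : #{a ∈ range N | ¬ g a ≤ 4 * Φ} * (4 * Φ) ≤ 2 * N * Φ := by
      refine le_trans ?_ htot
      refine le_trans ?_ (sum_le_sum_of_subset (filter_subset (fun a => ¬ g a ≤ 4 * Φ) _))
      rw [← smul_eq_mul]
      refine card_nsmul_le_sum _ _ _ fun a ha => ?_
      have := (mem_filter.1 ha).2
      omega
    have h2 : #{a ∈ range N | ¬ g a ≤ 4 * Φ} * 4 ≤ 2 * N := by
      refine Nat.le_of_mul_le_mul_right ?_ h0
      rw [mul_assoc]
      exact h1
    omega

theorem List.length_le_countP_add (as : List ℕ) (p q r t : ℕ → Bool)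
    (h : ∀ a ∈ as, p a ∨ q a ∨ r a ∨ t a) :
    as.length ≤ as.countP p + as.countP q + as.countP r + as.countP t := by
  induction as with
  | nil => simp
  | cons a as ih =>
    have h1 := ih fun b hb => h b (List.mem_cons_of_mem _ hb)
    have h2 := h a List.mem_cons_self
    simp only [List.length_cons, List.countP_cons]
    rcases h2 with h2 | h2 | h2 | h2 <;> rw [h2] <;> simp only [if_true] <;> omega

/-- The weight of an item that is bad for some of the words in `as`. -/
def weight {ι : Type*} (bad : ℕ → ι → Prop) [∀ a i, Decidable (bad a i)] (as : List ℕ) (i : ι) : ℕ :=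
  (2 ^ 16) ^ as.countP fun a => bad a i

theorem weight_cons {ι : Type*} (bad : ℕ → ι → Prop) [∀ a i, Decidable (bad a i)] (as : List ℕ)
    (a : ℕ) (i : ι) : weight bad (a :: as) i = weight bad as i * if bad a i then 2 ^ 16 else 1 := by
  rw [weight, weight, List.countP_cons]
  by_cases h : bad a i
  · simp [h, pow_succ]
  · simp [h]

/-- If the total weight is small, then for every four items there is a word for which none of them
is bad. -/
theorem exists_not_bad {ι : Type*} (bad : ℕ → ι → Prop) [∀ a i, Decidable (bad a i)] (as : List ℕ)
    (s : Finset ι) {c : ℕ} (hw : ∑ i ∈ s, weight bad as i ≤ c * 4 ^ as.length)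
    (hc : c < 4 ^ as.length) {i₁ i₂ i₃ i₄ : ι} (h₁ : i₁ ∈ s) (h₂ : i₂ ∈ s) (h₃ : i₃ ∈ s)
    (h₄ : i₄ ∈ s) : ∃ a ∈ as, ¬ bad a i₁ ∧ ¬ bad a i₂ ∧ ¬ bad a i₃ ∧ ¬ bad a i₄ := by
  -- An item that is bad for a quarter of the `r` words would have weight at least `(2 ^ 16) ^ (r /
  -- 4) = 16 ^ r`, but the total is below `4 ^ r * 4 ^ r`.
  have key : ∀ i ∈ s, 4 * as.countP (fun a => bad a i) < as.length := by
    intro i hi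
    by_contra hcon
    have h1 : weight bad as i ≤ c * 4 ^ as.length :=
      (Finset.single_le_sum (f := weight bad as) (fun _ _ => Nat.zero_le _) hi).trans hw
    have h2 : c * 4 ^ as.length < 4 ^ as.length * 4 ^ as.length :=
      Nat.mul_lt_mul_of_pos_right hc (by positivity)
    have h3 : 4 ^ as.length * 4 ^ as.length ≤ weight bad as i := by
      rw [weight, ← pow_add, show (4 : ℕ) = 2 ^ 2 by norm_num, ← pow_mul, ← pow_mul]
      exact Nat.pow_le_pow_right (by norm_num) (by omega)
    omega
  by_contra hcon
  push Not at hcon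
  have h := as.length_le_countP_add (fun a => bad a i₁) (fun a => bad a i₂) (fun a => bad a i₃)
    (fun a => bad a i₄) fun a ha => by
      simp only [decide_eq_true_eq]
      have := hcon a ha
      tauto
  have := key i₁ h₁
  have := key i₂ h₂
  have := key i₃ h₃
  have := key i₄ h₄
  omega

/-! ### Vectors of conditional assignments -/

/-- The vector after the conditional assignments `f (pos i) := val i` for `i < t`. -/
def writes (cond : ℕ → Prop) [DecidablePred cond] (pos : ℕ → ℕ) (val : ℕ → ℤ) (f : ℕ → ℤ) :
    ℕ → ℕ → ℤ
  | 0 => f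
  | t + 1 => if cond t then Function.update (writes cond pos val f t) (pos t) (val t)
      else writes cond pos val f t

section writes

variable {cond : ℕ → Prop} [DecidablePred cond] {pos : ℕ → ℕ} {val : ℕ → ℤ} {f : ℕ → ℤ}

/-- For soundness: whatever is overwritten, an entry is either an initial one or one of the written
values. -/
theorem writes_cases (t k : ℕ) : writes cond pos val f t k = f k ∨
    ∃ i < t, cond i ∧ pos i = k ∧ writes cond pos val f t k = val i := by
  induction t with
  | zero => exact .inl rfl
  | succ t ih =>
    rw [writes]
    by_cases hk : cond t ∧ k = pos t
    · right
      exact ⟨t, by omega, hk.1, hk.2.symm, by simp [hk.1, hk.2]⟩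
    · have : (if cond t then Function.update (writes cond pos val f t) (pos t) (val t)
          else writes cond pos val f t) k = writes cond pos val f t k := by
        split_ifs with hc
        · rw [Function.update_apply, if_neg fun h => hk ⟨hc, h⟩]
        · rfl
      rw [this]
      rcases ih with h | ⟨i, hi, h⟩
      · exact .inl h
      · exact .inr ⟨i, by omega, h⟩

theorem writes_eq_of_forall_ne {t k : ℕ} (h : ∀ i < t, cond i → pos i ≠ k) :
    writes cond pos val f t k = f k := by
  rcases writes_cases (cond := cond) (pos := pos) (val := val) (f := f) t k with h1 | ⟨i, hi, hc, hp, -⟩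
  · exact h1
  · exact absurd hp (h i hi hc)

/-- For completeness: a value survives if no other active assignment has the same position. -/
theorem writes_eq_val {t i : ℕ} (hi : i < t) (hc : cond i)
    (h : ∀ j < t, cond j → pos j = pos i → j = i) : writes cond pos val f t (pos i) = val i := by
  induction t with
  | zero => omega
  | succ t ih =>
    rw [writes]
    by_cases hit : i = t
    · subst hit
      simp [hc]
    · have h1 := ih (by omega) fun j hj => h j (by omega)
      split_ifs with hct
      · rw [Function.update_apply, if_neg, h1]
        intro he
        exact hit (h t (by omega) hct he.symm).symm
      · exact h1

end writes

/-! ### From a set to vectors: correctness of the reduction -/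

/-- An instance of `3SUM` of size `n`, with a word length `W`, together with the size `m` of the
instances of `Convolution3SUM` to be created, the block length `L` and a bound `D` for the
elements. -/
structure Inst where
  n : ℕ
  m : ℕ
  W : ℕ
  L : ℕ
  D : ℕ
  x : ℕ → ℤ

namespace Inst

variable (P : Inst)

/-- The number of words. -/
def N : ℕ := 2 ^ P.W

/-- The number of buckets. -/
def R : ℕ := 2 ^ 22 * P.L

/-- The number of words that are mapped to the same bucket. -/
def Mh : ℕ := P.N / P.R

/-- The number of words that are mapped to the same color. -/
def Mc : ℕ := P.N / 2 ^ 22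

/-- The elements in two's complement. -/
def X (i : ℕ) : ℕ := (P.x i % P.N).toNat

/-- The bucket of an element. -/
def hash (a i : ℕ) : ℕ := a * P.X i % P.N / P.Mh

/-- The color of a position. -/
def color (a i : ℕ) : ℕ := a * i % P.N / P.Mc

/-- The number of elements in the bucket of an element. -/
def count (a i : ℕ) : ℕ := ((Finset.range P.n).filter fun l => P.hash a l = P.hash a i).card

/-- The word `a` is bad for the item `i`. The items below `n` are the elements, the others are the
differences of positions. -/
def Bad (a i : ℕ) : Prop :=
  if i < P.n then P.count a i ≠ 1 else NearZero P.N P.Mc (a * (i - P.n + 1) % P.N)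

instance (a i : ℕ) : Decidable (P.Bad a i) := by
  unfold Bad
  infer_instance

/-- The block of the first summand. -/
def blockI (c : ℕ) : ℕ := c / 2 ^ 45

/-- The block of the second summand. -/
def blockJ (c : ℕ) : ℕ := c / 2 ^ 23 % 2 ^ 22

/-- The color of the first summand. -/
def colorI (c : ℕ) : ℕ := c / 2 % 2 ^ 22

/-- The carry. -/
def carry (c : ℕ) : ℕ := c % 2

/-- The distance of a bucket from the beginning of the block of the sums. -/
def offset (a c i : ℕ) : ℕ :=
  (P.hash a i + (2 * P.R - ((blockI c + blockJ c) * P.L + carry c))) % P.R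

/-- The vector of sentinels. -/
def sentinels (k : ℕ) : ℤ := if k < P.m then 12 else 0

/-- Enter the first summands. -/
def vec₁ (a c : ℕ) : ℕ → ℕ → ℤ :=
  writes (fun i => P.hash a i / P.L = blockI c ∧ P.color a i = colorI c ∧ P.X i ≠ 0)
    (fun i => P.L + P.hash a i % P.L) (fun i => 16 * P.x i + 1) P.sentinels

/-- Enter the second summands. -/
def vec₂ (a c : ℕ) : ℕ → ℕ → ℤ :=
  writes (fun i => P.hash a i / P.L = blockJ c ∧ P.color a i ≠ colorI c ∧ P.X i ≠ 0)
    (fun i => 2 * P.L + P.hash a i % P.L) (fun i => 16 * P.x i + 3) (P.vec₁ a c P.n)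

/-- Enter the sums. -/
def vec₃ (a c : ℕ) : ℕ → ℕ → ℤ :=
  writes (fun i => P.offset a c i < 2 * P.L)
    (fun i => 3 * P.L + P.offset a c i) (fun i => 16 * P.x i + 4) (P.vec₂ a c P.n)

/-- The vector for the word `a` and the choice `c` of blocks, color and carry. -/
def vec (a c : ℕ) : ℕ → ℤ := P.vec₃ a c P.n

/-- The requirements on the parameters. -/
structure Valid : Prop where
  inj : ∀ i < P.n, ∀ j < P.n, P.x i = P.x j → i = j
  lo : ∀ i < P.n, -(P.D : ℤ) ≤ P.x i
  hi : ∀ i < P.n, P.x i < P.D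
  D_le : 2 * P.D ≤ P.Mh
  n_le : P.n ≤ P.m
  le_m : 8 * P.L ≤ P.m
  m_lt : P.m < 16 * P.L
  dvd : P.R ∣ P.N
  n_le_Mc : P.n ≤ P.Mc

variable {P} (hP : P.Valid)
include hP

theorem Valid.L_pos : 0 < P.L := by
  have := hP.m_lt
  omega

omit hP in
theorem N_pos : 0 < P.N := Nat.two_pow_pos _

theorem Valid.R_mul : P.R * P.Mh = P.N := Nat.mul_div_cancel' hP.dvd

theorem Valid.Mh_pos : 0 < P.Mh := by
  have h1 := hP.R_mul
  have h2 := N_pos (P := P)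
  rcases Nat.eq_zero_or_pos P.Mh with h | h
  · simp [h] at h1
    omega
  · exact h

theorem Valid.mul_Mc : 2 ^ 22 * P.Mc = P.N :=
  Nat.mul_div_cancel' ((Dvd.intro _ rfl).trans hP.dvd)

theorem Valid.Mc_pos : 0 < P.Mc := by
  have h1 := hP.mul_Mc
  have h2 := N_pos (P := P)
  omega

omit hP in
theorem Mh_le : P.Mh ≤ P.N := Nat.div_le_self _ _

omit hP in
theorem Mc_le : P.Mc ≤ P.N := Nat.div_le_self _ _

omit hP in
theorem X_cast (i : ℕ) : (P.X i : ℤ) = P.x i % P.N := by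
  have := N_pos (P := P)
  exact Int.toNat_of_nonneg (Int.emod_nonneg _ (by omega))

theorem Valid.X_eq_zero {i : ℕ} (hi : i < P.n) : P.X i = 0 ↔ P.x i = 0 := by
  have h1 := X_cast (P := P) i
  have h2 := hP.lo i hi
  have h3 := hP.hi i hi
  have h4 := hP.D_le
  have h5 := Mh_le (P := P)
  constructor
  · intro h
    rw [h] at h1
    obtain ⟨c, hc⟩ := Int.dvd_of_emod_eq_zero h1.symm
    have hN := N_pos (P := P)
    by_contra hx
    have hc0 : c ≠ 0 := by
      rintro rfl
      simp at hc
      exact hx hc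
    rcases lt_or_gt_of_ne hc0 with h | h
    · have : (P.N : ℤ) * c ≤ P.N * (-1) := by gcongr; omega
      omega
    · have : (P.N : ℤ) * 1 ≤ P.N * c := by gcongr; omega
      omega
  · intro h
    rw [h] at h1
    simpa using h1

omit hP in
theorem mul_X_modEq (a i : ℕ) : ((a * P.X i % P.N : ℕ) : ℤ) ≡ a * P.x i [ZMOD P.N] := by
  push_cast
  rw [X_cast]
  exact (Int.mod_modEq _ _).trans ((Int.ModEq.refl _).mul (Int.mod_modEq _ _))

theorem Valid.hash_lt (a i : ℕ) : P.hash a i < P.R := by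
  rw [hash, Nat.div_lt_iff_lt_mul hP.Mh_pos, hP.R_mul]
  exact Nat.mod_lt _ N_pos

theorem Valid.color_lt (a i : ℕ) : P.color a i < 2 ^ 22 := by
  rw [color, Nat.div_lt_iff_lt_mul hP.Mc_pos, hP.mul_Mc]
  exact Nat.mod_lt _ N_pos

/-- The absolute difference is used because the counting lemma needs a positive multiplier, and
nearness to 0 modulo `N` is insensitive to the sign. -/
theorem Valid.nearZero_of_hash_eq {a i j : ℕ} (h : P.hash a i = P.hash a j) :
    NearZero P.N P.Mh (a * (P.x i - P.x j).natAbs % P.N) := by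
  have hi := Nat.mod_lt (a * P.X i) (N_pos (P := P))
  have hj := Nat.mod_lt (a * P.X j) (N_pos (P := P))
  have hz := Nat.mod_lt (a * (P.x i - P.x j).natAbs) (N_pos (P := P))
  have hmod : ((a * (P.x i - P.x j).natAbs % P.N : ℕ) : ℤ) ≡ a * |P.x i - P.x j| [ZMOD P.N] := by
    push_cast
    exact Int.mod_modEq _ _
  rcases le_total (P.x j) (P.x i) with hle | hle
  · refine nearZero_of_div_eq hP.Mh_pos hi hj h hz (hmod.trans ?_)
    rw [abs_of_nonneg (by omega), mul_sub]
    exact ((mul_X_modEq a i).sub (mul_X_modEq a j)).symm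
  · refine nearZero_of_div_eq hP.Mh_pos hj hi h.symm hz (hmod.trans ?_)
    rw [abs_of_nonpos (by omega), neg_sub, mul_sub]
    exact ((mul_X_modEq a j).sub (mul_X_modEq a i)).symm

theorem Valid.nearZero_of_color_eq {a i j : ℕ} (hij : j < i) (h : P.color a i = P.color a j) :
    NearZero P.N P.Mc (a * (i - j) % P.N) := by
  have hi := Nat.mod_lt (a * i) (N_pos (P := P))
  have hj := Nat.mod_lt (a * j) (N_pos (P := P))
  have hz := Nat.mod_lt (a * (i - j)) (N_pos (P := P))
  refine nearZero_of_div_eq hP.Mc_pos hi hj h hz ?_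
  push_cast [Nat.cast_sub hij.le]
  refine (Int.mod_modEq _ _).trans ?_
  rw [mul_sub]
  exact ((Int.mod_modEq _ _).sub (Int.mod_modEq _ _)).symm

omit hP in
theorem eq_of_not_bad {a i j : ℕ} (hi : i < P.n) (hj : j < P.n) (hb : ¬ P.Bad a i)
    (h : P.hash a j = P.hash a i) : j = i := by
  rw [Bad, if_pos hi, not_not, count, Finset.card_eq_one] at hb
  obtain ⟨k, hk⟩ := hb
  have h1 : i ∈ ({k} : Finset ℕ) := hk ▸ Finset.mem_filter.2 ⟨Finset.mem_range.2 hi, rfl⟩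
  have h2 : j ∈ ({k} : Finset ℕ) := hk ▸ Finset.mem_filter.2 ⟨Finset.mem_range.2 hj, h⟩
  rw [Finset.mem_singleton] at h1 h2
  rw [h1, h2]

open Finset in
-- For an element, a union bound over the other elements; their differences are nonzero and at most
-- `2 * D ≤ Mh`. For a difference of positions there is just one condition, and the difference is at
-- most `n ≤ Mc`.
theorem Valid.card_bad_le {i : ℕ} (hi : i < 2 * P.n) : #{a ∈ range P.N | P.Bad a i} * 2 ^ 16 ≤ P.N := by
  have hL := hP.m_lt
  have hn := hP.n_le
  by_cases hin : i < P.n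
  · have hsub : {a ∈ range P.N | P.Bad a i} ⊆ ((range P.n).erase i).biUnion fun l =>
        {a ∈ range P.N | NearZero P.N P.Mh (a * (P.x l - P.x i).natAbs % P.N)} := by
      intro a ha
      rw [mem_filter] at ha
      obtain ⟨ha, hb⟩ := ha
      rw [Bad, if_pos hin, count] at hb
      rw [mem_biUnion]
      by_contra hcon
      push Not at hcon
      refine hb ?_
      rw [Finset.card_eq_one]
      refine ⟨i, Finset.ext fun l => ?_⟩
      rw [mem_filter, mem_singleton, mem_range]
      constructor
      · rintro ⟨hl, hh⟩
        by_contra hne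
        exact hcon l (mem_erase.2 ⟨hne, mem_range.2 hl⟩)
          (mem_filter.2 ⟨ha, hP.nearZero_of_hash_eq hh⟩)
      · rintro rfl
        exact ⟨hin, rfl⟩
    have h1 : #{a ∈ range P.N | P.Bad a i} ≤ P.n * (4 * P.Mh) := by
      refine (card_le_card hsub).trans (card_biUnion_le.trans ?_)
      have : ∀ l ∈ (range P.n).erase i,
          #{a ∈ range P.N | NearZero P.N P.Mh (a * (P.x l - P.x i).natAbs % P.N)} ≤ 4 * P.Mh := by
        intro l hl
        obtain ⟨hne, hl⟩ := mem_erase.1 hl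
        rw [mem_range] at hl
        have e1 := hP.lo l hl
        have e2 := hP.hi l hl
        have e3 := hP.lo i hin
        have e4 := hP.hi i hin
        have e5 := hP.D_le
        have e6 : P.x l ≠ P.x i := fun h => hne (hP.inj l hl i hin h)
        exact card_nearZero_le (by omega) (by omega) Mh_le
      refine (sum_le_sum this).trans ?_
      rw [sum_const, smul_eq_mul]
      gcongr
      exact (card_le_card (erase_subset _ _)).trans (by simp)
    -- This fixes the number of buckets: with `n < 16 * L`, the factor is `16 * 4 * 2 ^ 16 = 2 ^ 26`
    calc _ ≤ P.n * (4 * P.Mh) * 2 ^ 16 := by gcongr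
      _ ≤ (16 * P.L) * (4 * P.Mh) * 2 ^ 16 := by gcongr; omega
      _ = P.R * P.Mh := by rw [R]; ring
      _ = P.N := hP.R_mul
  · have h1 : #{a ∈ range P.N | P.Bad a i} ≤ 4 * P.Mc := by
      simp only [Bad, if_neg hin]
      have := hP.n_le_Mc
      exact card_nearZero_le (by omega) (by omega) Mc_le
    have := hP.mul_Mc
    omega

theorem Valid.vec_cases (a c k : ℕ) (hk : k < P.m) : P.vec a c k = 12 ∨
    (∃ i < P.n, P.color a i = colorI c ∧ P.x i ≠ 0 ∧ P.vec a c k = 16 * P.x i + 1) ∨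
    (∃ i < P.n, P.color a i ≠ colorI c ∧ P.x i ≠ 0 ∧ P.vec a c k = 16 * P.x i + 3) ∨
    ∃ i < P.n, P.vec a c k = 16 * P.x i + 4 := by
  simp only [vec]
  rcases writes_cases (cond := fun i => P.offset a c i < 2 * P.L)
    (pos := fun i => 3 * P.L + P.offset a c i) (val := fun i => 16 * P.x i + 4)
    (f := P.vec₂ a c P.n) P.n k with h | ⟨i, hi, hc, -, h⟩
  swap
  · exact .inr (.inr (.inr ⟨i, hi, h⟩))
  rw [vec₃, h]
  rcases writes_cases (cond := fun i => P.hash a i / P.L = blockJ c ∧ P.color a i ≠ colorI c ∧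
      P.X i ≠ 0) (pos := fun i => 2 * P.L + P.hash a i % P.L) (val := fun i => 16 * P.x i + 3)
    (f := P.vec₁ a c P.n) P.n k with h | ⟨i, hi, hc, -, h⟩
  swap
  · exact .inr (.inr (.inl ⟨i, hi, hc.2.1, mt (hP.X_eq_zero hi).2 hc.2.2, h⟩))
  rw [vec₂, h]
  rcases writes_cases (cond := fun i => P.hash a i / P.L = blockI c ∧ P.color a i = colorI c ∧
      P.X i ≠ 0) (pos := fun i => P.L + P.hash a i % P.L) (val := fun i => 16 * P.x i + 1)
    (f := P.sentinels) P.n k with h | ⟨i, hi, hc, -, h⟩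
  swap
  · exact .inr (.inl ⟨i, hi, hc.2.1, mt (hP.X_eq_zero hi).2 hc.2.2, h⟩)
  rw [vec₁, h]
  exact .inl (if_pos hk)

/-- Holds for every word and every choice, good or bad. Different colors make the summands distinct
elements, and nonzero summands differ from the sum. -/
theorem Valid.threeSum_of_vec {a c : ℕ}
    (h : convolutionThreeSum.IsYes P.m fun k : Fin P.m => P.vec a c k) :
    threeSum.IsYes P.n fun i : Fin P.n => P.x i := by
  have key : ∃ i < P.n, ∃ j < P.n, ∃ k < P.n, P.color a i ≠ P.color a j ∧ P.x i ≠ 0 ∧ P.x j ≠ 0 ∧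
      P.x i + P.x j = P.x k := by
    obtain ⟨i, j, k, -, h⟩ := h
    simp only at h
    -- Among the tags 12, 1, 3, 4, the only sums that are again a tag modulo 16 are `1 + 3 = 4` and
    -- `3 + 1 = 4`.
    rcases hP.vec_cases a c i i.2 with hi | ⟨i', hi', c1, d1, hi⟩ | ⟨i', hi', c1, d1, hi⟩ | ⟨i', hi', hi⟩ <;>
    rcases hP.vec_cases a c j j.2 with hj | ⟨j', hj', c2, d2, hj⟩ | ⟨j', hj', c2, d2, hj⟩ | ⟨j', hj', hj⟩ <;>
    rcases hP.vec_cases a c k k.2 with hk | ⟨k', hk', c3, d3, hk⟩ | ⟨k', hk', c3, d3, hk⟩ | ⟨k', hk', hk⟩ <;>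
    rw [hi, hj, hk] at h <;> first
    | (exfalso; omega)
    | exact ⟨i', hi', j', hj', k', hk', by rw [c1]; exact c2.symm, d1, d2, by omega⟩
    | exact ⟨i', hi', j', hj', k', hk', by rw [c2]; exact c1, d1, d2, by omega⟩
  obtain ⟨i, hi, j, hj, k, hk, hc, h1, h2, h3⟩ := key
  refine ⟨_, ⟨⟨i, hi⟩, rfl⟩, _, ⟨⟨j, hj⟩, rfl⟩, _, ⟨⟨k, hk⟩, rfl⟩, ?_, ?_, ?_, h3⟩
  · intro h
    exact hc (by rw [hP.inj i hi j hj h])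
  · simp only
    omega
  · simp only
    omega

/-- The sum of two elements in the hash table. -/
theorem Valid.hash_add {a i j k : ℕ} (h : P.x i + P.x j = P.x k) :
    ∃ d < 2, ∃ e < 2, P.hash a i + P.hash a j + d = P.hash a k + e * P.R := by
  have hM := hP.Mh_pos
  have hR := hP.R_mul
  have hi := Nat.mod_lt (a * P.X i) (N_pos (P := P))
  have hj := Nat.mod_lt (a * P.X j) (N_pos (P := P))
  have hk := Nat.mod_lt (a * P.X k) (N_pos (P := P))
  have hmod : ((a * P.X i % P.N : ℕ) : ℤ) + (a * P.X j % P.N : ℕ) ≡ (a * P.X k % P.N : ℕ)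
      [ZMOD P.N] := by
    refine ((mul_X_modEq a i).add (mul_X_modEq a j)).trans ?_
    rw [← mul_add, h]
    exact (mul_X_modEq a k).symm
  simp only [hash]
  set u := a * P.X i % P.N
  set v := a * P.X j % P.N
  set z := a * P.X k % P.N
  have huv : u + v = z ∨ u + v = z + P.N := by
    have h1 : (u + v) % P.N = z % P.N := by
      have := hmod
      unfold Int.ModEq at this
      exact_mod_cast this
    rw [Nat.mod_eq_of_lt hk] at h1
    have h2 := Nat.div_add_mod (u + v) P.N
    have h3 : (u + v) / P.N < 2 := by
      rw [Nat.div_lt_iff_lt_mul N_pos]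
      omega
    interval_cases h4 : (u + v) / P.N <;> omega
  have e1 := Nat.div_add_mod u P.Mh
  have e2 := Nat.div_add_mod v P.Mh
  have l1 := Nat.mod_lt u hM
  have l2 := Nat.mod_lt v hM
  have hsum : (u + v) / P.Mh = u / P.Mh + v / P.Mh + (u % P.Mh + v % P.Mh) / P.Mh := by
    conv_lhs => rw [← e1, ← e2]
    rw [show P.Mh * (u / P.Mh) + u % P.Mh + (P.Mh * (v / P.Mh) + v % P.Mh) =
      P.Mh * (u / P.Mh + v / P.Mh) + (u % P.Mh + v % P.Mh) by ring, Nat.mul_add_div hM]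
  -- The carry comes from the low parts; `e` tells whether the sum of the residues wraps around
  -- modulo `N`.
  refine ⟨(u % P.Mh + v % P.Mh) / P.Mh, ?_, ?_⟩
  · rw [Nat.div_lt_iff_lt_mul hM]
    omega
  rw [← hsum]
  rcases huv with huv | huv
  · exact ⟨0, by omega, by rw [huv, zero_mul, add_zero]⟩
  · refine ⟨1, by omega, ?_⟩
    rw [huv, ← hR, mul_comm P.R, Nat.add_mul_div_left _ _ hM, one_mul]

/-- Write the buckets of the summands as `L * I + u` and `L * J + v`. Removing the block parts and
the carry from the bucket of the sum leaves `u + v` modulo `R`, and `u + v < 2 * L ≤ R`. The summand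
`2 * R` in `offset` prevents truncated subtraction. -/
theorem Valid.offset_eq {a c i j k e : ℕ} (hI : P.hash a i / P.L = blockI c)
    (hJ : P.hash a j / P.L = blockJ c)
    (h : P.hash a i + P.hash a j + carry c = P.hash a k + e * P.R) (he : e < 2) :
    P.offset a c k = P.hash a i % P.L + P.hash a j % P.L := by
  have hL := hP.L_pos
  have e1 := Nat.div_add_mod (P.hash a i) P.L
  have e2 := Nat.div_add_mod (P.hash a j) P.L
  have l1 := Nat.mod_lt (P.hash a i) hL
  have l2 := Nat.mod_lt (P.hash a j) hL
  have l3 := hP.hash_lt a i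
  have l4 := hP.hash_lt a j
  rw [hI] at e1
  rw [hJ] at e2
  have hR : P.R = 2 ^ 22 * P.L := rfl
  have hIJ : (blockI c + blockJ c) * P.L = P.L * blockI c + P.L * blockJ c := by ring
  have hd : carry c < 2 := Nat.mod_lt _ (by omega)
  set u := P.hash a i % P.L
  set v := P.hash a j % P.L
  have hlt : u + v < P.R := by omega
  rw [offset, hIJ]
  have hle : P.L * blockI c + P.L * blockJ c + carry c ≤ 2 * P.R := by omega
  have h2 : P.hash a k + (2 * P.R - (P.L * blockI c + P.L * blockJ c + carry c)) =
      u + v + (2 - e) * P.R := by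
    interval_cases e <;> omega
  rw [h2, Nat.add_mul_mod_self_right, Nat.mod_eq_of_lt hlt]

theorem Valid.offset_inj {a c i j : ℕ} (h : P.offset a c i = P.offset a c j) :
    P.hash a i = P.hash a j := by
  have h1 := Nat.ModEq.add_right_cancel' _ h
  rwa [Nat.ModEq, Nat.mod_eq_of_lt (hP.hash_lt a i), Nat.mod_eq_of_lt (hP.hash_lt a j)] at h1

omit hP in
theorem hash_inj {a i j : ℕ} (h : P.hash a i / P.L = P.hash a j / P.L)
    (h' : P.hash a i % P.L = P.hash a j % P.L) : P.hash a i = P.hash a j := by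
  rw [← Nat.div_add_mod (P.hash a i) P.L, h, h', Nat.div_add_mod]

omit hP in
-- Two blocks, a color and a carry take `22 + 22 + 22 + 1 = 67` bits.
theorem exists_choice {I J p d : ℕ} (hI : I < 2 ^ 22) (hJ : J < 2 ^ 22) (hp : p < 2 ^ 22)
    (hd : d < 2) : ∃ c < 2 ^ 67, blockI c = I ∧ blockJ c = J ∧ colorI c = p ∧ carry c = d := by
  refine ⟨((I * 2 ^ 22 + J) * 2 ^ 22 + p) * 2 + d, ?_⟩
  simp only [blockI, blockJ, colorI, carry]
  omega

/-- Take the choice given by the actual blocks, color and carry. The three ranges of positions are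
disjoint and lie below `5 * L ≤ m`. Within a range an equal position means an equal bucket, so an
element that is alone in its bucket is not overwritten. -/
theorem Valid.vec_of_threeSum {a i j k : ℕ} (hi : i < P.n) (hj : j < P.n) (hk : k < P.n)
    (h : P.x i + P.x j = P.x k) (hi0 : P.x i ≠ 0) (hj0 : P.x j ≠ 0) (bi : ¬ P.Bad a i)
    (bj : ¬ P.Bad a j) (bk : ¬ P.Bad a k) (hc : P.color a i ≠ P.color a j) :
    ∃ c < 2 ^ 67, convolutionThreeSum.IsYes P.m fun k : Fin P.m => P.vec a c k := by
  obtain ⟨d, hd, e, he, hde⟩ := hP.hash_add (a := a) h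
  have hL := hP.L_pos
  have hm := hP.le_m
  have b1 : P.hash a i / P.L < 2 ^ 22 := by
    rw [Nat.div_lt_iff_lt_mul hL]
    exact hP.hash_lt a i
  have b2 : P.hash a j / P.L < 2 ^ 22 := by
    rw [Nat.div_lt_iff_lt_mul hL]
    exact hP.hash_lt a j
  have b3 := hP.color_lt a i
  obtain ⟨c, hc67, hcI, hcJ, hcp, hcd⟩ := exists_choice b1 b2 b3 hd
  refine ⟨c, hc67, ?_⟩
  have hoff := hP.offset_eq (a := a) (c := c) hcI.symm hcJ.symm (hcd ▸ hde) he
  have l1 := Nat.mod_lt (P.hash a i) hL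
  have l2 := Nat.mod_lt (P.hash a j) hL
  have v1 : P.vec a c (P.L + P.hash a i % P.L) = 16 * P.x i + 1 := by
    rw [vec, vec₃, writes_eq_of_forall_ne fun t _ _ h => by omega,
      vec₂, writes_eq_of_forall_ne fun t _ _ h => by omega, vec₁]
    refine writes_eq_val (pos := fun i => P.L + P.hash a i % P.L)
      (val := fun i => 16 * P.x i + 1) hi ⟨hcI.symm, hcp.symm, mt (hP.X_eq_zero hi).1 hi0⟩ ?_
    rintro t ht ⟨ct, -, -⟩ hpos
    exact eq_of_not_bad hi ht bi (hash_inj (ct.trans hcI) (by simpa using hpos))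
  have v2 : P.vec a c (2 * P.L + P.hash a j % P.L) = 16 * P.x j + 3 := by
    rw [vec, vec₃, writes_eq_of_forall_ne fun t _ _ h => by omega, vec₂]
    refine writes_eq_val (pos := fun i => 2 * P.L + P.hash a i % P.L)
      (val := fun i => 16 * P.x i + 3) hj ⟨hcJ.symm, fun h => hc (hcp ▸ h.symm), mt (hP.X_eq_zero hj).1 hj0⟩ ?_
    rintro t ht ⟨ct, -, -⟩ hpos
    exact eq_of_not_bad hj ht bj (hash_inj (ct.trans hcJ) (by simpa using hpos))
  have v3 : P.vec a c (3 * P.L + P.offset a c k) = 16 * P.x k + 4 := by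
    rw [vec, vec₃]
    refine writes_eq_val (pos := fun i => 3 * P.L + P.offset a c i)
      (val := fun i => 16 * P.x i + 4) hk (by omega) ?_
    intro t ht _ hpos
    exact eq_of_not_bad hk ht bk (hP.offset_inj (by simpa using hpos))
  refine ⟨⟨P.L + P.hash a i % P.L, by omega⟩, ⟨2 * P.L + P.hash a j % P.L, by omega⟩,
    ⟨3 * P.L + P.offset a c k, by omega⟩, ?_, ?_⟩
  · simp only
    omega
  · simp only [v1, v2, v3]
    omega

/-- Once the total weight is small, the vectors have a solution if and only if the set has one. -/
theorem Valid.exists_vec_iff (as : List ℕ)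
    (hw : ∑ i ∈ Finset.range (2 * P.n), weight P.Bad as i ≤ 2 * P.n * 4 ^ as.length)
    (hlen : 2 * P.n < 4 ^ as.length) :
    (∃ a ∈ as, ∃ c < 2 ^ 67, convolutionThreeSum.IsYes P.m fun k : Fin P.m => P.vec a c k) ↔
      threeSum.IsYes P.n fun i : Fin P.n => P.x i := by
  constructor
  · rintro ⟨a, -, c, -, h⟩
    exact hP.threeSum_of_vec h
  · rintro ⟨_, ⟨i, rfl⟩, _, ⟨j, rfl⟩, _, ⟨k, rfl⟩, h1, h2, h3, h⟩
    simp only at h h1 h2 h3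
    -- The differences are items only when positive, so the summands are ordered by position; the
    -- equation is symmetric in them.
    have key : ∀ i j : Fin P.n, (j : ℕ) < i → P.x i + P.x j = P.x k → P.x i ≠ P.x k →
        P.x j ≠ P.x k → ∃ a ∈ as, ∃ c < 2 ^ 67,
          convolutionThreeSum.IsYes P.m fun k : Fin P.m => P.vec a c k := by
      intro i j hij h h2 h3
      have hi := i.2
      have hj := j.2
      have hk := k.2
      obtain ⟨a, ha, n1, n2, n3, n4⟩ := exists_not_bad P.Bad as (Finset.range (2 * P.n)) hw hlen
        (i₁ := i) (i₂ := j) (i₃ := k) (i₄ := P.n + (i - j - 1)) (Finset.mem_range.2 (by omega))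
        (Finset.mem_range.2 (by omega)) (Finset.mem_range.2 (by omega))
        (Finset.mem_range.2 (by omega))
      -- If a summand were 0, the other one would equal the sum. The fourth item, the difference of
      -- positions, being good forces different colors.
      refine ⟨a, ha, hP.vec_of_threeSum hi hj hk h (by omega) (by omega) n1 n2 n3 fun hcol => n4 ?_⟩
      rw [Bad, if_neg (by omega), show P.n + (i - j - 1) - P.n + 1 = i - j by omega]
      exact hP.nearZero_of_color_eq hij hcol
    rcases lt_trichotomy (i : ℕ) j with hij | hij | hij
    · exact key j i hij (by omega) h3 h2
    · exact absurd (by rw [hij]) h1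
    · exact key i j hij h h2 h3

end Inst

/-! ### Counting and weighing on the machine -/

namespace WordRAM

open Ex

theorem BinOp.eval_add {W a b : ℕ} (h : a + b < 2 ^ W) : BinOp.add.eval W a b = a + b :=
  Nat.mod_eq_of_lt h

theorem BinOp.eval_mul {W a b : ℕ} (h : a * b < 2 ^ W) : BinOp.mul.eval W a b = a * b :=
  Nat.mod_eq_of_lt h

theorem BinOp.eval_sub {W a b : ℕ} (h : b ≤ a) (ha : a < 2 ^ W) : BinOp.sub.eval W a b = a - b := by
  change (a + (2 ^ W - b)) % 2 ^ W = _
  rw [show a + (2 ^ W - b) = (a - b) + 2 ^ W by omega, Nat.add_mod_right, Nat.mod_eq_of_lt (by omega)]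

theorem BinOp.eval_div {W a : ℕ} (b : ℕ) (h : a < 2 ^ W) : BinOp.div.eval W a b = a / b :=
  Nat.mod_eq_of_lt ((Nat.div_le_self _ _).trans_lt h)

theorem BinOp.eval_rem {W a : ℕ} (b : ℕ) (h : a < 2 ^ W) : BinOp.mod.eval W a b = a % b :=
  Nat.mod_eq_of_lt ((Nat.mod_le _ _).trans_lt h)

theorem BinOp.eval_ltOp {W : ℕ} (a b : ℕ) (h : 1 < 2 ^ W) :
    BinOp.lt.eval W a b = if a < b then 1 else 0 := by
  change (if a < b then 1 else 0) % 2 ^ W = _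
  exact Nat.mod_eq_of_lt (by split_ifs <;> omega)

theorem BinOp.eval_eqOp {W : ℕ} (a b : ℕ) (h : 1 < 2 ^ W) :
    BinOp.eq.eval W a b = if a = b then 1 else 0 := by
  change (if a = b then 1 else 0) % 2 ^ W = _
  exact Nat.mod_eq_of_lt (by split_ifs <;> omega)

/-- The abstract state holds the parameters and the elements of the instance. -/
structure Ctx (P : Inst) (V w' : ℕ) (H : HS) : Prop where
  n : H.v 0 = P.n
  q : H.v 3 = 2 ^ V
  m : H.v 5 = P.m
  L : H.v 6 = P.L
  R : H.v 7 = P.R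
  Mh : H.v 8 = P.Mh
  Mc : H.v 9 = P.Mc
  w' : H.v 21 = w'
  x : ∀ i < P.n, H.a 0 i = P.X i

/-- The numerical requirements of the reduction. -/
structure Fits (P : Inst) (S V D w' E : ℕ) : Prop where
  le : 8 * S ≤ 2 ^ P.W
  word : V ≤ P.W
  mem : 2 ^ V ≤ S
  regs : D ≤ S
  two_le : 2 ≤ D
  epoch : (E + 1) * 2 ^ V ≤ 2 ^ P.W
  n_le : 2 * P.n ≤ S
  R_le : P.R ≤ S
  m_lt : P.m < 2 ^ V
  w'_lt : w' < 2 ^ V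
  W_ge : 100 ≤ P.W
  weight : 2 ^ 20 * (2 * P.n + 1) ^ 2 ≤ 2 ^ P.W

variable {P : Inst} {S V D w' E : ℕ} {H H₀ : HS} {a i c : ℕ}

theorem Ctx.fr (h : Ctx P V w' H) {X J : List ℕ} {H' : HS} (hF : Fr X J H H')
    (hX : ∀ x ∈ [0, 3, 5, 6, 7, 8, 9, 21], x ∉ X) (hJ : 0 ∉ J) : Ctx P V w' H' where
  n := by rw [hF.v 0 (hX _ (by simp)), h.n]
  q := by rw [hF.v 3 (hX _ (by simp)), h.q]
  m := by rw [hF.v 5 (hX _ (by simp)), h.m]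
  L := by rw [hF.v 6 (hX _ (by simp)), h.L]
  R := by rw [hF.v 7 (hX _ (by simp)), h.R]
  Mh := by rw [hF.v 8 (hX _ (by simp)), h.Mh]
  Mc := by rw [hF.v 9 (hX _ (by simp)), h.Mc]
  w' := by rw [hF.v 21 (hX _ (by simp)), h.w']
  x := fun i hi => by rw [hF.a 0 hJ, h.x i hi]

theorem Fits.lit_lt (hf : Fits P S V D w' E) {c : ℕ} (hc : c < 2 ^ 100) : c < 2 ^ P.W :=
  hc.trans_le (Nat.pow_le_pow_right (by omega) hf.W_ge)

theorem Fits.lit (hf : Fits P S V D w' E) {c : ℕ} (hc : c < 2 ^ 100) : c % 2 ^ P.W = c :=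
  Nat.mod_eq_of_lt (hf.lit_lt hc)

theorem Fits.one_lt (hf : Fits P S V D w' E) : 1 < 2 ^ P.W := hf.lit_lt (by norm_num)

/-- The bucket of the current element. -/
def hashEx : Ex := .bin .div (.bin .mul (.var 10) (.arr 0 (.var 14))) (.var 8)

theorem eval_hashEx (hc : Ctx P V w' H) (ha : H.v 10 = a) (hi : H.v 14 = i) (hin : i < P.n) :
    hashEx.eval P.W H = P.hash a i := by
  simp only [hashEx, eval, ha, hi, hc.Mh, hc.x i hin]
  rw [BinOp.eval_div _ (BinOp.eval_lt ..)]
  rfl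

theorem ok_hashEx (hf : Fits P S V D w' E) (hi : H.v 14 = i) (hin : i < P.n) :
    hashEx.Ok P.W S H := by
  have := hf.n_le
  simp only [hashEx, Ok, eval, hi]
  omega

/-- Clear the counters of the buckets that are used. -/
def clearCounts : Prog := forDo 14 (.var 0) (put 1 hashEx (.lit 0))

/-- Count the elements in the buckets. -/
def countElements : Prog :=
  forDo 14 (.var 0) (put 1 hashEx (.bin .add (.arr 1 hashEx) (.lit 1)))

theorem clearCounts_spec (hP : P.Valid) (hf : Fits P S V D w' E) (hc : Ctx P V w' H)
    (ha : H.v 10 = a) : HSpec P.W S clearCounts H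
      (fun H' => Fr [14] [1] H H' ∧ ∀ l < P.n, H'.a 1 (P.hash a l) = 0) (100 * (P.n + 1)) := by
  have hn : P.n < 2 ^ P.W := by
    have := hf.n_le
    have := hf.le
    have := hf.one_lt
    omega
  refine (HSpec.forDo (x := 14) P.n (τ := 30) (fun i H' => H'.v 14 = i ∧ Fr [14] [1] H H' ∧
    ∀ l < i, H'.a 1 (P.hash a l) = 0) (by omega) (by omega) hn ?_ ?_ ?_).mono
    (fun H' h => h.2) (by simp [Ex.time]; omega)
  · exact ⟨by simp, (Fr.refl _ _ _).setV _ (by simp), by simp⟩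
  · rintro i H' ⟨h1, h2, -⟩
    have h0 := hc.fr h2 (by decide) (by decide)
    exact ⟨h1, by simp [Ok], h0.n⟩
  · rintro i hi H' ⟨h1, h2, h3⟩
    have h0 := hc.fr h2 (by decide) (by decide)
    have ha' : H'.v 10 = a := by rw [h2.v 10 (by decide), ha]
    have he := eval_hashEx h0 ha' h1 hi
    refine (HSpec.put (e := hashEx) (e' := .lit 0) (ok_hashEx hf h1 hi) trivial (by omega) ?_
      ?_).mono (fun H' h => h) (by simp [Ex.time, hashEx])
    · rw [he]
      exact (hP.hash_lt a i).trans_le hf.R_le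
    · rw [he]
      refine ⟨by simp [h1], by simp, (h2.setA _ _ (by simp)).setV _ (by simp), fun l hl => ?_⟩
      rcases Nat.lt_succ_iff_lt_or_eq.1 hl with hl | rfl
      · simp [Ex.eval, h3 l hl]
      · simp [Ex.eval]

open Finset in
theorem countElements_spec (hP : P.Valid) (hf : Fits P S V D w' E) (hc : Ctx P V w' H)
    (ha : H.v 10 = a) (h0 : ∀ l < P.n, H.a 1 (P.hash a l) = 0) : HSpec P.W S countElements H
      (fun H' => Fr [14] [1] H H' ∧ ∀ l < P.n, H'.a 1 (P.hash a l) = P.count a l)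
      (100 * (P.n + 1)) := by
  have hn : P.n < 2 ^ P.W := by
    have := hf.n_le
    have := hf.le
    have := hf.one_lt
    omega
  refine (HSpec.forDo (x := 14) P.n (τ := 60) (fun i H' => H'.v 14 = i ∧ Fr [14] [1] H H' ∧
    ∀ l < P.n, H'.a 1 (P.hash a l) = #{j ∈ range i | P.hash a j = P.hash a l})
    (by omega) (by omega) hn ?_ ?_ ?_).mono
    (fun H' h => h.2) (by simp [Ex.time]; omega)
  · exact ⟨by simp, (Fr.refl _ _ _).setV _ (by simp), by simpa using h0⟩
  · rintro i H' ⟨h1, h2, -⟩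
    have h0 := hc.fr h2 (by decide) (by decide)
    exact ⟨h1, by simp [Ok], h0.n⟩
  · rintro i hi H' ⟨h1, h2, h3⟩
    have h0 := hc.fr h2 (by decide) (by decide)
    have ha' : H'.v 10 = a := by rw [h2.v 10 (by decide), ha]
    have he := eval_hashEx h0 ha' h1 hi
    have hS := (hP.hash_lt a i).trans_le hf.R_le
    refine (HSpec.put (e := hashEx) (e' := .bin .add (.arr 1 hashEx) (.lit 1)) (ok_hashEx hf h1 hi)
      ⟨⟨by omega, ok_hashEx hf h1 hi, he ▸ hS⟩, trivial⟩ (by omega) (he ▸ hS)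
      ?_).mono (fun H' h => h) (by simp [Ex.time, hashEx])
    have hcard : #{j ∈ range i | P.hash a j = P.hash a i} ≤ i :=
      (card_filter_le _ _).trans (by simp)
    have hval : (Ex.bin .add (.arr 1 hashEx) (.lit 1)).eval P.W H' =
        #{j ∈ range i | P.hash a j = P.hash a i} + 1 := by
      simp only [Ex.eval, he, h3 i hi, hf.lit (show 1 < 2 ^ 100 by norm_num)]
      exact BinOp.eval_add (by omega)
    rw [he, hval]
    refine ⟨by simp [h1], by simp, (h2.setA _ _ (by simp)).setV _ (by simp), fun l hl => ?_⟩
    rw [range_add_one, filter_insert]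
    by_cases hli : P.hash a l = P.hash a i
    · simp [hli]
    · simp [hli, h3 l hl, Ne.symm hli]

/-- Update the weights of `n` items, where `e` is the position of the weight and `b` tells whether
the item is bad. -/
def weigh (e b : Ex) : Prog :=
  forDo 14 (.var 0) (.seq
    (asg 24 (.bin .mul (.arr 2 e) (.bin .add (.bin .mul b (.lit 65535)) (.lit 1))))
    (.seq (put 3 e (.var 24)) (asg 12 (.bin .add (.var 12) (.var 24)))))

/-- The new weight of an item. -/
def newWeight (P : Inst) (as : List ℕ) (a i : ℕ) : ℕ :=
  weight P.Bad as i * if P.Bad a i then 2 ^ 16 else 1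

theorem newWeight_eq (as : List ℕ) : newWeight P as a = weight P.Bad (a :: as) :=
  funext fun i => (weight_cons P.Bad as a i).symm

open Finset in
/-- The total weight. -/
def total (P : Inst) (as : List ℕ) : ℕ := ∑ i ∈ range (2 * P.n), weight P.Bad as i

-- Used with `o = 0` for the elements and `o = n` for the differences. The new weights go to array
-- 3, so the old ones in array 2 survive if the word is rejected. The bound on the new total
-- excludes overflow.
open Finset in
theorem weigh_spec (hf : Fits P S V D w' E) (hc : Ctx P V w' H) {as : List ℕ} {e b : Ex} {o : ℕ}
    (ho : o + P.n ≤ 2 * P.n) (h2 : ∀ i < 2 * P.n, H.a 2 i = weight P.Bad as i)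
    (h3 : ∀ i < o, H.a 3 i = newWeight P as a i) (h12 : H.v 12 = ∑ i ∈ range o, newWeight P as a i)
    (hw : ∑ i ∈ range (2 * P.n), newWeight P as a i < 2 ^ P.W) (het : e.time ≤ 10)
    (hbt : b.time ≤ 100)
    (he : ∀ i < P.n, ∀ H', Fr [12, 14, 24] [3] H H' → H'.v 14 = i →
      e.Ok P.W S H' ∧ e.eval P.W H' = o + i)
    (hb : ∀ i < P.n, ∀ H', Fr [12, 14, 24] [3] H H' → H'.v 14 = i →
      b.Ok P.W S H' ∧ b.eval P.W H' = if P.Bad a (o + i) then 1 else 0) :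
    HSpec P.W S (weigh e b) H (fun H' => Fr [12, 14, 24] [3] H H' ∧
      (∀ i < o + P.n, H'.a 3 i = newWeight P as a i) ∧
      H'.v 12 = ∑ i ∈ range (o + P.n), newWeight P as a i) (300 * (P.n + 1)) := by
  have hn : P.n < 2 ^ P.W := by
    have := hf.n_le
    have := hf.le
    have := hf.one_lt
    omega
  refine (HSpec.forDo (x := 14) P.n (τ := 250) (fun i H' => H'.v 14 = i ∧ Fr [12, 14, 24] [3] H H' ∧
    (∀ l < o + i, H'.a 3 l = newWeight P as a l) ∧
      H'.v 12 = ∑ l ∈ range (o + i), newWeight P as a l) (by omega) (by omega) hn ?_ ?_ ?_).mono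
    (fun H' h => h.2) (by simp [Ex.time]; omega)
  · exact ⟨by simp, (Fr.refl _ _ _).setV _ (by simp), by simpa using h3, by simpa using h12⟩
  · rintro i H' ⟨h1, h2, -⟩
    have h0 := hc.fr h2 (by decide) (by decide)
    exact ⟨h1, by simp [Ok], h0.n⟩
  · rintro i hi H' ⟨h1, hF, h3', h12'⟩
    have hle : o + i < 2 * P.n := by omega
    have hnS := hf.n_le
    have hsum : ∑ l ∈ range (o + i), newWeight P as a l + newWeight P as a (o + i) < 2 ^ P.W := by
      rw [← sum_range_succ]
      exact (sum_le_sum_of_subset (range_subset_range.2 (by omega))).trans_lt hw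
    obtain ⟨e1, e2⟩ := he i hi H' hF h1
    obtain ⟨b1, b2⟩ := hb i hi H' hF h1
    have hwt : H'.a 2 (o + i) = weight P.Bad as (o + i) := by
      rw [hF.a 2 (by decide), h2 _ hle]
    have hval : (Ex.bin .mul (.arr 2 e) (.bin .add (.bin .mul b (.lit 65535))
        (.lit 1))).eval P.W H' = newWeight P as a (o + i) := by
      have hfac : (Ex.bin .add (.bin .mul b (.lit 65535)) (.lit 1)).eval P.W H' =
          if P.Bad a (o + i) then 2 ^ 16 else 1 := by
        simp only [Ex.eval, b2, hf.lit (show 1 < 2 ^ 100 by norm_num),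
          hf.lit (show 65535 < 2 ^ 100 by norm_num)]
        have h16 : 2 ^ 16 < 2 ^ P.W := hf.lit_lt (by norm_num)
        split_ifs
        · rw [BinOp.eval_mul (by omega), BinOp.eval_add (by omega)]
          norm_num
        · rw [BinOp.eval_mul (by rw [zero_mul]; omega), zero_mul, BinOp.eval_add (by omega)]
      rw [Ex.eval, hfac, Ex.eval, e2, hwt]
      refine BinOp.eval_mul ?_
      change newWeight P as a (o + i) < _
      omega
    refine (HSpec.seq (M := fun H'' => H'' = H'.setV 24 (newWeight P as a (o + i)))
      (HSpec.asg (e := .bin .mul (.arr 2 e) (.bin .add (.bin .mul b (.lit 65535)) (.lit 1)))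
        ⟨⟨by omega, e1, by omega⟩, ⟨b1, trivial⟩, trivial⟩ (by omega)
        (by rw [hval])) (τ' := 70) ?_).mono (fun _ h => h) (by simp [Ex.time]; omega)
    rintro _ rfl
    have hF1 : Fr [12, 14, 24] [3] H (H'.setV 24 (newWeight P as a (o + i))) :=
      hF.setV _ (by simp)
    obtain ⟨e1, e2⟩ := he i hi _ hF1 (by simpa using h1)
    refine (HSpec.seq (M := fun H'' => H'' = (H'.setV 24 (newWeight P as a (o + i))).setA 3 (o + i)
        (newWeight P as a (o + i)))
      (HSpec.put (e' := .var 24) e1 (by simp [Ok]) (by omega) (by omega)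
        (by rw [e2]; simp [Ex.eval])) (τ' := 10) ?_).mono (fun _ h => h) (by simp [Ex.time]; omega)
    rintro _ rfl
    refine (HSpec.asg (e := .bin .add (.var 12) (.var 24)) (by simp [Ok]) (by omega) ?_).mono
      (fun _ h => h) (by simp [Ex.time])
    have hv : (Ex.bin .add (.var 12) (.var 24)).eval P.W ((H'.setV 24 (newWeight P as a
        (o + i))).setA 3 (o + i) (newWeight P as a (o + i))) =
        ∑ l ∈ range (o + (i + 1)), newWeight P as a l := by
      simp only [Ex.eval, HS.setA_v, HS.setV_v, if_true, show ¬ (12 = 24) by omega, if_false, h12']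
      rw [BinOp.eval_add hsum, ← add_assoc, sum_range_succ]
    rw [hv]
    refine ⟨by simp [h1], by simp, ((hF1.setA _ _ (by simp)).setV _ (by simp)).setV _ (by simp),
      fun l hl => ?_, by simp⟩
    by_cases hl' : l = o + i
    · simp [hl']
    · simp [hl', h3' l (by omega)]

/-- Is the current element bad? -/
def badElement : Ex := .bin .eq (.bin .eq (.arr 1 hashEx) (.lit 1)) (.lit 0)

/-- The multiple of the current difference. -/
def diffEx : Ex := .bin .mul (.var 10) (.bin .add (.var 14) (.lit 1))

/-- Is the current difference bad? -/
def badDifference : Ex := .bin .or (.bin .lt diffEx (.var 9))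
  (.bin .eq (.bin .lt diffEx (.bin .sub (.lit 0) (.var 9))) (.lit 0))

/-- Update the counters and compute the new weights and the flag for the word that was drawn. -/
def trial : Prog := .seq clearCounts (.seq countElements (.seq (asg 12 (.lit 0))
  (.seq (weigh (.var 14) badElement) (.seq (weigh (.bin .add (.var 0) (.var 14)) badDifference)
    (asg 22 (.bin .lt (.bin .mul (.lit 4) (.var 11)) (.var 12)))))))

/-- The wrapped subtraction `0 - Mc` gives `N - Mc`, so both sides of the nearness condition are
comparisons of words. -/
theorem eval_badDifference (hP : P.Valid) (hf : Fits P S V D w' E) (hc : Ctx P V w' H)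
    (ha : H.v 10 = a) (hi : H.v 14 = i) (hin : i < P.n) :
    badDifference.eval P.W H = if P.Bad a (P.n + i) then 1 else 0 := by
  have h1 := hf.one_lt
  have hn := hf.n_le
  have hle := hf.le
  have hM := hP.Mc_pos
  have hMN : P.Mc ≤ 2 ^ P.W := Inst.Mc_le
  have hz : diffEx.eval P.W H = a * (i + 1) % 2 ^ P.W := by
    simp only [diffEx, Ex.eval, ha, hi, hf.lit (show 1 < 2 ^ 100 by norm_num)]
    rw [BinOp.eval_add (by omega)]
    rfl
  have hN : (Ex.bin .sub (.lit 0) (.var 9)).eval P.W H = 2 ^ P.W - P.Mc := by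
    simp only [Ex.eval, hc.Mc, hf.lit (show 0 < 2 ^ 100 by norm_num), BinOp.eval]
    rw [zero_add, Nat.mod_eq_of_lt (by omega)]
  have hlt := Nat.mod_lt (a * (i + 1)) (Nat.two_pow_pos P.W)
  have hbad : P.Bad a (P.n + i) ↔
      a * (i + 1) % 2 ^ P.W < P.Mc ∨ 2 ^ P.W ≤ a * (i + 1) % 2 ^ P.W + P.Mc := by
    rw [Inst.Bad, if_neg (by omega), show P.n + i - P.n + 1 = i + 1 by omega]
    rfl
  have hval : badDifference.eval P.W H = BinOp.or.eval P.W
      (BinOp.lt.eval P.W (diffEx.eval P.W H) (H.v 9)) (BinOp.eq.eval P.W (BinOp.lt.eval P.W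
        (diffEx.eval P.W H) ((Ex.bin .sub (.lit 0) (.var 9)).eval P.W H)) (0 % 2 ^ P.W)) := rfl
  rw [hval, hN, hz, BinOp.eval_ltOp _ _ h1, BinOp.eval_ltOp _ _ h1, BinOp.eval_eqOp _ _ h1, hc.Mc,
    hf.lit (show 0 < 2 ^ 100 by norm_num)]
  simp only [hbad]
  set z := a * (i + 1) % 2 ^ P.W
  by_cases h2 : z < P.Mc <;> by_cases h3 : z < 2 ^ P.W - P.Mc
  · rw [if_pos h2, if_pos h3, if_pos (Or.inl h2)]
    simp [BinOp.eval, Nat.mod_eq_of_lt h1]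
  · rw [if_pos h2, if_neg h3, if_pos (Or.inl h2)]
    simp [BinOp.eval, Nat.mod_eq_of_lt h1]
  · rw [if_neg h2, if_pos h3, if_neg (by omega : ¬ (z < P.Mc ∨ 2 ^ P.W ≤ z + P.Mc))]
    simp [BinOp.eval]
  · rw [if_neg h2, if_neg h3, if_pos (Or.inr (by omega))]
    simp [BinOp.eval, Nat.mod_eq_of_lt h1]

-- The flag in variable 22 is 0 exactly when the word is accepted, as the condition of the retry
-- loop requires. The new total is at most `2 ^ 16` times the old one, hence `hw`.
open Finset in
theorem trial_spec (hP : P.Valid) (hf : Fits P S V D w' E) (hc : Ctx P V w' H) (ha : H.v 10 = a)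
    {as : List ℕ} (h2 : ∀ i < 2 * P.n, H.a 2 i = weight P.Bad as i) (h11 : H.v 11 = total P as)
    (hw : 2 ^ 16 * total P as < 2 ^ P.W) :
    HSpec P.W S trial H (fun H' => Fr [12, 14, 22, 24] [1, 3] H H' ∧
      (∀ i < 2 * P.n, H'.a 3 i = weight P.Bad (a :: as) i) ∧ H'.v 12 = total P (a :: as) ∧
      H'.v 22 = if total P (a :: as) ≤ 4 * total P as then 0 else 1) (1000 * (P.n + 1)) := by
  have h1lt := hf.one_lt
  have hnew : ∑ i ∈ range (2 * P.n), newWeight P as a i ≤ 2 ^ 16 * total P as := by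
    rw [total, mul_sum]
    refine sum_le_sum fun i _ => ?_
    rw [newWeight, mul_comm]
    gcongr
    split_ifs <;> norm_num
  refine (HSpec.seq (clearCounts_spec hP hf hc ha) (τ' := 900 * (P.n + 1) - 1) ?_).mono
    (fun _ h => h) (by omega)
  rintro H1 ⟨hF1, hz⟩
  have hF1' : Fr [12, 14, 22, 24] [1, 3] H H1 := hF1.mono (by decide) (by decide)
  have hc1 := hc.fr hF1 (by decide) (by decide)
  refine (HSpec.seq (countElements_spec hP hf hc1 (a := a) (by rw [hF1.v 10 (by decide), ha]) hz)
    (τ' := 800 * (P.n + 1) - 2) ?_).mono (fun _ h => h) (by omega)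
  rintro H2 ⟨hF2, hcnt⟩
  have hF2' : Fr [12, 14, 22, 24] [1, 3] H H2 := hF1'.trans (hF2.mono (by decide) (by decide))
  refine (HSpec.seq (M := fun H' => H' = H2.setV 12 0) (HSpec.asg (e := .lit 0) trivial
    (by omega) (by simp [Ex.eval])) (τ' := 799 * (P.n + 1) - 6) ?_).mono (fun _ h => h)
    (by simp [Ex.time]; omega)
  rintro _ rfl
  have hF3' : Fr [12, 14, 22, 24] [1, 3] H (H2.setV 12 0) := hF2'.setV _ (by simp)
  have hc3 := hc.fr hF3' (by decide) (by decide)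
  refine (HSpec.seq (weigh_spec hf hc3 (a := a) (as := as) (o := 0) (e := .var 14) (b := badElement)
    (by omega) (fun i hi => by rw [hF3'.a 2 (by decide), h2 i hi]) (by simp) (by simp)
    (hnew.trans_lt hw) (by simp [Ex.time]) (by simp [badElement, Ex.time, hashEx]) ?_ ?_)
    (τ' := 400 * (P.n + 1)) ?_).mono (fun _ h => h) (by omega)
  · intro i hi H' hF h14
    exact ⟨by simp [Ok], by simp [Ex.eval, h14]⟩
  · intro i hi H' hF h14
    have hc' := hc3.fr hF (by decide) (by decide)
    have ha' : H'.v 10 = a := by rw [hF.v 10 (by decide), hF3'.v 10 (by decide), ha]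
    have he := eval_hashEx hc' ha' h14 hi
    have hS := (hP.hash_lt a i).trans_le hf.R_le
    refine ⟨⟨⟨⟨by omega, ok_hashEx hf h14 hi, he ▸ hS⟩, trivial⟩, trivial⟩, ?_⟩
    have hcnt' : H'.a 1 (P.hash a i) = P.count a i := by
      rw [hF.a 1 (by decide), HS.setV_a, hcnt i hi]
    simp only [badElement, Ex.eval, he, hcnt', hf.lit (show 1 < 2 ^ 100 by norm_num),
      hf.lit (show 0 < 2 ^ 100 by norm_num), BinOp.eval_eqOp _ _ h1lt, zero_add]
    have hbad : P.Bad a i ↔ P.count a i ≠ 1 := by rw [Inst.Bad, if_pos hi]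
    simp only [hbad]
    by_cases h : P.count a i = 1 <;> simp [h]
  rintro H4 ⟨hF4, h43, h412⟩
  have hF4' : Fr [12, 14, 22, 24] [1, 3] H H4 := hF3'.trans (hF4.mono (by decide) (by decide))
  have hc4 := hc.fr hF4' (by decide) (by decide)
  refine (HSpec.seq (weigh_spec hf hc4 (a := a) (as := as) (o := P.n)
    (e := .bin .add (.var 0) (.var 14)) (b := badDifference)
    (by omega) (fun i hi => by rw [hF4'.a 2 (by decide), h2 i hi]) (by simpa using h43)
    (by simpa using h412) (hnew.trans_lt hw) (by simp [Ex.time])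
    (by simp [badDifference, Ex.time, diffEx]) ?_ ?_)
    (τ' := 20) ?_).mono (fun _ h => h) (by omega)
  · intro i hi H' hF h14
    have hc' := hc4.fr hF (by decide) (by decide)
    refine ⟨by simp [Ok], ?_⟩
    have := hf.n_le
    have := hf.le
    simp only [Ex.eval, hc'.n, h14]
    exact BinOp.eval_add (by omega)
  · intro i hi H' hF h14
    have hc' := hc4.fr hF (by decide) (by decide)
    have ha' : H'.v 10 = a := by rw [hF.v 10 (by decide), hF4'.v 10 (by decide), ha]
    exact ⟨by simp [badDifference, diffEx, Ok], eval_badDifference hP hf hc' ha' h14 hi⟩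
  rintro H5 ⟨hF5, h53, h512⟩
  have hF5' : Fr [12, 14, 22, 24] [1, 3] H H5 := hF4'.trans (hF5.mono (by decide) (by decide))
  refine (HSpec.asg (e := .bin .lt (.bin .mul (.lit 4) (.var 11)) (.var 12)) (by simp [Ok])
    (by omega) ?_).mono (fun _ h => h) (by simp [Ex.time])
  rw [← two_mul, newWeight_eq] at h53 h512
  refine ⟨hF5'.setV _ (by simp), by simpa using h53, ?_, ?_⟩
  · simpa [total] using h512
  · have h512' : H5.v 12 = total P (a :: as) := h512
    simp only [HS.setV_v, if_true, Ex.eval, h512', hF5'.v 11 (by decide), h11,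
      hf.lit (show 4 < 2 ^ 100 by norm_num)]
    rw [BinOp.eval_ltOp _ _ h1lt, BinOp.eval_mul (by omega)]
    split_ifs <;> first | rfl | omega

end WordRAM

/-- The simulated machine expects zeros behind its input, and all assignments stay below `5 * L ≤
m`. -/
theorem Inst.Valid.vec_eq_zero {P : Inst} (hP : P.Valid) {a c k : ℕ} (hk : P.m ≤ k) :
    P.vec a c k = 0 := by
  have hL := hP.L_pos
  have hm := hP.le_m
  have l : ∀ i, P.hash a i % P.L < P.L := fun i => Nat.mod_lt _ hL
  rw [Inst.vec, Inst.vec₃, writes_eq_of_forall_ne fun t _ h h' => by omega, Inst.vec₂,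
    writes_eq_of_forall_ne fun t _ h h' => by have := l t; omega, Inst.vec₁,
    writes_eq_of_forall_ne fun t _ h h' => by have := l t; omega]
  exact if_neg (by omega)

theorem Inst.Valid.vec_bounds {P : Inst} (hP : P.Valid) {a c k : ℕ} (hk : k < P.m) :
    -(16 * P.D : ℤ) ≤ P.vec a c k ∧ P.vec a c k < 16 * P.D + 13 := by
  rcases hP.vec_cases a c k hk with h | ⟨i, hi, -, -, h⟩ | ⟨i, hi, -, -, h⟩ | ⟨i, hi, h⟩
  · omega
  all_goals
    have := hP.lo i hi
    have := hP.hi i hi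
    omega

/-- Lets the sentinels be entered by the same kind of loop as the elements. -/
theorem Inst.sentinels_eq (P : Inst) :
    P.sentinels = writes (fun _ => True) (fun i => i) (fun _ => 12) (fun _ => 0) P.m := by
  ext k
  by_cases hk : k < P.m
  · rw [sentinels, if_pos hk]
    exact (writes_eq_val (cond := fun _ => True) (pos := fun i => i) (val := fun _ => 12)
      (f := fun _ => 0) hk trivial fun j _ _ h => h).symm
  · rw [sentinels, if_neg hk, writes_eq_of_forall_ne fun i hi _ h => by omega]

/-! ### Building the vectors in the simulated memory -/

namespace WordRAM

open Ex

/-- The epochs of all cells are at most `e`. -/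
def Epochs (S V e : ℕ) (H : HS) : Prop :=
  ∀ x < S, H.a 6 x / 2 ^ V ≤ e ∧ H.a 7 x / 2 ^ V ≤ e

/-- The simulated memory holds the vector `f`. -/
def Holds (V e : ℕ) (f : ℕ → ℤ) (H : HS) : Prop :=
  ∀ x < 2 ^ V, unpackNat (2 ^ V) e (H.a 6 x) = (f x % 2 ^ V).toNat

/-- For `i < cnt`, if `ce` then store `ve` into the cell `pe` of the simulated memory. -/
def writeCells (cnt ce pe ve : Ex) : Prog :=
  forDo 14 cnt (cond ce (put 6 pe (pack ve)) (asg 24 (.lit 0)))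

variable {P : Inst} {S V D w' E : ℕ} {H : HS} {a c i e : ℕ}

theorem Epochs.setA {j x u : ℕ} (h : Epochs S V e H) (hu : u / 2 ^ V ≤ e) :
    Epochs S V e (H.setA j x u) := by
  intro y hy
  have := h y hy
  rw [HS.setA_a, HS.setA_a]
  constructor <;> split_ifs <;> omega

/-- Each iteration mirrors one step of `writes`. Values matter only modulo `2 ^ V`, which is what
packing retains. -/
theorem writeCells_spec (hf : Fits P S V D w' E) (he : e ≤ E) (hc : Ctx P V w' H) (h4 : H.v 4 = e)
    (hE : Epochs S V e H) {f : ℕ → ℤ} (hH : Holds V e f H) {cnt ce pe ve : Ex} {T : ℕ}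
    (hT : T < 2 ^ P.W) {C : ℕ → Prop} [DecidablePred C] {pos : ℕ → ℕ} {val : ℕ → ℤ}
    (hcnt : ∀ H', Fr [14, 24] [6] H H' → cnt.Ok P.W S H' ∧ cnt.eval P.W H' = T)
    (hce : ∀ i < T, ∀ H', Fr [14, 24] [6] H H' → H'.v 14 = i →
      ce.Ok P.W S H' ∧ (ce.eval P.W H' ≠ 0 ↔ C i))
    (hpe : ∀ i < T, C i → ∀ H', Fr [14, 24] [6] H H' → H'.v 14 = i →
      pe.Ok P.W S H' ∧ pe.eval P.W H' = pos i ∧ pos i < 2 ^ V ∧ ve.Ok P.W S H' ∧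
        ((ve.eval P.W H' % 2 ^ V : ℕ) : ℤ) = val i % 2 ^ V)
    (tcnt : cnt.time ≤ 10) (tce : ce.time ≤ 100) (tpe : pe.time ≤ 100) (tve : ve.time ≤ 100) :
    HSpec P.W S (writeCells cnt ce pe ve) H (fun H' => Fr [14, 24] [6] H H' ∧ Epochs S V e H' ∧
      Holds V e (writes C pos val f T) H') (400 * (T + 1)) := by
  have hq := Nat.two_pow_pos V
  have hpk : (e + 1) * 2 ^ V ≤ 2 ^ P.W := le_trans (by gcongr) hf.epoch
  refine (HSpec.forDo (x := 14) T (τ := 350) (fun i H' => H'.v 14 = i ∧ Fr [14, 24] [6] H H' ∧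
    Epochs S V e H' ∧ Holds V e (writes C pos val f i) H') (by omega) (by omega) hT ?_ ?_ ?_).mono
    (fun H' h => h.2) (by
      have := Nat.mul_le_mul_left T (by omega : 350 + cnt.time + 14 ≤ 374)
      omega)
  · exact ⟨by simp, (Fr.refl _ _ _).setV _ (by simp), hE, hH⟩
  · rintro i H' ⟨h1, h2, -⟩
    exact ⟨h1, hcnt H' h2⟩
  · rintro i hi H' ⟨h1, hF, hE', hH'⟩
    obtain ⟨c1, c2⟩ := hce i hi H' hF h1
    refine (HSpec.cond c1 (τ := 240) ?_ ?_).mono (fun _ h => h) (by omega)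
    · intro h0
      have hCi := c2.1 h0
      obtain ⟨p1, p2, p3, v1, v2⟩ := hpe i hi hCi H' hF h1
      refine (HSpec.put p1 (ok_pack v1) (by omega) (p2 ▸ p3.trans_le hf.mem) ?_).mono
        (fun _ h => h) (by simp [Ex.time, pack]; omega)
      have hv4 : H'.v 4 = e := by rw [hF.v 4 (by decide), h4]
      have hv3 : H'.v 3 = 2 ^ V := (hc.fr hF (by decide) (by decide)).q
      rw [eval_pack hv3 hv4 hpk hq, p2]
      have hu : ve.eval P.W H' % 2 ^ V < 2 ^ V := Nat.mod_lt _ hq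
      refine ⟨by simp [h1], by simp, (hF.setA _ _ (by simp)).setV _ (by simp), ?_, ?_⟩
      · exact hE'.setA (j := 6) (x := pos i) (pack_div hu).le
      · intro x hx
        rw [writes, if_pos hCi, HS.setV_a, HS.setA_a, Function.update_apply]
        by_cases hxp : x = pos i
        · rw [if_pos ⟨rfl, hxp⟩, if_pos hxp, unpackNat_pack hu, ← v2, Int.toNat_natCast]
        · rw [if_neg fun h => hxp h.2, if_neg hxp, hH' x hx]
    · intro h0
      have hCi : ¬ C i := fun h => c2.2 h h0
      refine (HSpec.asg (e := .lit 0) trivial (by omega) ?_).mono (fun _ h => h) (by simp [Ex.time])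
      refine ⟨by simp [h1], by simp, (hF.setV _ (by simp)).setV _ (by simp), hE', ?_⟩
      intro x hx
      rw [writes, if_neg hCi]
      exact hH' x hx

/-- The state during the construction of the vector for the word `a` and the choice `c`. -/
structure Choice (P : Inst) (V w' a c : ℕ) (H : HS) : Prop extends Ctx P V w' H where
  a : H.v 10 = a
  I : H.v 16 = Inst.blockI c
  J : H.v 17 = Inst.blockJ c
  d : H.v 18 = Inst.carry c
  p : H.v 19 = Inst.colorI c

theorem Choice.fr (h : Choice P V w' a c H) {H' : HS} (hF : Fr [14, 24] [6] H H') :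
    Choice P V w' a c H' where
  toCtx := h.toCtx.fr hF (by decide) (by decide)
  a := by rw [hF.v 10 (by decide), h.a]
  I := by rw [hF.v 16 (by decide), h.I]
  J := by rw [hF.v 17 (by decide), h.J]
  d := by rw [hF.v 18 (by decide), h.d]
  p := by rw [hF.v 19 (by decide), h.p]

/-- The color of the current position. -/
def colorEx : Ex := .bin .div (.bin .mul (.var 10) (.var 14)) (.var 9)

/-- The distance of the current element from the beginning of the block of the sums. -/
def offsetEx : Ex := .bin .mod (.bin .add hashEx (.bin .sub (.bin .mul (.lit 2) (.var 7))
  (.bin .add (.bin .mul (.bin .add (.var 16) (.var 17)) (.var 6)) (.var 18)))) (.var 7)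

/-- The current element with the tag `t`. -/
def tagEx (t : ℕ) : Ex := .bin .add (.bin .mul (.lit 16) (.arr 0 (.var 14))) (.lit t)

/-- Is the current element in the block `y`, does it satisfy `b`, and is it nonzero? -/
def selectEx (y : ℕ) (b : Ex) : Ex := .bin .mul (.bin .eq (.bin .div hashEx (.var 6)) (.var y))
  (.bin .mul b (.bin .lt (.lit 0) (.arr 0 (.var 14))))

/-- Build the vector for the current word and choice. -/
def buildVector : Prog :=
  .seq (writeCells (.var 5) (.lit 1) (.var 14) (.lit 12)) (.seq
    (writeCells (.var 0) (selectEx 16 (.bin .eq colorEx (.var 19)))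
      (.bin .add (.var 6) (.bin .mod hashEx (.var 6))) (tagEx 1)) (.seq
    (writeCells (.var 0) (selectEx 17 (.bin .eq (.bin .eq colorEx (.var 19)) (.lit 0)))
      (.bin .add (.bin .mul (.lit 2) (.var 6)) (.bin .mod hashEx (.var 6))) (tagEx 3))
    (writeCells (.var 0) (.bin .lt offsetEx (.bin .mul (.lit 2) (.var 6)))
      (.bin .add (.bin .mul (.lit 3) (.var 6)) offsetEx) (tagEx 4))))

section evals

variable (hP : P.Valid) (hf : Fits P S V D w' E) (h : Choice P V w' a c H) (h14 : H.v 14 = i)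
  (hi : i < P.n)

include h h14 in
theorem eval_colorEx : colorEx.eval P.W H = P.color a i := by
  simp only [colorEx, eval, h.a, h14, h.Mc]
  rw [BinOp.eval_div _ (BinOp.eval_lt ..)]
  rfl

include hP hf h h14 hi in
theorem eval_offsetEx (hc : c < 2 ^ 67) : offsetEx.eval P.W H = P.offset a c i := by
  have h1 := hf.R_le
  have h2 := hf.le
  have h3 := hP.hash_lt a i
  have hR : P.R = 2 ^ 22 * P.L := rfl
  have hL := hP.L_pos
  have hI : Inst.blockI c < 2 ^ 22 := by rw [Inst.blockI]; omega
  have hJ : Inst.blockJ c < 2 ^ 22 := by rw [Inst.blockJ]; omega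
  have hd : Inst.carry c < 2 := by rw [Inst.carry]; omega
  have hW := hf.lit_lt (show 2 ^ 23 < 2 ^ 100 by norm_num)
  -- Two block numbers below `2 ^ 22` add up to at most `2 ^ 23 - 2`, so the subtraction from `2 *
  -- R` does not wrap around.
  have hIJ : (Inst.blockI c + Inst.blockJ c) * P.L + Inst.carry c ≤ 2 * P.R := by
    calc _ ≤ (2 ^ 23 - 2) * P.L + 1 := by gcongr <;> omega
      _ ≤ 2 * P.R := by rw [hR, Nat.sub_mul]; omega
  have hhash := eval_hashEx h.toCtx h.a h14 hi
  simp only [offsetEx, eval, hhash, h.R, h.I, h.J, h.L, h.d, hf.lit (show 2 < 2 ^ 100 by norm_num)]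
  rw [BinOp.eval_add (by omega : Inst.blockI c + Inst.blockJ c < 2 ^ P.W),
    BinOp.eval_mul (a := Inst.blockI c + Inst.blockJ c) (by omega),
    BinOp.eval_add (a := (Inst.blockI c + Inst.blockJ c) * P.L) (by omega),
    BinOp.eval_mul (a := 2) (by omega), BinOp.eval_sub hIJ (by omega), BinOp.eval_add (by omega),
    BinOp.eval_rem _ (by omega)]
  rfl

-- Two's complement for `W` bits reduces to two's complement for `V` bits because `2 ^ V` divides `2
-- ^ W`.
include hf h h14 hi in
theorem eval_tagEx {t : ℕ} (ht : t < 2 ^ 100) : (tagEx t).Ok P.W S H ∧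
    (((tagEx t).eval P.W H % 2 ^ V : ℕ) : ℤ) = (16 * P.x i + t) % 2 ^ V := by
  have hn := hf.n_le
  refine ⟨⟨⟨trivial, by omega, by simp [Ok], by simp only [eval, h14]; omega⟩, trivial⟩, ?_⟩
  have hX : (P.X i : ℤ) ≡ P.x i [ZMOD 2 ^ P.W] := by
    have := Inst.X_cast (P := P) i
    rw [show (P.N : ℤ) = 2 ^ P.W by simp [Inst.N]] at this
    rw [this]
    exact Int.mod_modEq _ _
  simp only [tagEx, eval, h14, h.x i hi, hf.lit (show 16 < 2 ^ 100 by norm_num), hf.lit ht,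
    BinOp.eval]
  have hdvd : (2 : ℤ) ^ V ∣ 2 ^ P.W := pow_dvd_pow 2 hf.word
  have : ((16 * P.X i % 2 ^ P.W + t : ℕ) : ℤ) ≡ 16 * P.x i + t [ZMOD 2 ^ P.W] := by
    push_cast
    exact ((Int.mod_modEq _ _).trans (hX.mul_left 16)).add_right _
  have h2 : (((16 * P.X i % 2 ^ P.W + t) % 2 ^ P.W : ℕ) : ℤ) ≡ 16 * P.x i + t [ZMOD 2 ^ P.W] := by
    refine Int.ModEq.trans ?_ this
    push_cast
    exact Int.mod_modEq _ _
  have h3 := h2.of_dvd hdvd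
  rw [Int.natCast_mod]
  push_cast at h3 ⊢
  exact h3

include hP hf h h14 hi in
theorem eval_selectEx {y k : ℕ} {b : Ex} {C : Prop} [Decidable C] (hy : H.v y = k) (hy' : y < 32)
    (hb : b.Ok P.W S H) (hb' : b.eval P.W H = if C then 1 else 0) :
    (selectEx y b).Ok P.W S H ∧ ((selectEx y b).eval P.W H ≠ 0 ↔
      P.hash a i / P.L = k ∧ C ∧ P.X i ≠ 0) := by
  have hn := hf.n_le
  have h1 := hf.one_lt
  refine ⟨⟨⟨⟨ok_hashEx hf h14 hi, by simp [Ok]⟩, hy'⟩, hb, trivial, by omega, by simp [Ok],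
    by simp only [eval, h14]; omega⟩, ?_⟩
  have hS := (hP.hash_lt a i).trans_le hf.R_le
  have hW := hf.le
  simp only [selectEx, eval, h14, h.x i hi, eval_hashEx h.toCtx h.a h14 hi, h.L, hy, hb',
    hf.lit (show 0 < 2 ^ 100 by norm_num)]
  rw [BinOp.eval_div _ (by omega), BinOp.eval_eqOp _ _ h1, BinOp.eval_ltOp _ _ h1]
  by_cases q1 : P.hash a i / P.L = k <;> by_cases q2 : C <;> by_cases q3 : P.X i = 0 <;>
    simp [q1, q2, q3, BinOp.eval, Nat.mod_eq_of_lt h1, Nat.pos_iff_ne_zero]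

end evals

theorem buildVector_spec (hP : P.Valid) (hf : Fits P S V D w' E) (he : e + 1 ≤ E)
    (h : Choice P V w' a c H) (hc : c < 2 ^ 67) (h4 : H.v 4 = e + 1) (hE : Epochs S V e H) :
    HSpec P.W S buildVector H (fun H' => Fr [14, 24] [6] H H' ∧ Epochs S V (e + 1) H' ∧
      Holds V (e + 1) (P.vec a c) H') (2000 * (P.m + 1)) := by
  have hnm := hP.n_le
  have hnS := hf.n_le
  have hSW := hf.le
  have hmV := hf.m_lt
  have hVS := hf.mem
  have hL := hP.L_pos
  have hLm := hP.le_m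
  have h1 := hf.one_lt
  have hE' : Epochs S V (e + 1) H := fun x hx => by have := hE x hx; omega
  -- The epoch was just advanced to `e + 1` and all cells are older, so the memory reads as zero
  -- without being cleared.
  have hH0 : Holds V (e + 1) (fun _ => 0) H := fun x hx => by
    have := hE x (by omega)
    rw [unpackNat, if_neg (by omega)]
    simp
  have hmod : ∀ x, P.hash a x % P.L < P.L := fun x => Nat.mod_lt _ hL
  have hmodEx : ∀ {H' i}, Choice P V w' a c H' → H'.v 14 = i → i < P.n →
      (Ex.bin .mod hashEx (.var 6)).Ok P.W S H' ∧
      (Ex.bin .mod hashEx (.var 6)).eval P.W H' = P.hash a i % P.L := by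
    intro H' i h h14 hi
    have hS := (hP.hash_lt a i).trans_le hf.R_le
    refine ⟨⟨ok_hashEx hf h14 hi, by simp [Ok]⟩, ?_⟩
    simp only [eval, eval_hashEx h.toCtx h.a h14 hi, h.L]
    exact BinOp.eval_rem _ (by omega)
  refine (HSpec.seq (writeCells_spec hf he h.toCtx h4 hE' hH0 (cnt := .var 5) (ce := .lit 1)
    (pe := .var 14) (ve := .lit 12) (T := P.m) (by omega) (C := fun _ => True) (pos := fun i => i)
    (val := fun _ => 12) ?_ ?_ ?_ (by simp [Ex.time]) (by simp [Ex.time]) (by simp [Ex.time])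
    (by simp [Ex.time])) (τ' := 1400 * (P.m + 1)) ?_).mono (fun _ h => h) (by omega)
  · exact fun H' hF => ⟨by simp [Ok], (h.fr hF).m⟩
  · exact fun i _ H' hF h14 => ⟨trivial, by simp [eval, Nat.mod_eq_of_lt h1]⟩
  · intro i hi _ H' hF h14
    refine ⟨by simp [Ok], h14, by omega, trivial, ?_⟩
    simp only [eval, hf.lit (show 12 < 2 ^ 100 by norm_num)]
    push_cast
    rfl
  rintro H1 ⟨F1, E1, V1⟩
  rw [← P.sentinels_eq] at V1
  have C1 := h.fr F1
  have time1 : hashEx.time = 17 := rfl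
  have time2 : colorEx.time = 9 := rfl
  refine (HSpec.seq (writeCells_spec hf he C1.toCtx (by rw [F1.v 4 (by decide), h4]) E1 V1
    (cnt := .var 0) (T := P.n) (by omega)
    (C := fun i => P.hash a i / P.L = Inst.blockI c ∧ P.color a i = Inst.colorI c ∧ P.X i ≠ 0)
    (pos := fun i => P.L + P.hash a i % P.L) (val := fun i => 16 * P.x i + 1)
    ?_ ?_ ?_ (by simp [Ex.time]) (by simp [Ex.time, selectEx, time1, time2])
    (by simp [Ex.time, time1]) (by simp [Ex.time, tagEx]))
    (τ' := 900 * (P.m + 1)) ?_).mono (fun _ h => h) (by omega)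
  · exact fun H' hF => ⟨by simp [Ok], (C1.fr hF).n⟩
  · intro i hi H' hF h14
    have C' := C1.fr hF
    refine eval_selectEx hP hf C' h14 hi C'.I (by omega) (by simp [Ok, colorEx]) ?_
    rw [eval, eval_colorEx C' h14, BinOp.eval_eqOp _ _ h1, eval, C'.p]
  · intro i hi _ H' hF h14
    have C' := C1.fr hF
    obtain ⟨m1, m2⟩ := hmodEx C' h14 hi
    have l := hmod i
    refine ⟨⟨by simp [Ok], m1⟩, ?_, by omega, eval_tagEx hf C' h14 hi (by norm_num)⟩
    rw [eval, m2, eval, C'.L]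
    exact BinOp.eval_add (by omega)
  rintro H2 ⟨F2, E2, V2⟩
  have F2' := F1.trans F2
  have C2 := h.fr F2'
  refine (HSpec.seq (writeCells_spec hf he C2.toCtx (by rw [F2'.v 4 (by decide), h4]) E2 V2
    (cnt := .var 0) (T := P.n) (by omega)
    (C := fun i => P.hash a i / P.L = Inst.blockJ c ∧ P.color a i ≠ Inst.colorI c ∧ P.X i ≠ 0)
    (pos := fun i => 2 * P.L + P.hash a i % P.L) (val := fun i => 16 * P.x i + 3)
    ?_ ?_ ?_ (by simp [Ex.time]) (by simp [Ex.time, selectEx, time1, time2])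
    (by simp [Ex.time, time1]) (by simp [Ex.time, tagEx]))
    (τ' := 400 * (P.m + 1)) ?_).mono (fun _ h => h) (by omega)
  · exact fun H' hF => ⟨by simp [Ok], (C2.fr hF).n⟩
  · intro i hi H' hF h14
    have C' := C2.fr hF
    refine eval_selectEx hP hf C' h14 hi C'.J (by omega) (by simp [Ok, colorEx]) ?_
    rw [eval, eval, eval, eval_colorEx C' h14, BinOp.eval_eqOp _ _ h1, BinOp.eval_eqOp _ _ h1, eval,
      C'.p, hf.lit (show 0 < 2 ^ 100 by norm_num)]
    by_cases hq : P.color a i = Inst.colorI c <;> simp [hq]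
  · intro i hi _ H' hF h14
    have C' := C2.fr hF
    obtain ⟨m1, m2⟩ := hmodEx C' h14 hi
    have l := hmod i
    refine ⟨⟨by simp [Ok], m1⟩, ?_, by omega, eval_tagEx hf C' h14 hi (by norm_num)⟩
    rw [eval, m2, eval, eval, eval, C'.L, hf.lit (show 2 < 2 ^ 100 by norm_num),
      BinOp.eval_mul (by omega)]
    exact BinOp.eval_add (by omega)
  rintro H3 ⟨F3, E3, V3⟩
  have F3' := F2'.trans F3
  have C3 := h.fr F3'
  have time3 : offsetEx.time = 45 := rfl
  refine (writeCells_spec hf he C3.toCtx (by rw [F3'.v 4 (by decide), h4]) E3 V3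
    (cnt := .var 0) (T := P.n) (by omega)
    (C := fun i => P.offset a c i < 2 * P.L)
    (pos := fun i => 3 * P.L + P.offset a c i) (val := fun i => 16 * P.x i + 4)
    ?_ ?_ ?_ (by simp [Ex.time]) (by simp [Ex.time, time3])
    (by simp [Ex.time, time3]) (by simp [Ex.time, tagEx])).mono ?_ (by omega)
  · exact fun H' hF => ⟨by simp [Ok], (C3.fr hF).n⟩
  · intro i hi H' hF h14
    have C' := C3.fr hF
    have hok := ok_hashEx hf h14 hi
    refine ⟨by simp [Ok, offsetEx, hok], ?_⟩
    rw [eval, eval_offsetEx hP hf C' h14 hi hc, eval, eval, eval, C'.L, BinOp.eval_ltOp _ _ h1,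
      hf.lit (show 2 < 2 ^ 100 by norm_num), BinOp.eval_mul (by omega)]
    simp
  · intro i hi hC H' hF h14
    have C' := C3.fr hF
    have hok := ok_hashEx hf h14 hi
    refine ⟨by simp [Ok, offsetEx, hok], ?_, by omega, eval_tagEx hf C' h14 hi (by norm_num)⟩
    rw [eval, eval_offsetEx hP hf C' h14 hi hc, eval, eval, eval, C'.L,
      hf.lit (show 3 < 2 ^ 100 by norm_num), BinOp.eval_mul (by omega)]
    exact BinOp.eval_add (by omega)
  · rintro H4 ⟨F4, E4, V4⟩
    exact ⟨F3'.trans F4, E4, V4⟩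

end WordRAM

/-! ### Calls of the given algorithm and the rounds -/

namespace WordRAM

open Ex

variable {P : Inst} {S V D w' E : ℕ} {H : HS} {a c i e τ : ℕ} {p : Prog}

/-- The vector for `a` and `c` is a yes-instance. -/
def VecYes (P : Inst) (a c : ℕ) : Prop :=
  convolutionThreeSum.IsYes P.m fun k : Fin P.m => P.vec a c k

/-- On the vectors of length `m` with entries of `w'` bits, the program `p` solves `Convolution3SUM`
at an expected cost of at most `τ`. -/
def Solves (p : Prog) (V w' m τ : ℕ) : Prop :=
  ∀ f : ℕ → ℤ, (∀ k < m, -(2 ^ (w' - 1)) ≤ f k ∧ f k < 2 ^ (w' - 1)) → ∀ N,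
    cost V (penalty fun t => t.reg 0 ≠ 0 ↔ convolutionThreeSum.IsYes m fun k : Fin m => f k) N
      (start V p w' fun k : Fin m => f k) ≤ τ

/-- Build the vector for the current choice, run the simulation and record the answer. -/
def call (p : Prog) : Prog :=
  .seq (asg 4 (.bin .add (.var 4) (.lit 1))) (.seq (asg 16 (.bin .div (.var 15) (.lit (2 ^ 45))))
  (.seq (asg 17 (.bin .mod (.bin .div (.var 15) (.lit (2 ^ 23))) (.lit (2 ^ 22))))
  (.seq (asg 19 (.bin .mod (.bin .div (.var 15) (.lit 2)) (.lit (2 ^ 22))))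
  (.seq (asg 18 (.bin .mod (.var 15) (.lit 2))) (.seq buildVector
  (.seq (put 7 (.lit 0) (pack (.var 5))) (.seq (put 7 (.lit 1) (pack (.var 21)))
  (.seq (simulate p) (asg 20 (.bin .or (.var 20) (simReg 0)))))))))))

/-- Registers other than 0 and 1 are stale and read as 0; these two receive the length and the bit
size. -/
theorem sim_start (hP : P.Valid) (hf : Fits P S V D w' E) (hc : Ctx P V w' H) (h4 : H.v 4 = e + 1)
    (hE : Epochs S V (e + 1) H) (hH : Holds V (e + 1) (P.vec a c) H)
    (h7 : ∀ x < S, H.a 7 x / 2 ^ V ≤ e) :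
    Sim S V D (e + 1) (start V p w' fun k : Fin P.m => P.vec a c k).2
      ((H.setA 7 0 ((e + 1) * 2 ^ V + P.m)).setA 7 1 ((e + 1) * 2 ^ V + w')) := by
  have hm := hf.m_lt
  have hw := hf.w'_lt
  have hq := Nat.two_pow_pos V
  constructor
  · intro r hr
    have hrS : r < S := hr.trans_le hf.regs
    simp only [start, HS.setA_a, true_and]
    by_cases h1 : r = 1
    · simp [h1, unpackNat_pack hw]
    · by_cases h0 : r = 0
      · simp [h0, unpackNat_pack hm]
      · have := h7 r hrS
        simp [h0, h1]
        rw [unpackNat, if_neg (by omega)]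
  · intro x hx
    have := hH x hx
    simp only [start, HS.setA_a, show ¬ (6 = 7) by omega, false_and, if_false, this]
    split_ifs with h
    · rfl
    · rw [hP.vec_eq_zero (by omega)]
      simp
  · intro r hr
    simp only [start]
    split_ifs <;> omega
  · intro x hx
    simp only [start]
    split_ifs with h
    · have h2 : (0 : ℤ) < 2 ^ V := by positivity
      have h3 := Int.emod_nonneg (P.vec a c x) h2.ne'
      have h4 := Int.emod_lt_of_pos (P.vec a c x) h2
      zify
      rwa [Int.toNat_of_nonneg h3]
    · exact hq
  · exact hc.q
  · exact h4
  · exact (hE.setA (pack_div hm).le).setA (pack_div hw).le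

/-- Each call has an epoch of its own. The bound `hD` makes the tagged entries fit into `w'` bits,
so the promise of `Solves` applies, and the answer is joined to variable 20 by a bitwise or. -/
theorem call_spec (hP : P.Valid) (hf : Fits P S V D w' E) (hp : p.RegsBelow D)
    (hs : Solves p V w' P.m τ) (hD : 16 * P.D + 13 ≤ 2 ^ (w' - 1)) (he : e + 1 ≤ E)
    (hc : Ctx P V w' H) (ha : H.v 10 = a) (h15 : H.v 15 = c) (hc67 : c < 2 ^ 67) (h4 : H.v 4 = e)
    (hE : Epochs S V e H) :
    HSpec P.W S (call p) H (fun H' => Fr [4, 14, 16, 17, 18, 19, 20, 24, 31] [6, 7] H H' ∧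
      H'.v 4 = e + 1 ∧ Epochs S V (e + 1) H' ∧ (H'.v 20 ≠ 0 ↔ H.v 20 ≠ 0 ∨ VecYes P a c))
      (2400 * (P.m + 1) + 200 * τ) := by
  have hcW : c < 2 ^ P.W := hf.lit_lt (by omega)
  have hpk : (e + 1 + 1) * 2 ^ V ≤ 2 ^ P.W := le_trans (by gcongr) hf.epoch
  have hq := Nat.two_pow_pos V
  have hm := hf.m_lt
  have hw := hf.w'_lt
  have h2S : 2 ≤ S := hf.two_le.trans hf.regs
  have hSW := hf.le
  have heW : e + 1 < 2 ^ P.W := by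
    have : (e + 1 + 1) * 1 ≤ (e + 1 + 1) * 2 ^ V := by gcongr; omega
    omega
  have hlit1 := hf.lit (show 1 < 2 ^ 100 by norm_num)
  refine (HSpec.seq (M := fun H' => H' = H.setV 4 (e + 1)) (HSpec.asg
    (e := .bin .add (.var 4) (.lit 1)) (by simp [Ok]) (by omega) ?_)
    (τ' := 2390 * (P.m + 1) + 200 * τ) ?_).mono (fun _ h => h) (by simp [Ex.time]; omega)
  · rw [eval, eval, eval, h4, hlit1, BinOp.eval_add heW]
  rintro _ rfl
  refine (HSpec.seq (M := fun H' => H' = (H.setV 4 (e + 1)).setV 16 (Inst.blockI c)) (HSpec.asg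
    (e := .bin .div (.var 15) (.lit (2 ^ 45))) (by simp [Ok]) (by omega) ?_)
    (τ' := 2380 * (P.m + 1) + 200 * τ) ?_).mono (fun _ h => h) (by simp [Ex.time]; omega)
  · simp only [eval, HS.setV_v, show ¬ (15 = 4) by omega, if_false, h15,
      hf.lit (show 2 ^ 45 < 2 ^ 100 by norm_num)]
    rw [BinOp.eval_div _ hcW]
    rfl
  rintro _ rfl
  refine (HSpec.seq (M := fun H' => H' = ((H.setV 4 (e + 1)).setV 16 (Inst.blockI c)).setV 17
    (Inst.blockJ c)) (HSpec.asg
    (e := .bin .mod (.bin .div (.var 15) (.lit (2 ^ 23))) (.lit (2 ^ 22)))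
    (by simp [Ok]) (by omega) ?_)
    (τ' := 2360 * (P.m + 1) + 200 * τ) ?_).mono (fun _ h => h) (by simp [Ex.time]; omega)
  · simp only [eval, HS.setV_v, show ¬ (15 = 4) by omega, show ¬ (15 = 16) by omega, if_false, h15,
      hf.lit (show 2 ^ 23 < 2 ^ 100 by norm_num), hf.lit (show 2 ^ 22 < 2 ^ 100 by norm_num)]
    rw [BinOp.eval_div _ hcW, BinOp.eval_rem _ ((Nat.div_le_self _ _).trans_lt hcW)]
    rfl
  rintro _ rfl
  refine (HSpec.seq (M := fun H' => H' = (((H.setV 4 (e + 1)).setV 16 (Inst.blockI c)).setV 17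
    (Inst.blockJ c)).setV 19 (Inst.colorI c)) (HSpec.asg
    (e := .bin .mod (.bin .div (.var 15) (.lit 2)) (.lit (2 ^ 22)))
    (by simp [Ok]) (by omega) ?_)
    (τ' := 2340 * (P.m + 1) + 200 * τ) ?_).mono (fun _ h => h) (by simp [Ex.time]; omega)
  · simp only [eval, HS.setV_v, show ¬ (15 = 4) by omega, show ¬ (15 = 16) by omega,
      show ¬ (15 = 17) by omega, if_false, h15,
      hf.lit (show 2 < 2 ^ 100 by norm_num), hf.lit (show 2 ^ 22 < 2 ^ 100 by norm_num)]
    rw [BinOp.eval_div _ hcW, BinOp.eval_rem _ ((Nat.div_le_self _ _).trans_lt hcW)]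
    rfl
  rintro _ rfl
  refine (HSpec.seq (M := fun H' => H' = ((((H.setV 4 (e + 1)).setV 16 (Inst.blockI c)).setV 17
    (Inst.blockJ c)).setV 19 (Inst.colorI c)).setV 18 (Inst.carry c)) (HSpec.asg
    (e := .bin .mod (.var 15) (.lit 2)) (by simp [Ok]) (by omega) ?_)
    (τ' := 2330 * (P.m + 1) + 200 * τ) ?_).mono (fun _ h => h) (by simp [Ex.time]; omega)
  · simp only [eval, HS.setV_v, show ¬ (15 = 4) by omega, show ¬ (15 = 16) by omega,
      show ¬ (15 = 17) by omega, show ¬ (15 = 19) by omega, if_false, h15,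
      hf.lit (show 2 < 2 ^ 100 by norm_num)]
    rw [BinOp.eval_rem _ hcW]
    rfl
  rintro H1 hH1
  have F1 : Fr [4, 14, 16, 17, 18, 19, 20, 24, 31] [6, 7] H H1 := by
    rw [hH1]
    exact (((((Fr.refl _ _ _).setV _ (by simp)).setV _ (by simp)).setV _ (by simp)).setV _
      (by simp)).setV _ (by simp)
  have C1 : Choice P V w' a c H1 :=
    { toCtx := hc.fr F1 (by decide) (by decide)
      a := by rw [F1.v 10 (by decide), ha]
      I := by simp [hH1]
      J := by simp [hH1]
      d := by simp [hH1]
      p := by simp [hH1] }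
  have h41 : H1.v 4 = e + 1 := by simp [hH1]
  have h201 : H1.v 20 = H.v 20 := by simp [hH1]
  have hE1 : Epochs S V e H1 := by rw [hH1]; exact hE
  clear hH1
  refine (HSpec.seq (buildVector_spec hP hf he C1 hc67 h41 hE1)
    (τ' := 300 * (P.m + 1) + 200 * τ) ?_).mono (fun _ h => h) (by omega)
  rintro H2 ⟨F2, E2, V2⟩
  have C2 := C1.toCtx.fr F2 (by decide) (by decide)
  have F2' : Fr [4, 14, 16, 17, 18, 19, 20, 24, 31] [6, 7] H H2 :=
    F1.trans (F2.mono (by decide) (by decide))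
  have h42 : H2.v 4 = e + 1 := by rw [F2.v 4 (by decide), h41]
  have h72 : ∀ x < S, H2.a 7 x / 2 ^ V ≤ e := fun x hx => by
    rw [F2.a 7 (by decide)]
    exact (hE1 x hx).2
  refine (HSpec.seq (M := fun H' => H' = H2.setA 7 0 ((e + 1) * 2 ^ V + P.m)) (HSpec.put
    (e := .lit 0) (e' := pack (.var 5)) trivial (ok_pack (by simp [Ok])) (by omega)
    (by simp [eval]; omega) ?_)
    (τ' := 200 * (P.m + 1) + 200 * τ) ?_).mono (fun _ h => h) (by simp [Ex.time, pack]; omega)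
  · rw [eval_pack C2.q h42 hpk hq, eval, eval, C2.m, Nat.mod_eq_of_lt hm, Nat.zero_mod]
  rintro _ rfl
  refine (HSpec.seq (M := fun H' => H' = (H2.setA 7 0 ((e + 1) * 2 ^ V + P.m)).setA 7 1
    ((e + 1) * 2 ^ V + w')) (HSpec.put
    (e := .lit 1) (e' := pack (.var 21)) trivial (ok_pack (by simp [Ok])) (by omega)
    (by rw [eval, hlit1]; omega) ?_)
    (τ' := 100 * (P.m + 1) + 200 * τ) ?_).mono (fun _ h => h) (by simp [Ex.time, pack]; omega)
  · rw [eval_pack (H := H2.setA 7 0 ((e + 1) * 2 ^ V + P.m)) C2.q h42 hpk hq, eval, eval, HS.setA_v,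
      C2.w', Nat.mod_eq_of_lt hw, hlit1]
  rintro H3 hH3
  have F3 : Fr [4, 14, 16, 17, 18, 19, 20, 24, 31] [6, 7] H H3 := by
    rw [hH3]
    exact (F2'.setA _ _ (by simp)).setA _ _ (by simp)
  have S3 : Sim S V D (e + 1) (start V p w' fun k : Fin P.m => P.vec a c k).2 H3 :=
    hH3 ▸ sim_start hP hf C2 h42 E2 V2 h72
  have h203 : H3.v 20 = H.v 20 := by
    rw [hH3, HS.setA_v, HS.setA_v, F2.v 20 (by decide), h201]
  clear hH3
  have hz : SimSize P.W S V D (e + 1) := ⟨hf.word, hf.mem, hf.regs, hpk⟩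
  have hsolve := hs (P.vec a c) fun k hk => by
    have hb := hP.vec_bounds (a := a) (c := c) hk
    have hD' : 16 * (P.D : ℤ) + 13 ≤ 2 ^ (w' - 1) := by exact_mod_cast hD
    omega
  refine (HSpec.seq (Sim.hspec hz hp S3 hsolve) (τ' := 50) ?_).mono (fun _ h => h) (by omega)
  rintro H4 ⟨F4, t, ht, S4⟩
  have F4' : Fr [4, 14, 16, 17, 18, 19, 20, 24, 31] [6, 7] H H4 :=
    F3.trans (F4.mono (by decide) (by decide))
  intro s hs
  have hreg := S4.eval_simReg hz hs (a := 0) (by have := hf.two_le; omega)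
  refine HSpec.mono (HSpec.asg (e := .bin .or (.var 20) (simReg 0))
    ⟨by simp [Ok], Sim.ok_simReg hz hs (by have := hf.two_le; omega)⟩ (by omega) ?_)
    (fun _ h => h) (by simp [Ex.time, simReg_time]) s hs
  refine ⟨F4'.setV _ (by simp), by simpa using S4.epoch, S4.le_epoch, ?_⟩
  have h204 : H4.v 20 = H.v 20 := by rw [F4.v 20 (by decide), h203]
  have hlt := hs.v_lt 20 (by omega)
  have hlt' : t.reg 0 < 2 ^ P.W := (S4.reg_lt 0 (by have := hf.two_le; omega)).trans_le
    (Nat.pow_le_pow_right (by omega) hf.word)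
  have hor : (H4.v 20 ||| t.reg 0) % 2 ^ P.W = H4.v 20 ||| t.reg 0 :=
    Nat.mod_eq_of_lt (Nat.or_lt_two_pow hlt hlt')
  rw [eval, hreg, eval, HS.setV_v, if_pos rfl, BinOp.eval]
  rw [hor, ne_eq, Nat.or_eq_zero_iff, h204, not_and_or]
  exact or_congr Iff.rfl ht

/-- Run through all the choices for the current word. -/
def calls (p : Prog) : Prog := forDo 15 (.lit (2 ^ 67)) (call p)

theorem calls_spec (hP : P.Valid) (hf : Fits P S V D w' E) (hp : p.RegsBelow D)
    (hs : Solves p V w' P.m τ) (hD : 16 * P.D + 13 ≤ 2 ^ (w' - 1)) (he : e + 2 ^ 67 ≤ E)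
    (hc : Ctx P V w' H) (ha : H.v 10 = a) (h4 : H.v 4 = e) (hE : Epochs S V e H) :
    HSpec P.W S (calls p) H (fun H' => Fr [4, 14, 15, 16, 17, 18, 19, 20, 24, 31] [6, 7] H H' ∧
      H'.v 4 = e + 2 ^ 67 ∧ Epochs S V (e + 2 ^ 67) H' ∧
      (H'.v 20 ≠ 0 ↔ H.v 20 ≠ 0 ∨ ∃ c < 2 ^ 67, VecYes P a c))
      (2 ^ 67 * (2500 * (P.m + 1) + 200 * τ)) := by
  refine (HSpec.forDo (x := 15) (2 ^ 67) (τ := 2400 * (P.m + 1) + 200 * τ)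
    (fun c H' => H'.v 15 = c ∧ Fr [4, 14, 15, 16, 17, 18, 19, 20, 24, 31] [6, 7] H H' ∧
      H'.v 4 = e + c ∧ Epochs S V (e + c) H' ∧
      (H'.v 20 ≠ 0 ↔ H.v 20 ≠ 0 ∨ ∃ c' < c, VecYes P a c')) (by omega) (by omega)
    (hf.lit_lt (by norm_num)) ?_ ?_ ?_).mono
    (fun H' h => h.2) (by
      have : (Ex.lit (2 ^ 67)).time = 1 := rfl
      omega)
  · exact ⟨by simp, (Fr.refl _ _ _).setV _ (by simp), by simpa using h4, hE, by simp⟩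
  · rintro i H' ⟨h1, h2, -⟩
    exact ⟨h1, trivial, hf.lit (by norm_num)⟩
  · rintro c hc67 H' ⟨h15, hF, h4', hE', hans⟩
    have hc' := hc.fr hF (by decide) (by decide)
    refine (call_spec hP hf hp hs hD (e := e + c) (by omega) hc' (a := a)
      (by rw [hF.v 10 (by decide), ha]) h15 hc67 h4' hE').mono ?_ le_rfl
    rintro H'' ⟨hF', h4'', hE'', hans'⟩
    refine ⟨by rw [hF'.v 15 (by decide), h15], by simp,
      (hF.trans (hF'.mono (by decide) (by decide))).setV _ (by simp), by rw [← add_assoc]; exact h4'', hE'', ?_⟩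
    rw [HS.setV_v, if_neg (by omega), hans', hans, or_assoc]
    refine or_congr Iff.rfl ⟨?_, ?_⟩
    · rintro (⟨c', h1, h2⟩ | h)
      · exact ⟨c', by omega, h2⟩
      · exact ⟨c, by omega, h⟩
    · rintro ⟨c', h1, h2⟩
      rcases Nat.lt_succ_iff_lt_or_eq.1 h1 with h1 | rfl
      · exact .inl ⟨c', h1, h2⟩
      · exact .inr h2

/-- Set the entries of array `2` from `e`. -/
def fillWeights (e : Ex) : Prog := forDo 14 (.bin .add (.var 0) (.var 0)) (put 2 (.var 14) e)

theorem fillWeights_spec (hf : Fits P S V D w' E) (hc : Ctx P V w' H) {ex : Ex} {g : ℕ → ℕ}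
    (he : ∀ i < 2 * P.n, ∀ H', Fr [14] [2] H H' → H'.v 14 = i → ex.Ok P.W S H' ∧
      ex.eval P.W H' = g i) (ht : ex.time ≤ 20) :
    HSpec P.W S (fillWeights ex) H (fun H' => Fr [14] [2] H H' ∧ ∀ i < 2 * P.n, H'.a 2 i = g i)
      (200 * (P.n + 1)) := by
  have hnS := hf.n_le
  have hSW := hf.le
  have hW := hf.one_lt
  refine (HSpec.forDo (x := 14) (2 * P.n) (τ := 30) (fun i H' => H'.v 14 = i ∧ Fr [14] [2] H H' ∧
    ∀ l < i, H'.a 2 l = g l) (by omega) (by omega) (by omega) ?_ ?_ ?_).mono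
    (fun H' h => h.2) (by simp only [Ex.time]; omega)
  · exact ⟨by simp, (Fr.refl _ _ _).setV _ (by simp), by simp⟩
  · rintro i H' ⟨h1, h2, -⟩
    have h0 := hc.fr h2 (by decide) (by decide)
    refine ⟨h1, by simp [Ok], ?_⟩
    rw [eval, eval, h0.n, BinOp.eval_add (by omega)]
    omega
  · rintro i hi H' ⟨h1, h2, h3⟩
    obtain ⟨e1, e2⟩ := he i hi H' h2 h1
    refine (HSpec.put (e := .var 14) (e' := ex) (by simp [Ok]) e1 (by omega)
      (by rw [eval, h1]; omega) ?_).mono (fun H' h => h) (by simp [Ex.time]; omega)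
    rw [e2, eval, h1]
    refine ⟨by simp [h1], by simp, (h2.setA _ _ (by simp)).setV _ (by simp), fun l hl => ?_⟩
    by_cases hli : l = i
    · simp [hli]
    · simp [hli, h3 l (by omega)]

/-- The invariant of the main loop, where `as` are the words that were accepted. -/
structure MainInv (P : Inst) (S V w' : ℕ) (as : List ℕ) (H : HS) : Prop extends Ctx P V w' H where
  weight : ∀ i < 2 * P.n, H.a 2 i = weight P.Bad as i
  total : H.v 11 = total P as
  total_le : WordRAM.total P as ≤ 2 * P.n * 4 ^ as.length
  pow : H.v 13 = 4 ^ as.length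
  epoch : H.v 4 = as.length * 2 ^ 67
  epochs : Epochs S V (as.length * 2 ^ 67) H
  ans : H.v 20 ≠ 0 ↔ ∃ a ∈ as, ∃ c < 2 ^ 67, VecYes P a c

/-- Find a good word, and run through all the choices for it. -/
def round (p : Prog) : Prog :=
  .seq (asg 22 (.lit 1)) (.seq (.loop 22 (.seq (.rand 10) trial))
  (.seq (fillWeights (.arr 3 (.var 14))) (.seq (asg 11 (.var 12)) (.seq (calls p)
  (asg 13 (.bin .mul (.lit 4) (.var 13)))))))

/-- The loop condition `hlen` bounds the weights, and with them all sums, by words; the retry loop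
is where randomness enters. -/
theorem round_spec (hP : P.Valid) (hf : Fits P S V D w' E) (hp : p.RegsBelow D)
    (hs : Solves p V w' P.m τ) (hD : 16 * P.D + 13 ≤ 2 ^ (w' - 1)) {as : List ℕ}
    (he : (as.length + 1) * 2 ^ 67 ≤ E) (hI : MainInv P S V w' as H)
    (hlen : 4 ^ as.length ≤ 2 * P.n) :
    HSpec P.W S (round p) H (fun H' => ∃ a, MainInv P S V w' (a :: as) H')
      (2 ^ 67 * (2500 * (P.m + 1) + 200 * τ) + 3000 * (P.m + 1)) := by
  have hnm := hP.n_le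
  have hnS := hf.n_le
  have hSW := hf.le
  -- The total is at most `2 * n * 4 ^ r`, hence at most `(2 * n) ^ 2` by `hlen`.
  have htot : 2 ^ 16 * total P as < 2 ^ P.W := by
    refine lt_of_lt_of_le ?_ hf.weight
    calc 2 ^ 16 * total P as ≤ 2 ^ 16 * (2 * P.n * (2 * P.n)) := by
          gcongr
          exact hI.total_le.trans (by gcongr)
      _ < 2 ^ 20 * (2 * P.n + 1) ^ 2 := by nlinarith
  set Z := 2 ^ 67 * (2500 * (P.m + 1) + 200 * τ) with hZ
  refine (HSpec.seq (M := fun H' => H' = H.setV 22 1) (HSpec.asg (e := .lit 1) trivial (by omega)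
    (by rw [eval, hf.lit (by norm_num)])) (τ' := Z + 2900 * (P.m + 1)) ?_).mono (fun _ h => h)
    (by simp only [Ex.time]; omega)
  rintro _ rfl
  refine (HSpec.seq (τ := 2 * (1000 * (P.n + 1)) + 7) (M := fun H' => ∃ a,
      Fr [10, 12, 14, 22, 24] [1, 3] H H' ∧ (∀ i < 2 * P.n, H'.a 3 i = _root_.weight P.Bad (a :: as) i) ∧
      H'.v 12 = total P (a :: as) ∧ H'.v 10 = a ∧ total P (a :: as) ≤ 4 * total P as)
    (HSpec.retry (f := 22) (d := 10) (p := trial)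
      (fun H' => Fr [10, 12, 14, 22, 24] [1, 3] H H' ∧ H'.v 22 ≠ 0)
      (fun a => total P (a :: as) ≤ 4 * total P as) (by omega) (by omega) ?_ ?_ ?_ ?_)
    (τ' := Z + 800 * (P.m + 1)) ?_).mono (fun _ h => h) (by omega)
  -- At least half of the words are accepted: Markov's inequality with factor `2 ^ 16` and failure
  -- probability `2 ^ (-16)`.
  · have h := card_sum_weights_le (Finset.range (2 * P.n)) (_root_.weight P.Bad as) (2 ^ P.W)
      (2 ^ 16) P.Bad fun i hi => hP.card_bad_le (Finset.mem_range.1 hi)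
    simpa only [total, weight_cons] using h
  · exact fun H' h => h.2
  · rintro H' ⟨hF, h22⟩ a ha
    have hF' : Fr [10, 12, 14, 22, 24] [1, 3] H (H'.setV 10 a) := hF.setV _ (by simp)
    refine (trial_spec hP hf (hI.toCtx.fr hF' (by decide) (by decide)) (a := a) (as := as) (by simp)
      (fun i hi => by rw [hF'.a 2 (by decide), hI.weight i hi])
      (by rw [hF'.v 11 (by decide), hI.total]) htot).mono ?_ le_rfl
    rintro H'' ⟨hF'', h3, h12, h22'⟩
    have hF3 : Fr [10, 12, 14, 22, 24] [1, 3] H H'' := hF'.trans (hF''.mono (by decide) (by decide))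
    split_ifs with hg
    · rw [if_pos hg] at h22'
      refine ⟨h22', a, hF3, h3, h12, ?_, hg⟩
      rw [hF''.v 10 (by decide)]
      simp
    · rw [if_neg hg] at h22'
      exact ⟨hF3, by omega⟩
  · exact ⟨(Fr.refl _ _ _).setV _ (by simp), by simp⟩
  rintro H1 ⟨a, F1, h3, h12, h10, hle⟩
  have C1 := hI.toCtx.fr F1 (by decide) (by decide)
  refine (HSpec.seq (fillWeights_spec hf C1 (ex := .arr 3 (.var 14))
    (g := _root_.weight P.Bad (a :: as)) ?_ (by simp [Ex.time])) (τ' := Z + 500 * (P.m + 1)) ?_).mono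
    (fun _ h => h) (by omega)
  · intro i hi H' hF h14
    refine ⟨⟨by omega, by simp [Ok], by rw [eval, h14]; omega⟩, ?_⟩
    rw [eval, eval, h14, hF.a 3 (by decide), h3 i hi]
  rintro H2 ⟨F2, h2⟩
  refine (HSpec.seq (M := fun H' => H' = H2.setV 11 (total P (a :: as))) (HSpec.asg (e := .var 12)
    (by simp [Ok]) (by omega) (by rw [eval, F2.v 12 (by decide), h12]))
    (τ' := Z + 400 * (P.m + 1)) ?_).mono (fun _ h => h) (by simp only [Ex.time]; omega)
  rintro _ rfl
  have F2' : Fr [10, 11, 12, 14, 22, 24] [1, 2, 3] H (H2.setV 11 (total P (a :: as))) :=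
    ((F1.mono (by decide) (by decide)).trans (F2.mono (by decide) (by decide))).setV _ (by simp)
  have C2 := hI.toCtx.fr F2' (by decide) (by decide)
  refine (HSpec.seq (calls_spec hP hf hp hs hD (e := as.length * 2 ^ 67) (a := a) (by omega) C2
    (by simp [F2.v 10 (by decide), h10]) (by rw [F2'.v 4 (by decide), hI.epoch]) ?_)
    (τ' := 100 * (P.m + 1)) ?_).mono (fun _ h => h) (by omega)
  · intro x hx
    rw [F2'.a 6 (by decide), F2'.a 7 (by decide)]
    exact hI.epochs x hx
  rintro H3 ⟨F3, h43, hE3, hans⟩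
  have h13 : H3.v 13 = 4 ^ as.length := by
    rw [F3.v 13 (by decide), F2'.v 13 (by decide), hI.pow]
  have h20 : (H2.setV 11 (total P (a :: as))).v 20 = H.v 20 := F2'.v 20 (by decide)
  have hpow : (Ex.bin .mul (.lit 4) (.var 13)).eval P.W H3 = 4 ^ (as.length + 1) := by
    rw [eval, eval, eval, h13, hf.lit (show 4 < 2 ^ 100 by norm_num), BinOp.eval_mul (by omega),
      pow_succ, mul_comm]
  refine (HSpec.asg (e := .bin .mul (.lit 4) (.var 13)) (by simp [Ok]) (by omega) ?_).mono
    (fun _ h => h) (by simp only [Ex.time]; omega)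
  rw [hpow]
  have F4 : Fr [4, 13, 14, 15, 16, 17, 18, 19, 20, 24, 31] [6, 7] (H2.setV 11 (total P (a :: as)))
      (H3.setV 13 (4 ^ (as.length + 1))) := (F3.mono (by decide) (by decide)).setV _ (by simp)
  have hlen' : (a :: as).length * 2 ^ 67 = as.length * 2 ^ 67 + 2 ^ 67 := by
    rw [List.length_cons]
    omega
  refine ⟨a, C2.fr F4 (by decide) (by decide), ?_, ?_, ?_, ?_, ?_, ?_, ?_⟩
  · intro i hi
    rw [F4.a 2 (by decide)]
    exact h2 i hi
  · rw [F4.v 11 (by decide)]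
    simp
  · refine hle.trans ?_
    rw [List.length_cons, pow_succ]
    have := hI.total_le
    nlinarith
  · simp
  · rw [hlen']
    simpa using h43
  · rw [hlen']
    exact hE3
  · rw [HS.setV_v, if_neg (by omega), hans, h20, hI.ans]
    simp only [List.mem_cons, exists_eq_or_imp, or_comm]

end WordRAM

/-! ### Parameters, the complete reduction and its running time -/

namespace WordRAM

open Ex

/-- Compute the size of the instances of `Convolution3SUM` and the block length. -/
def setSizes (κ : ℕ) : Prog :=
  .seq (asg 3 (.bin .shl (.lit 1) (.bin .mul (.var 1) (.lit (8 * κ)))))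
  (.seq (asg 21 (.bin .mul (.lit 8) (.var 1)))
  (.seq (cond (.bin .lt (.var 0) (.lit 64)) (asg 5 (.lit 64)) (asg 5 (.var 0)))
  (.seq (asg 6 (.lit 1))
  (whileDo (.bin .lt (.bin .mul (.lit 16) (.var 6)) (.bin .add (.var 5) (.lit 1)))
    (asg 6 (.bin .mul (.lit 2) (.var 6)))))))

/-- The quotient of the number of words by `e`, if it is an integer. -/
def quotEx (e : Ex) : Ex := .bin .add (.bin .div (.bin .sub (.lit 0) (.lit 1)) e) (.lit 1)

/-- Compute the other parameters. -/
def setParams : Prog :=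
  .seq (asg 7 (.bin .mul (.lit (2 ^ 22)) (.var 6))) (.seq (asg 8 (quotEx (.var 7)))
  (.seq (asg 9 (quotEx (.lit (2 ^ 22)))) (.seq (fillWeights (.lit 1))
  (.seq (asg 11 (.bin .add (.var 0) (.var 0))) (asg 13 (.lit 1))))))

/-- The rounds. -/
def rounds (p : Prog) : Prog :=
  whileDo (.bin .lt (.var 13) (.bin .add (.bin .add (.var 0) (.var 0)) (.lit 1))) (round p)

/-- The reduction, on a machine whose number of cells per array has been computed. -/
def driver (p : Prog) (κ : ℕ) : Prog :=
  .seq (setSizes κ) (.seq setParams (.seq (rounds p) (asg 0 (.var 20))))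

/-- The reduction from `3SUM` to `Convolution3SUM`, for `2 ^ (σ * w)` cells per array. -/
def reduction (p : Prog) (κ σ : ℕ) : Prog :=
  .seq (.const 2 σ) (.seq (.op .mul 2 2 1) (.seq (.const 40 1)
    (.seq (.op .shl 2 40 2) (driver p κ))))

variable {P : Inst} {S V D w' E : ℕ} {H : HS} {τ : ℕ} {p : Prog}

/-- The block length is found by doubling. It is the power of two with `8 * L ≤ m < 16 * L`, which
makes all moduli powers of two. -/
theorem setSizes_spec {W n w κ : ℕ} (h0 : H.v 0 = n) (h1 : H.v 1 = w) (hW : 100 ≤ W)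
    (hκ : 8 * κ < 2 ^ W) (hκw : w * (8 * κ) < W) (hn : 16 * (n + 64) < 2 ^ W) (hw : 8 * w < 2 ^ W) :
    HSpec W S (setSizes κ) H (fun H' => Fr [3, 5, 6, 21] [] H H' ∧ H'.v 3 = 2 ^ (w * (8 * κ)) ∧
      H'.v 21 = 8 * w ∧ H'.v 5 = max n 64 ∧ ∃ l, H'.v 6 = 2 ^ l ∧ 8 * 2 ^ l ≤ max n 64 ∧
        max n 64 < 16 * 2 ^ l) (100 * (max n 64 + 1)) := by
  set m := max n 64 with hm
  have h64 : 64 ≤ m := le_max_right _ _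
  have hmn : m ≤ n + 64 := by omega
  have hlit : ∀ {c}, c < 2 ^ 100 → c % 2 ^ W = c := fun hc =>
    Nat.mod_eq_of_lt (hc.trans_le (Nat.pow_le_pow_right (by omega) hW))
  have hone : 1 < 2 ^ W := (by norm_num : 1 < 2 ^ 100).trans_le (Nat.pow_le_pow_right (by omega) hW)
  have hWW : W < 2 ^ W := Nat.lt_two_pow_self
  refine (HSpec.seq (M := fun H' => Fr [3, 5, 6, 21] [] H H' ∧ H'.v 3 = 2 ^ (w * (8 * κ)))
    (HSpec.asg (by simp [Ok]) (by omega) ⟨(Fr.refl _ _ _).setV _ (by simp), ?_⟩)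
    (τ' := 90 * (m + 1)) ?_).mono (fun _ h => h) (by simp only [Ex.time]; omega)
  · simp only [HS.setV_v, if_true, eval, h1, Nat.mod_eq_of_lt hκ, Nat.mod_eq_of_lt hone]
    rw [BinOp.eval_mul (by omega)]
    change (1 <<< (w * (8 * κ))) % 2 ^ W = _
    rw [Nat.one_shiftLeft, Nat.mod_eq_of_lt (Nat.pow_lt_pow_right (by omega) hκw)]
  rintro H1 ⟨F1, e3⟩
  refine (HSpec.seq (M := fun H' => Fr [3, 5, 6, 21] [] H H' ∧ H'.v 3 = 2 ^ (w * (8 * κ)) ∧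
    H'.v 21 = 8 * w)
    (HSpec.asg (by simp [Ok]) (by omega) ⟨F1.setV _ (by simp), by simp [e3], ?_⟩)
    (τ' := 80 * (m + 1)) ?_).mono (fun _ h => h) (by simp only [Ex.time]; omega)
  · simp only [HS.setV_v, if_true, eval, F1.v 1 (by decide), h1, hlit (show 8 < 2 ^ 100 by norm_num)]
    exact BinOp.eval_mul hw
  rintro H2 ⟨F2, e3, e21⟩
  refine (HSpec.seq (τ := 20) (M := fun H' => Fr [3, 5, 6, 21] [] H H' ∧
    H'.v 3 = 2 ^ (w * (8 * κ)) ∧ H'.v 21 = 8 * w ∧ H'.v 5 = m)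
    ((HSpec.cond (τ := 5) (by simp [Ok]) (fun hlt => ?_) (fun hlt => ?_)).mono (fun _ h => h)
      (by simp only [Ex.time]; omega)) (τ' := 59 * (m + 1)) ?_).mono (fun _ h => h) (by omega)
  · refine (HSpec.asg (e := .lit 64) trivial (by omega)
      ⟨F2.setV _ (by simp), by simp [e3], by simp [e21], ?_⟩).mono (fun _ h => h)
      (by simp only [Ex.time]; omega)
    rw [eval, eval, eval, F2.v 0 (by decide), h0, hlit (show 64 < 2 ^ 100 by norm_num),
      BinOp.eval_ltOp _ _ hone] at hlt
    have : n < 64 := by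
      by_contra hc
      simp [hc] at hlt
    rw [HS.setV_v, if_pos rfl, eval, hlit (by norm_num)]
    omega
  · refine (HSpec.asg (e := .var 0) (by simp [Ok]) (by omega)
      ⟨F2.setV _ (by simp), by simp [e3], by simp [e21], ?_⟩).mono (fun _ h => h)
      (by simp only [Ex.time]; omega)
    rw [eval, eval, eval, F2.v 0 (by decide), h0, hlit (show 64 < 2 ^ 100 by norm_num),
      BinOp.eval_ltOp _ _ hone] at hlt
    have : ¬ n < 64 := by
      intro hc
      simp [hc] at hlt
    rw [HS.setV_v, if_pos rfl, eval, F2.v 0 (by decide), h0]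
    omega
  rintro H3 ⟨F3, e3, e21, e5⟩
  refine (HSpec.seq (M := fun H' => H' = H3.setV 6 1)
    (HSpec.asg (e := .lit 1) trivial (by omega) (by rw [eval, hlit (by norm_num)]))
    (τ' := 50 * (m + 1)) ?_).mono (fun _ h => h) (by simp only [Ex.time]; omega)
  rintro _ rfl
  have hcond : ∀ {H' : HS} {l : ℕ}, H'.v 5 = m → H'.v 6 = 2 ^ l → 8 * 2 ^ l ≤ m →
      (Ex.bin .lt (.bin .mul (.lit 16) (.var 6)) (.bin .add (.var 5) (.lit 1))).eval W H' =
        if 16 * 2 ^ l ≤ m then 1 else 0 := by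
    intro H' l q5 q6 q8
    simp only [eval, q5, q6, hlit (show 16 < 2 ^ 100 by norm_num), Nat.mod_eq_of_lt hone]
    rw [BinOp.eval_mul (by omega), BinOp.eval_add (by omega), BinOp.eval_ltOp _ _ hone]
    simp only [Nat.lt_succ_iff]
  refine (HSpec.whileDo (τ := 7) (fun f H' => ∃ l, f + l = m ∧ Fr [3, 5, 6, 21] [] H H' ∧
    H'.v 3 = 2 ^ (w * (8 * κ)) ∧ H'.v 21 = 8 * w ∧ H'.v 5 = m ∧ H'.v 6 = 2 ^ l ∧ 8 * 2 ^ l ≤ m)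
    (fun f H' _ => by simp [Ok]) ?_ m
    ⟨0, by omega, F3.setV _ (by simp), by simp [e3], by simp [e21], by simp [e5], by simp,
      by omega⟩).mono ?_ (by simp only [Ex.time]; omega)
  · rintro f H' ⟨l, hl, q1, q3, q21, q5, q6, q8⟩ hne
    rw [hcond q5 q6 q8] at hne
    have hle : 16 * 2 ^ l ≤ m := by
      by_contra hc
      simp [hc] at hne
    -- Since `l < 2 ^ l ≤ m`, a budget of `m` iterations is enough; time linear in `m` is spent
    -- anyway.
    have hlt : l < 2 ^ l := Nat.lt_two_pow_self
    refine ⟨f - 1, by omega, (HSpec.asg (e := .bin .mul (.lit 2) (.var 6)) (by simp [Ok]) (by omega)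
      ⟨l + 1, by omega, q1.setV _ (by simp), by simp [q3], by simp [q21], by simp [q5], ?_,
        by rw [pow_succ]; omega⟩).mono (fun _ h => h) (by simp only [Ex.time]; omega)⟩
    simp only [HS.setV_v, if_true, eval, q6, hlit (show 2 < 2 ^ 100 by norm_num)]
    rw [BinOp.eval_mul (by omega), pow_succ, mul_comm]
  · rintro H' ⟨⟨f, l, hl, q1, q3, q21, q5, q6, q8⟩, hz⟩
    refine ⟨q1, q3, q21, q5, l, q6, q8, ?_⟩
    rw [hcond q5 q6 q8] at hz
    by_contra hc
    simp [show 16 * 2 ^ l ≤ m by omega] at hz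

/-- The number `2 ^ W` is not a word. For a divisor `d > 1` one has `(2 ^ W - 1) / d = 2 ^ W / d -
1`, and the quotient is a word. -/
theorem eval_quotEx {W d : ℕ} {e : Ex} (hW : 1 < 2 ^ W) (hd : 1 < d) (hdvd : d ∣ 2 ^ W)
    (he : e.eval W H = d) : (quotEx e).eval W H = 2 ^ W / d := by
  obtain ⟨q, hq⟩ := hdvd
  have hq0 : 0 < q := by
    rcases Nat.eq_zero_or_pos q with rfl | h
    · simp at hq
    · exact h
  have h1 : (0 % 2 ^ W + (2 ^ W - 1 % 2 ^ W)) % 2 ^ W = 2 ^ W - 1 := by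
    rw [Nat.zero_mod, Nat.mod_eq_of_lt hW, zero_add, Nat.mod_eq_of_lt (by omega)]
  have h2 : (Ex.bin .sub (.lit 0) (.lit 1)).eval W H = 2 ^ W - 1 := h1
  have h3 : (2 ^ W - 1) / d = q - 1 := by
    obtain ⟨q, rfl⟩ : ∃ q', q = q' + 1 := ⟨q - 1, by omega⟩
    rw [hq, mul_add, mul_one, Nat.add_sub_assoc (by omega), Nat.mul_add_div (by omega),
      Nat.div_eq_of_lt (by omega)]
    omega
  have h4 : q < 2 ^ W := by
    rw [hq]
    exact (Nat.lt_mul_iff_one_lt_left hq0).2 hd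
  have h5 : (quotEx e).eval W H = BinOp.add.eval W
      (BinOp.div.eval W ((Ex.bin .sub (.lit 0) (.lit 1)).eval W H) (e.eval W H)) (1 % 2 ^ W) := rfl
  rw [h5, h2, he, BinOp.eval_div _ (by omega), h3, Nat.mod_eq_of_lt hW,
    BinOp.eval_add (by omega), hq, Nat.mul_div_cancel_left _ (by omega)]
  omega

theorem setParams_spec (hP : P.Valid) (hf : Fits P S V D w' E) (h0 : H.v 0 = P.n) (h3 : H.v 3 = 2 ^ V)
    (h5 : H.v 5 = P.m) (h6 : H.v 6 = P.L) (h21 : H.v 21 = w') (hx : ∀ i < P.n, H.a 0 i = P.X i)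
    (h4 : H.v 4 = 0) (h20 : H.v 20 = 0) (hE : Epochs S V 0 H) :
    HSpec P.W S setParams H (MainInv P S V w' []) (400 * (P.m + 1)) := by
  have hone := hf.one_lt
  have hle := hf.le
  have hRS := hf.R_le
  have hnS := hf.n_le
  have hL := hP.L_pos
  have hR : P.R = 2 ^ 22 * P.L := rfl
  have hnm := hP.n_le
  have h22 : (Ex.lit (2 ^ 22)).eval P.W H = 2 ^ 22 := hf.lit (by norm_num)
  refine (HSpec.seq (M := fun H' => H' = H.setV 7 P.R)
    (HSpec.asg (e := .bin .mul (.lit (2 ^ 22)) (.var 6)) (by simp [Ok]) (by omega) ?_)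
    (τ' := 380 * (P.m + 1)) ?_).mono (fun _ h => h) (by simp only [Ex.time]; omega)
  · rw [eval, h22, eval, h6, BinOp.eval_mul (by omega), hR]
  rintro _ rfl
  refine (HSpec.seq (M := fun H' => H' = (H.setV 7 P.R).setV 8 P.Mh)
    (HSpec.asg (e := quotEx (.var 7)) (by simp [Ok, quotEx]) (by omega) ?_)
    (τ' := 350 * (P.m + 1)) ?_).mono (fun _ h => h) (by simp only [Ex.time, quotEx]; omega)
  · rw [eval_quotEx hone (by omega : 1 < P.R) hP.dvd (by simp [eval])]
    rfl
  rintro _ rfl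
  refine (HSpec.seq (M := fun H' => H' = ((H.setV 7 P.R).setV 8 P.Mh).setV 9 P.Mc)
    (HSpec.asg (e := quotEx (.lit (2 ^ 22))) (by simp [Ok, quotEx]) (by omega) ?_)
    (τ' := 320 * (P.m + 1)) ?_).mono (fun _ h => h) (by simp only [Ex.time, quotEx]; omega)
  · rw [eval_quotEx hone (by norm_num : 1 < 2 ^ 22) ((Dvd.intro _ rfl).trans hP.dvd)
      (hf.lit (by norm_num))]
    rfl
  rintro H1 hH1
  have F1 : Fr [7, 8, 9] [] H H1 := by
    rw [hH1]
    exact (((Fr.refl _ _ _).setV _ (by simp)).setV _ (by simp)).setV _ (by simp)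
  have C1 : Ctx P V w' H1 :=
    { n := by rw [F1.v 0 (by decide), h0]
      q := by rw [F1.v 3 (by decide), h3]
      m := by rw [F1.v 5 (by decide), h5]
      L := by rw [F1.v 6 (by decide), h6]
      R := by simp [hH1]
      Mh := by simp [hH1]
      Mc := by simp [hH1]
      w' := by rw [F1.v 21 (by decide), h21]
      x := fun i hi => by rw [F1.a 0 (by decide), hx i hi] }
  clear hH1
  refine (HSpec.seq (fillWeights_spec hf C1 (ex := .lit 1) (g := fun _ => 1)
    (fun i hi H' hF h14 => ⟨trivial, hf.lit (by norm_num)⟩) (by simp [Ex.time]))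
    (τ' := 100 * (P.m + 1)) ?_).mono (fun _ h => h) (by omega)
  rintro H2 ⟨F2, hw⟩
  have F2' : Fr [7, 8, 9, 14] [2] H H2 :=
    (F1.mono (by decide) (by decide)).trans (F2.mono (by decide) (by decide))
  refine (HSpec.seq (M := fun H' => H' = H2.setV 11 (2 * P.n))
    (HSpec.asg (e := .bin .add (.var 0) (.var 0)) (by simp [Ok]) (by omega) ?_)
    (τ' := 50 * (P.m + 1)) ?_).mono (fun _ h => h) (by simp only [Ex.time]; omega)
  · rw [eval, eval, F2'.v 0 (by decide), h0, BinOp.eval_add (by omega), two_mul]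
  rintro _ rfl
  refine (HSpec.asg (e := .lit 1) trivial (by omega) ?_).mono (fun _ h => h)
    (by simp only [Ex.time]; omega)
  have F3 : Fr [11, 13, 14] [2] H1 ((H2.setV 11 (2 * P.n)).setV 13 1) :=
    ((F2.mono (by decide) (by decide)).setV _ (by simp)).setV _ (by simp)
  rw [eval, hf.lit (by norm_num)]
  refine ⟨C1.fr F3 (by decide) (by decide), ?_, ?_, ?_, ?_, ?_, ?_, ?_⟩
  · intro i hi
    simpa [weight] using hw i hi
  · simp [total, weight]
  · simp [total, weight]
  · simp
  · rw [F3.v 4 (by decide), F1.v 4 (by decide), h4]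
    simp
  · intro x hx
    rw [F3.a 6 (by decide), F3.a 7 (by decide), F1.a 6 (by decide), F1.a 7 (by decide)]
    simpa using hE x hx
  · rw [F3.v 20 (by decide), F1.v 20 (by decide), h20]
    simp

/-- A bound for the number of rounds. -/
def numRounds (n : ℕ) : ℕ := Nat.log 4 (2 * n) + 1

/-- While the loop runs, `4 ^ r ≤ 2 * n`, which bounds the number of rounds; once it ends,
`Inst.Valid.exists_vec_iff` applies. -/
theorem rounds_spec (hP : P.Valid) (hf : Fits P S V D w' (numRounds P.n * 2 ^ 67))
    (hp : p.RegsBelow D) (hs : Solves p V w' P.m τ) (hD : 16 * P.D + 13 ≤ 2 ^ (w' - 1))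
    (hI : MainInv P S V w' [] H) :
    HSpec P.W S (rounds p) H (fun H' => H'.v 20 ≠ 0 ↔ threeSum.IsYes P.n fun i : Fin P.n => P.x i)
      (numRounds P.n * (2 ^ 67 * (2500 * (P.m + 1) + 200 * τ) + 3100 * (P.m + 1)) + 20) := by
  have hone := hf.one_lt
  have hle := hf.le
  have hnS := hf.n_le
  have hcond : ∀ {as H'}, MainInv P S V w' as H' →
      (Ex.bin .lt (.var 13) (.bin .add (.bin .add (.var 0) (.var 0)) (.lit 1))).eval P.W H' =
        if 4 ^ as.length ≤ 2 * P.n then 1 else 0 := by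
    intro as H' hI
    simp only [eval, hI.n, hI.pow, hf.lit (show 1 < 2 ^ 100 by norm_num)]
    rw [BinOp.eval_add (a := P.n) (by omega), BinOp.eval_add (by omega), BinOp.eval_ltOp _ _ hone]
    simp only [Nat.lt_succ_iff, two_mul]
  set Z := 2 ^ 67 * (2500 * (P.m + 1) + 200 * τ) with hZ
  refine (HSpec.whileDo (τ := Z + 3000 * (P.m + 1))
    (fun f H' => ∃ as, f + as.length = numRounds P.n ∧ MainInv P S V w' as H')
    (fun f H' _ => by simp [Ok]) ?_ (numRounds P.n) ⟨[], by simp, hI⟩).mono ?_ ?_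
  · rintro f H' ⟨as, hf', hI'⟩ hne
    rw [hcond hI'] at hne
    have hlen : 4 ^ as.length ≤ 2 * P.n := by
      by_contra hc
      simp [hc] at hne
    have hlog : as.length ≤ Nat.log 4 (2 * P.n) := Nat.le_log_of_pow_le (by omega) hlen
    have hlog' : as.length + 1 ≤ numRounds P.n := by
      rw [numRounds]
      omega
    refine ⟨f - 1, by omega, (round_spec hP hf hp hs hD (by gcongr) hI' hlen).mono ?_ le_rfl⟩
    rintro H'' ⟨a, ha⟩
    exact ⟨a :: as, by rw [List.length_cons]; omega, ha⟩
  · rintro H' ⟨⟨f, as, -, hI'⟩, hz⟩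
    rw [hcond hI'] at hz
    have hlen : 2 * P.n < 4 ^ as.length := by
      by_contra hc
      simp [show 4 ^ as.length ≤ 2 * P.n by omega] at hz
    rw [hI'.ans]
    exact hP.exists_vec_iff as hI'.total_le hlen
  · simp only [Ex.time]
    have : numRounds P.n * (Z + 3000 * (P.m + 1) + (1 + (1 + 1 + 3 + 1 + 3) + 3) + 2) ≤
      numRounds P.n * (Z + 3100 * (P.m + 1)) := Nat.mul_le_mul_left _ (by omega)
    clear_value Z
    clear hf
    linarith

/-- A bound for the expected running time of the reduction. -/
def reductionTime (n τ : ℕ) : ℕ :=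
  numRounds n * (2 ^ 67 * (2500 * (max n 64 + 1) + 200 * τ) + 3100 * (max n 64 + 1)) +
    1000 * (max n 64 + 1)

/-- The instance that is given to the reduction, with blocks of length `2 ^ l`. -/
def toInst {n : ℕ} (A : Fin n → ℤ) (w W l : ℕ) : Inst where
  n := n
  m := max n 64
  W := W
  L := 2 ^ l
  D := 2 ^ (w - 1)
  x i := if h : i < n then A ⟨i, h⟩ else 0

theorem numRounds_le (n : ℕ) : numRounds n ≤ 2 * n + 1 := by
  rw [numRounds]
  have := Nat.log_le_self 4 (2 * n)
  omega

section params

variable {n w W σ κ l : ℕ} {A : Fin n → ℤ}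

theorem valid_toInst (hA : Function.Injective A) (hw : 1 ≤ w) (hn : n < 2 ^ w)
    (hb : ∀ i, -(2 ^ (w - 1)) ≤ A i ∧ A i < 2 ^ (w - 1)) (hW : 100 * w ≤ W)
    (h8 : 8 * 2 ^ l ≤ max n 64) (h16 : max n 64 < 16 * 2 ^ l) : (toInst A w W l).Valid := by
  have hlw : l ≤ 6 + w := by
    have h1 : 2 ^ l ≤ 2 ^ (6 + w) := by
      rw [pow_add]
      have : 1 ≤ 2 ^ w := Nat.one_le_two_pow
      omega
    exact (Nat.pow_le_pow_iff_right (by omega)).1 h1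
  have hR : (toInst A w W l).R = 2 ^ (22 + l) := by
    rw [Inst.R, pow_add]
    rfl
  have hN : (toInst A w W l).N = 2 ^ W := rfl
  have hMh : (toInst A w W l).Mh = 2 ^ (W - (22 + l)) := by
    rw [Inst.Mh, hR, hN, Nat.pow_div (by omega) (by omega)]
  have hMc : (toInst A w W l).Mc = 2 ^ (W - 22) := by
    rw [Inst.Mc, hN, Nat.pow_div (by omega) (by omega)]
  constructor
  · intro i hi j hj h
    simp only [toInst] at h hi hj
    rw [dif_pos hi, dif_pos hj] at h
    simpa using hA h
  · intro i hi
    simp only [toInst] at hi ⊢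
    rw [dif_pos hi]
    push_cast
    exact (hb _).1
  · intro i hi
    simp only [toInst] at hi ⊢
    rw [dif_pos hi]
    push_cast
    exact (hb _).2
  · rw [hMh]
    change 2 * 2 ^ (w - 1) ≤ _
    rw [← pow_succ']
    exact Nat.pow_le_pow_right (by omega) (by omega)
  · exact le_max_left _ _
  · exact h8
  · exact h16
  · rw [hR, hN]
    exact pow_dvd_pow 2 (by omega)
  · rw [hMc]
    exact hn.le.trans (Nat.pow_le_pow_right (by omega) (by omega))

/-- Each array has `2 ^ (σ * w)` cells, enough for the whole simulated address space. The word
length exceeds twice `σ * w` by `100 * w` bits, which leaves room for epochs and weights. -/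
theorem fits_toInst (hw : 1 ≤ w) (hn : n < 2 ^ w) (hκ : 1 ≤ κ) (hσ : 8 * κ + D + 100 ≤ σ)
    (hW : W = (2 * σ + 100) * w) (hD : 2 ≤ D) (h8 : 8 * 2 ^ l ≤ max n 64) :
    Fits (toInst A w W l) (2 ^ (σ * w)) (w * (8 * κ)) D (8 * w) (numRounds n * 2 ^ 67) := by
  have e1 : (8 * κ + D + 100) * w ≤ σ * w := by gcongr
  have e2 : D * 1 ≤ D * w := by gcongr
  have e3 : 1 * w ≤ κ * w := by gcongr
  have e4 : w * (8 * κ) = 8 * (κ * w) := by ring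
  rw [add_mul, mul_assoc] at hW
  rw [add_mul, add_mul, mul_assoc] at e1
  have h64 : 64 < 2 ^ (8 * w) := lt_of_lt_of_le (by norm_num : 64 < 2 ^ 8)
    (Nat.pow_le_pow_right (by omega) (by omega))
  have hn8 : n < 2 ^ (8 * w) := hn.trans_le (Nat.pow_le_pow_right (by omega) (by omega))
  constructor
  · change 2 ^ 3 * 2 ^ (σ * w) ≤ 2 ^ W
    rw [← pow_add]
    exact Nat.pow_le_pow_right (by omega) (by omega)
  · change w * (8 * κ) ≤ W
    omega
  · exact Nat.pow_le_pow_right (by omega) (by omega)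
  · exact Nat.lt_two_pow_self.le.trans (Nat.pow_le_pow_right (by omega) (by omega))
  · exact hD
  · change (numRounds n * 2 ^ 67 + 1) * 2 ^ (w * (8 * κ)) ≤ 2 ^ W
    have h1 : numRounds n * 2 ^ 67 + 1 ≤ 2 ^ (w + 2 + 68) := by
      have := numRounds_le n
      rw [pow_add, pow_add]
      omega
    calc _ ≤ 2 ^ (w + 2 + 68) * 2 ^ (w * (8 * κ)) := by gcongr
      _ ≤ 2 ^ W := by
        rw [← pow_add]
        exact Nat.pow_le_pow_right (by omega) (by omega)
  · change 2 * n ≤ _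
    calc 2 * n ≤ 2 ^ (w + 1) := by rw [pow_succ]; omega
      _ ≤ _ := Nat.pow_le_pow_right (by omega) (by omega)
  · change 2 ^ 22 * 2 ^ l ≤ _
    have h1 : 2 ^ l ≤ 2 ^ (8 * w) := by omega
    calc 2 ^ 22 * 2 ^ l ≤ 2 ^ 22 * 2 ^ (8 * w) := by gcongr
      _ ≤ _ := by
        rw [← pow_add]
        exact Nat.pow_le_pow_right (by omega) (by omega)
  · change max n 64 < _
    calc max n 64 < 2 ^ (8 * w) := by omega
      _ ≤ _ := Nat.pow_le_pow_right (by omega) (by omega)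
  · calc 8 * w < 2 ^ (8 * w) := Nat.lt_two_pow_self
      _ ≤ _ := Nat.pow_le_pow_right (by omega) (by omega)
  · change 100 ≤ W
    omega
  · change 2 ^ 20 * (2 * n + 1) ^ 2 ≤ 2 ^ W
    have h1 : 2 * n + 1 ≤ 2 ^ (w + 1) := by rw [pow_succ]; omega
    calc _ ≤ 2 ^ 20 * (2 ^ (w + 1)) ^ 2 := by gcongr
      _ ≤ _ := by
        rw [← pow_mul, ← pow_add]
        exact Nat.pow_le_pow_right (by omega) (by omega)

theorem driver_spec (hA : Function.Injective A) (hw : 1 ≤ w) (hn : n < 2 ^ w)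
    (hb : ∀ i, -(2 ^ (w - 1)) ≤ A i ∧ A i < 2 ^ (w - 1)) (hκ : 1 ≤ κ) (hσ : 8 * κ + D + 100 ≤ σ)
    (hW : W = (2 * σ + 100) * w) (hD : 2 ≤ D) (hp : p.RegsBelow D)
    (hs : Solves p (w * (8 * κ)) (8 * w) (max n 64) τ) (h0 : H.v 0 = n) (h1 : H.v 1 = w)
    (h4 : H.v 4 = 0) (h20 : H.v 20 = 0) (hx : ∀ i : Fin n, H.a 0 i = (A i % 2 ^ W).toNat)
    (hE : Epochs (2 ^ (σ * w)) (w * (8 * κ)) 0 H) :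
    HSpec W (2 ^ (σ * w)) (driver p κ) H (fun H' => H'.v 0 ≠ 0 ↔ threeSum.IsYes n A)
      (reductionTime n τ - 10) := by
  have e1 : (2 * σ + 100) * 1 ≤ (2 * σ + 100) * w := by gcongr
  have e2 : (8 * κ) * w ≤ σ * w := by gcongr; omega
  have hW' : W = 2 * (σ * w) + 100 * w := by rw [hW]; ring
  have hκW : 8 * κ < 2 ^ W := lt_of_lt_of_le Nat.lt_two_pow_self
    (Nat.pow_le_pow_right (by omega) (by omega))
  have h7 : 16 * (n + 64) < 2 ^ W := by
    have h1 : 16 * (n + 64) < 2 ^ (w + 12) := by rw [pow_add]; omega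
    exact h1.trans_le (Nat.pow_le_pow_right (by omega) (by omega))
  have h8w : 8 * w < 2 ^ W :=
    Nat.lt_two_pow_self.trans_le (Nat.pow_le_pow_right (by omega) (by omega))
  have hT : reductionTime n τ = numRounds n * (2 ^ 67 * (2500 * (max n 64 + 1) + 200 * τ) +
    3100 * (max n 64 + 1)) + 1000 * (max n 64 + 1) := rfl
  set Z := numRounds n * (2 ^ 67 * (2500 * (max n 64 + 1) + 200 * τ) + 3100 * (max n 64 + 1))
    with hZ
  refine (HSpec.seq (setSizes_spec h0 h1 (by omega) hκW (by nlinarith) h7 h8w)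
    (τ' := Z + 500 * (max n 64 + 1)) ?_).mono (fun _ h => h) (by omega)
  rintro H1 ⟨F1, q3, q21, q5, l, q6, l8, l16⟩
  have hP := valid_toInst (A := A) hA hw hn hb (show 100 * w ≤ W by omega) l8 l16
  have hf := fits_toInst (A := A) hw hn hκ hσ hW hD l8
  refine (HSpec.seq (setParams_spec (P := toInst A w W l) hP hf (by rw [F1.v 0 (by decide), h0]; rfl)
    q3 q5 q6 q21 ?_ (by rw [F1.v 4 (by decide), h4]) (by rw [F1.v 20 (by decide), h20]) ?_)
    (τ' := Z + 50 * (max n 64 + 1)) ?_).mono (fun _ h => h)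
    (by change _ + 400 * (max n 64 + 1) + _ ≤ _; omega)
  · intro i hi
    have := hx ⟨i, hi⟩
    rw [F1.a 0 (by decide), this, Inst.X, Inst.N]
    simp only [toInst] at hi ⊢
    rw [dif_pos hi]
    push_cast
    rfl
  · intro x hx
    rw [F1.a 6 (by decide), F1.a 7 (by decide)]
    exact hE x hx
  intro H2 hI
  have hD' : 16 * (toInst A w W l).D + 13 ≤ 2 ^ (8 * w - 1) := by
    change 16 * 2 ^ (w - 1) + 13 ≤ _
    have h2 : 2 ^ (w - 1 + 5) ≤ 2 ^ (8 * w - 1) := Nat.pow_le_pow_right (by omega) (by omega)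
    have h3 : 1 ≤ 2 ^ (w - 1) := Nat.one_le_two_pow
    rw [pow_add] at h2
    omega
  refine (HSpec.seq (rounds_spec (τ := τ) hP hf hp hs hD' hI) (τ' := 5) ?_).mono (fun _ h => h)
    (by change 1 + (Z + 20) + 5 ≤ _; omega)
  intro H3 h3
  refine (HSpec.asg (e := .var 20) (by simp [Ok]) (by omega) ?_).mono (fun _ h => h)
    (by simp only [Ex.time]; omega)
  rw [HS.setV_v, if_pos rfl, eval, h3]
  have : (fun i : Fin n => (toInst A w W l).x i) = A := by
    funext i
    simp [toInst]
  change threeSum.IsYes n (fun i : Fin n => (toInst A w W l).x i) ↔ _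
  rw [this]

theorem reduction_spec (hA : Function.Injective A) (hw : 1 ≤ w) (hn : n < 2 ^ w)
    (hb : ∀ i, -(2 ^ (w - 1)) ≤ A i ∧ A i < 2 ^ (w - 1)) (hκ : 1 ≤ κ) (hσ : 8 * κ + D + 100 ≤ σ)
    (hW : W = (2 * σ + 100) * w) (hD : 2 ≤ D) (hp : p.RegsBelow D)
    (hs : Solves p (w * (8 * κ)) (8 * w) (max n 64) τ) :
    Spec W (reduction p κ σ) (start W p w A).2 (fun s => s.reg 0 ≠ 0 ↔ threeSum.IsYes n A)
      (reductionTime n τ) := by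
  have e1 : (2 * σ + 100) * 1 ≤ (2 * σ + 100) * w := by gcongr
  have e2 : 100 * w ≤ σ * w := by gcongr; omega
  have hW' : W = 2 * (σ * w) + 100 * w := by rw [hW]; ring
  have hWW : W < 2 ^ W := Nat.lt_two_pow_self
  have hσw : σ ≤ σ * w := Nat.le_mul_of_pos_right _ hw
  have hS8 : 8 * 2 ^ (σ * w) ≤ 2 ^ W := by
    change 2 ^ 3 * 2 ^ (σ * w) ≤ 2 ^ W
    rw [← pow_add]
    exact Nat.pow_le_pow_right (by omega) (by omega)
  have hS0 : 0 < 2 ^ (σ * w) := Nat.two_pow_pos _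
  have hnS : n < 2 ^ (σ * w) := hn.trans_le (Nat.pow_le_pow_right (by omega) (by omega))
  have hT : 1000 ≤ reductionTime n τ := by
    rw [reductionTime]
    omega
  set S := 2 ^ (σ * w) with hS
  refine (Spec.seq (strictSpec_const 2 σ).spec (τ' := reductionTime n τ - 2) ?_).mono (fun _ h => h)
    (by omega)
  rintro _ rfl
  refine (Spec.seq (strictSpec_op .mul 2 2 1).spec (τ' := reductionTime n τ - 4) ?_).mono
    (fun _ h => h) (by omega)
  rintro _ rfl
  refine (Spec.seq (strictSpec_const 40 1).spec (τ' := reductionTime n τ - 6) ?_).mono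
    (fun _ h => h) (by omega)
  rintro _ rfl
  refine (Spec.seq (strictSpec_op .shl 2 40 2).spec (τ' := reductionTime n τ - 8) ?_).mono
    (fun _ h => h) (by omega)
  rintro s hs'
  have hmem : s.mem = (start W p w A).2.mem := by rw [hs']; rfl
  have hreg : ∀ r < 32, s.reg r = if r = 0 then n else if r = 1 then w else if r = 2 then S else 0 := by
    intro r hr
    have h40 : r ≠ 40 := by omega
    rw [hs']
    by_cases h2 : r = 2
    · subst h2
      simp only [Store.setReg_reg, start, BinOp.eval, if_true, show ¬ (40 = 2) by omega,
        show ¬ (2 = 40) by omega, show ¬ (1 = 2) by omega, show ¬ (2 = 0) by omega,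
        show ¬ (2 = 1) by omega, show ¬ (1 = 0) by omega, if_false]
      rw [Nat.mod_eq_of_lt (by omega : 1 < 2 ^ W), Nat.mod_eq_of_lt (by omega : σ < 2 ^ W),
        Nat.mod_eq_of_lt (by omega : σ * w < 2 ^ W), Nat.one_shiftLeft, Nat.mod_eq_of_lt (by omega)]
    · simp only [Store.setReg_reg, start, h2, h40, if_false]
  have hmlt : ∀ x, s.mem x < 2 ^ W := by
    intro x
    rw [hmem]
    simp only [start]
    split_ifs with h
    · have h2 : (0 : ℤ) < 2 ^ W := by positivity
      have h3 := Int.emod_nonneg (A ⟨x, h⟩) h2.ne'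
      have h4 := Int.emod_lt_of_pos (A ⟨x, h⟩) h2
      zify
      rwa [Int.toNat_of_nonneg h3]
    · exact Nat.two_pow_pos W
  have hmz : ∀ x, S ≤ x → s.mem x = 0 := by
    intro x hx
    rw [hmem]
    exact dif_neg (by omega)
  -- The input lies in cells below `n < S`, so it is array 0, and the other arrays start as zero.
  have habs : Abs W S s ⟨fun r => if r = 0 then n else if r = 1 then w else if r = 2 then S else 0,
      fun j i => s.mem (j * S + i)⟩ := by
    refine ⟨hreg, fun _ _ _ _ => rfl, fun r hr => ?_, fun _ _ _ _ => hmlt _, rfl, hS8⟩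
    simp only
    have : w ≤ 100 * w := by omega
    split_ifs <;> omega
  have hspec := driver_spec (τ := τ) (H := ⟨fun r => if r = 0 then n else if r = 1 then w else
    if r = 2 then S else 0, fun j i => s.mem (j * S + i)⟩) hA hw hn hb hκ hσ hW hD hp hs rfl rfl rfl
    rfl ?_ ?_ s habs
  · refine hspec.mono ?_ (by omega)
    rintro s' ⟨H', h1, h2⟩
    rw [h1.reg 0 (by omega)]
    exact h2
  · intro i
    simp [hmem, start]
  · intro x hx
    simp only
    rw [hmz _ (by omega), hmz _ (by omega)]
    simp

end params

/-- Declaring the entries to have `8 * w` bits makes room for the tags and for the length `max n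
64`, even for `w = 1`. -/
theorem solves_of_isLasVegasAlgorithm {κ w m : ℕ} {T : ℕ → ℝ≥0} (hw : 1 ≤ w) (hm : m < 2 ^ (8 * w))
    (h : IsLasVegasAlgorithm convolutionThreeSum p κ T) :
    Solves p (w * (8 * κ)) (8 * w) m ⌈T m⌉₊ := by
  intro f hf N
  have hV : w * (8 * κ) = κ * (8 * w) := by ring
  obtain ⟨h1, h2⟩ := h m (8 * w) (fun k => f k) trivial (by omega) hm fun k => hf k k.2
  rw [hV]
  refine cost_penalty_le (P := fun t => t.reg 0 ≠ 0 ↔ convolutionThreeSum.IsYes m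
    fun k : Fin m => f k) (fun t c hc hh => h1 t c hc hh) (h2.trans ?_) N
  have := Nat.le_ceil (T m)
  exact_mod_cast this

theorem isLasVegasAlgorithm_reduction {κ σ : ℕ} {T : ℕ → ℝ≥0} (hκ : 1 ≤ κ)
    (hσ : 8 * κ + D + 100 ≤ σ) (hD : 2 ≤ D) (hp : p.RegsBelow D)
    (h : IsLasVegasAlgorithm convolutionThreeSum p κ T) :
    IsLasVegasAlgorithm threeSum (reduction p κ σ) (2 * σ + 100)
      fun n => reductionTime n ⌈T (max n 64)⌉₊ := by
  intro n w A hA hw hn hb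
  have hm : max n 64 < 2 ^ (8 * w) := by
    have h1 : 2 ^ w ≤ 2 ^ (8 * w) := Nat.pow_le_pow_right (by omega) (by omega)
    have h2 : 2 ^ 8 ≤ 2 ^ (8 * w) := Nat.pow_le_pow_right (by omega) (by omega)
    omega
  have hspec := reduction_spec (W := (2 * σ + 100) * w) hA hw hn hb hκ hσ rfl hD hp
    (solves_of_isLasVegasAlgorithm hw hm h)
  refine safe_and_expectedTime_le (P := fun s => s.reg 0 ≠ 0 ↔ threeSum.IsYes n A)
    ENNReal.coe_ne_top fun N => ?_
  refine (hspec _ [] N 0 fun s' hs' => ?_).trans (by simp)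
  cases N with
  | zero => rw [cost_zero]
  | succ N => rw [cost_nil, penalty, if_pos hs']

/-- From `4 ^ k ≤ 2 * n ≤ n ^ 2` and `log 4 ≥ 1` it follows that `k ≤ 2 * log n`, and the last round
is paid by `log n ≥ 1`. -/
theorem numRounds_le_log {n : ℕ} (hn : 64 ≤ n) : (numRounds n : ℝ) ≤ 3 * Real.log n := by
  have hn' : (64 : ℝ) ≤ n := by exact_mod_cast hn
  have h4 : 1 ≤ Real.log 4 := by
    rw [Real.le_log_iff_exp_le (by norm_num)]
    linarith [Real.exp_one_lt_d9]
  have h1 : 1 ≤ Real.log n := h4.trans (Real.log_le_log (by norm_num) (by linarith))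
  have hpow : (4 : ℝ) ^ Nat.log 4 (2 * n) ≤ (n : ℝ) ^ 2 := by
    have : 4 ^ Nat.log 4 (2 * n) ≤ 2 * n := Nat.pow_log_le_self 4 (by omega)
    have h2 : (4 : ℝ) ^ Nat.log 4 (2 * n) ≤ 2 * n := by exact_mod_cast this
    nlinarith
  have h3 := Real.log_le_log (by positivity) hpow
  rw [Real.log_pow, Real.log_pow] at h3
  have h5 : (Nat.log 4 (2 * n) : ℝ) ≤ Nat.log 4 (2 * n) * Real.log 4 :=
    le_mul_of_one_le_right (by positivity) h4
  rw [numRounds]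
  push_cast at h3 ⊢
  linarith

theorem reductionTime_le {n : ℕ} {t : ℝ≥0} (hn : 64 ≤ n) (ht : (((n - 1) / 2 : ℕ) : ℝ≥0) ≤ t) :
    (reductionTime n ⌈t⌉₊ : ℝ) ≤ 2 ^ 90 * (Real.log n * t) := by
  have hlog := numRounds_le_log hn
  have hn' : (64 : ℝ) ≤ n := by exact_mod_cast hn
  have h0 : (0 : ℝ) ≤ numRounds n := by positivity
  have h1 : (1 : ℝ) ≤ numRounds n := by
    rw [numRounds]
    push_cast
    linarith [Nat.cast_nonneg (α := ℝ) (Nat.log 4 (2 * n))]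
  have hceil : ((⌈t⌉₊ : ℕ) : ℝ) ≤ t + 1 := by
    have := (Nat.ceil_lt_add_one (show 0 ≤ t from bot_le)).le
    exact_mod_cast this
  have ht' : ((n : ℝ) - 2) / 2 ≤ t := by
    have h2 : (((n - 1) / 2 : ℕ) : ℝ) ≤ t := by exact_mod_cast ht
    have h3 : n ≤ 2 * ((n - 1) / 2) + 2 := by omega
    have h4 : (n : ℝ) ≤ 2 * ((n - 1) / 2 : ℕ) + 2 := by exact_mod_cast h3
    linarith
  -- Here the lower bound for `t` turns all the work linear in `n` into a multiple of `t`.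
  have hn4 : (n : ℝ) + 1 ≤ 4 * t := by linarith
  have hc2 : ((⌈t⌉₊ : ℕ) : ℝ) ≤ 2 * t := by linarith
  have ht0 : (0 : ℝ) ≤ t := t.2
  rw [reductionTime, max_eq_left hn]
  push_cast
  have h5 : 1000 * ((n : ℝ) + 1) ≤ numRounds n * (1000 * (4 * (t : ℝ))) := by
    nlinarith [mul_le_mul_of_nonneg_right h1 ht0]
  rw [show (147573952589676412928 : ℝ) = 2 ^ 67 by norm_num]
  calc (numRounds n : ℝ) * (2 ^ 67 * (2500 * (n + 1) + 200 * ⌈t⌉₊) + 3100 * (n + 1)) +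
        1000 * (n + 1) ≤
      numRounds n * (2 ^ 67 * (2500 * (4 * (t : ℝ)) + 200 * (2 * (t : ℝ))) + 3100 * (4 * (t : ℝ))) +
        numRounds n * (1000 * (4 * (t : ℝ))) := by
        gcongr
    _ = numRounds n * ((2 ^ 67 * 10400 + 16400) * (t : ℝ)) := by ring
    _ ≤ (3 * Real.log n) * ((2 ^ 67 * 10400 + 16400) * (t : ℝ)) := by gcongr
    _ = (3 * (2 ^ 67 * 10400 + 16400)) * (Real.log n * (t : ℝ)) := by ring
    _ ≤ 2 ^ 90 * (Real.log n * (t : ℝ)) := by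
        have : 0 ≤ Real.log n * (t : ℝ) := mul_nonneg (by linarith) ht0
        gcongr
        norm_num

end WordRAM

open WordRAM

theorem mainTheorem3 :
    ∃ (C : ℝ≥0) (n₀ : ℕ), ∀ T : ℕ → ℝ≥0, LasVegasComplexityLE convolutionThreeSum T →
      ∃ T' : ℕ → ℝ≥0, LasVegasComplexityLE threeSum T' ∧
        ∀ n : ℕ, n₀ ≤ n → (T' n : ℝ) ≤ C * (Real.log n * T n) := by
  refine ⟨2 ^ 90, 64, fun T ⟨p, κ, hκ, h⟩ => ?_⟩
  obtain ⟨D, hD⟩ := p.exists_regsBelow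
  -- For `n ≥ 64` the bound involves `T` at `n` only. The 2 in `D + 2` ensures that registers 0 and
  -- 1 are among the simulated ones.
  refine ⟨fun n => reductionTime n ⌈T (max n 64)⌉₊, ⟨reduction p κ (8 * κ + (D + 2) + 100),
    2 * (8 * κ + (D + 2) + 100) + 100, by omega, isLasVegasAlgorithm_reduction hκ le_rfl (by omega)
      (hD.mono (by omega)) h⟩, fun n hn => ?_⟩
  have := reductionTime_le hn (le_of_isLasVegasAlgorithm h n)
  simp only [max_eq_left hn]
  exact_mod_cast this
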